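/- **Proposition 2.1.** Let $\mathbb K$ be a field, and work with categories whose objects form a set of a fixed universe containing $\mathbb K$ and all morphism spaces. A *non-unital $A_\infty$ category* $\mathcal A$ has a set of objects, $\mathbb Z$-graded $\mathbb K$-vector spaces $\mathcal A(X,Y)$, and, for all $n\ge 1$, linear maps $m_n\colon \mathcal A(X_{n-1},X_n)\otimes\cdots\otimes\mathcal A(X_0,X_1)\to\mathcal A(X_0,X_n)$ of degree $2-n$ such that, for every $n\ge1$, $$\sum_{j+k+l=n,\;k\ge1}(-1)^{jk+l}\,m_{j+1+l}\,(\mathrm{id}^{\otimes j}\otimes m_k\otimes \mathrm{id}^{\otimes l})=0 .$$ It is *strictly unital* if every object $X$ has $\mathrm{id}_X\in\mathcal A(X,X)^0$ with $m_1(\mathrm{id}_X)=0$, $m_2(f,\mathrm{id}_X)=f$, $m_2(\mathrm{id}_X,f)=f$ whenever these are defined, and $m_n(\ldots,\mathrm{id}_X,\ldots)=0$ for $n>2$. An *$A_\infty$ functor* $F\colon\mathcal A\to\mathcal B$ is a map $F^0$ on objects together with linear maps $F^n\colon \mathcal A(X_{n-1},X_n)\otimes\cdots\otimes\mathcal A(X_0,X_1)\to\mathcal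 B(F^0X_0,F^0X_n)$ of degree $1-n$ ($n\ge1$) such that, for every $n\ge1$, $$\sum_{j+k+l=n,\;k\ge1}(-1)^{jk+l}F^{j+1+l}(\mathrm{id}^{\otimes j}\otimes m_k^{\mathcal A}\otimes\mathrm{id}^{\otimes l})=\sum_{\substack{1\le r\le n\\ s_1+\cdots+s_r=n}}(-1)^{\sum_{u}(1-s_u)\sum_{v>u}s_v}\,m^{\mathcal B}_r(F^{s_r}\otimes\cdots\otimes F^{s_1}).$$ The Koszul sign rule applies when tensor products of maps are evaluated. Composition is $(G\circ F)^n=\sum(-1)^{\sum_u(1-s_u)\sum_{v>u}s_v}\,G^r(F^{s_r}\otimes\cdots\otimes F^{s_1})$, the sum being over the same indices. If $\mathcal A,\mathcal B$ are strictly unital, $F$ is *strictly unital* if $F^1(\mathrm{id}_X)=\mathrm{id}_{F^0X}$ and $F^n(\ldots,\mathrm{id}_X,\ldots)=0$ for $n>1$. Let $\mathbf{A_\infty Cat}$ be the category of strictly unital $A_\infty$ categories and strictly unital $A_\infty$ functors. Let $\mathbf{dgCat}$ be the category whose objects are the dg categories (strictly unital $A_\infty$ categories with $m_n=0$ for $n>2$)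 and whose morphisms are the dg functors (strictly unital $A_\infty$ functors with $F^n=0$ for $n>1$). A functor $F$ is a *quasi-isomorphism* if $H(F)$ is an isomorphism, that is, if $F^0$ is bijective and each $F^1\colon(\mathcal A(X,Y),m_1)\to(\mathcal B(F^0X,F^0Y),m_1)$ is a quasi-isomorphism of complexes. Then there is an adjunction $$V\colon \mathbf{A_\infty Cat}\rightleftarrows\mathbf{dgCat}\colon I,\qquad V\dashv I,$$ where $I$ is the inclusion functor. Moreover its unit $\mathcal A\to I(V(\mathcal A))$ is a quasi-isomorphism for every $\mathcal A\in\mathbf{A_\infty Cat}$, and its counit $V(I(\mathcal B))\to\mathcal B$ is a quasi-isomorphism for every $\mathcal B\in\mathbf{dgCat}$. -/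

import Mathlib

open CategoryTheory

universe u

namespace AInf

/-- `sumOver l f` is the sum of `f a` over the entries `a` of the list `l`. -/
def sumOver {α N : Type*} [AddCommGroup N] (l : List α) (f : α → N) : N := (l.map f).sum

/-- Composable strings. An element of `Chain Q X Y` is a string `(f_n, ..., f_1)` with
`f_1` starting at `X`, `f_n` ending at `Y`, and consecutive entries composable. The entry applied
last is the leftmost one, and `cons f p` puts `f` on the left of `p`. -/
inductive Chain {O : Type u} (Q : O → O → Type u) : O → O → Type u
  | nil (X : O) : Chain Q X X
  | cons {X Y Z : O} (f : Q Y Z) (p : Chain Q X Y) : Chain Q X Z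

/-- A way of cutting a string in two, `p = left · right`; either piece may be empty. -/
structure Split {O : Type u} (Q : O → O → Type u) (X Y : O) where
  mid : O
  left : Chain Q mid Y
  right : Chain Q X mid

namespace Chain

variable {O O' : Type u} {Q : O → O → Type u} {Q' : O' → O' → Type u}

/-- The number of entries. -/
def len {X : O} : {Y : O} → Chain Q X Y → ℕ
  | _, nil _ => 0
  | _, cons _ p => p.len + 1

/-- Concatenation `p · q`. -/
def append {X Y : O} : {Z : O} → Chain Q Y Z → Chain Q X Y → Chain Q X Z
  | _, nil _, q => q
  | _, cons f p, q => cons f (p.append q)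

/-- Apply a map to every entry. -/
def map (g : O → O') (φ : ∀ X Y : O, Q X Y → Q' (g X) (g Y)) {X : O} :
    {Y : O} → Chain Q X Y → Chain Q' (g X) (g Y)
  | _, nil _ => nil _
  | _, cons f p => cons (φ _ _ f) (p.map g φ)

/-- The sum over the entries of an integer attached to each of them. -/
def total (t : ∀ X Y : O, Q X Y → ℤ) {X : O} : {Y : O} → Chain Q X Y → ℤ
  | _, nil _ => 0
  | _, cons f p => t _ _ f + p.total t

/-- All the ways of cutting a string in two (possibly empty) pieces. -/
def splits {X : O} : {Y : O} → Chain Q X Y → List (Split Q X Y)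
  | _, nil _ => [⟨_, nil _, nil _⟩]
  | _, cons f p =>
      ⟨_, nil _, cons f p⟩ :: p.splits.map (fun s => ⟨s.mid, cons f s.left, s.right⟩)

/-- Put `f` on the left of the leftmost block of a string of blocks (there is no result if there
are no blocks). -/
def extendHead {X Y Z : O} (f : Q Y Z) : Chain (Chain Q) X Y → List (Chain (Chain Q) X Z)
  | nil _ => []
  | cons b δ => [cons (cons f b) δ]

/-- All the ways of cutting a string into nonempty consecutive blocks. -/
def blocks {X : O} : {Y : O} → Chain Q X Y → List (Chain (Chain Q) X Y)
  | _, nil _ => [nil _]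
  | _, cons f p =>
      p.blocks.map (fun δ => cons (cons f (nil _)) δ) ++ p.blocks.flatMap (fun δ => extendHead f δ)

end Chain

section sums

variable {α β N : Type*} [AddCommGroup N]

@[simp] lemma sumOver_nil (f : α → N) : sumOver [] f = 0 := rfl
@[simp] lemma sumOver_cons (a : α) (l : List α) (f : α → N) :
    sumOver (a :: l) f = f a + sumOver l f := by simp [sumOver]
@[simp] lemma sumOver_append (l l' : List α) (f : α → N) :
    sumOver (l ++ l') f = sumOver l f + sumOver l' f := by simp [sumOver]
@[simp] lemma sumOver_map (l : List β) (g : β → α) (f : α → N) :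
    sumOver (l.map g) f = sumOver l (fun b => f (g b)) := by simp [sumOver, Function.comp_def]
@[simp] lemma sumOver_flatMap (l : List β) (g : β → List α) (f : α → N) :
    sumOver (l.flatMap g) f = sumOver l (fun b => sumOver (g b) f) := by
  induction l with
  | nil => rfl
  | cons a l ih => simp [ih]
lemma sumOver_add (l : List α) (f g : α → N) :
    sumOver l (fun a => f a + g a) = sumOver l f + sumOver l g := by
  induction l with
  | nil => simp
  | cons a l ih => simp only [sumOver_cons, ih]; abel
lemma sumOver_congr (l : List α) {f g : α → N} (h : ∀ a ∈ l, f a = g a) :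
    sumOver l f = sumOver l g := by
  induction l with
  | nil => simp
  | cons a l ih =>
    rw [sumOver_cons, sumOver_cons, h a (by simp), ih (fun b hb => h b (by simp [hb]))]
lemma sumOver_zero (l : List α) : sumOver l (fun _ => (0 : N)) = 0 := by
  induction l with
  | nil => simp
  | cons a l ih => simp [ih]
lemma sumOver_eq_zero (l : List α) {f : α → N} (h : ∀ a ∈ l, f a = 0) : sumOver l f = 0 :=
  (sumOver_congr l h).trans (sumOver_zero l)
lemma sumOver_smul {R : Type*} [Monoid R] [DistribMulAction R N] (l : List α) (r : R)
    (f : α → N) : sumOver l (fun a => r • f a) = r • sumOver l f := by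
  induction l with
  | nil => simp
  | cons a l ih => simp [ih]
lemma sumOver_hom {M : Type*} [AddCommGroup M] (F : N →+ M) (l : List α) (f : α → N) :
    F (sumOver l f) = sumOver l (fun a => F (f a)) := by
  induction l with
  | nil => simp
  | cons a l ih => simp [ih]
lemma sumOver_apply {ι : Type*} {M : ι → Type*} [∀ i, AddCommGroup (M i)] (l : List α)
    (f : α → ∀ i, M i) (i : ι) : sumOver l f i = sumOver l (fun a => f a i) := by
  induction l with
  | nil => simp
  | cons a l ih => simp [ih]

end sums

namespace Chain

variable {O O' : Type u} {Q : O → O → Type u} {Q' : O' → O' → Type u} {N : Type*} [AddCommGroup N]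

@[simp] lemma len_append {X Y Z : O} (p : Chain Q Y Z) (q : Chain Q X Y) :
    (p.append q).len = p.len + q.len := by
  induction p with
  | nil => simp [append, len]
  | cons f p ih => simp only [append, len, ih]; omega

@[simp] lemma append_nil {X Y : O} (p : Chain Q X Y) : p.append (nil X) = p := by
  induction p with
  | nil => simp [append]
  | cons f p ih => simp [append, ih]

lemma append_assoc {X Y Z W : O} (p : Chain Q Z W) (q : Chain Q Y Z) (r : Chain Q X Y) :
    (p.append q).append r = p.append (q.append r) := by
  induction p with
  | nil => simp [append]
  | cons f p ih => simp [append, ih]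

@[simp] lemma total_append (t : ∀ X Y : O, Q X Y → ℤ) {X Y Z : O} (p : Chain Q Y Z)
    (q : Chain Q X Y) : (p.append q).total t = p.total t + q.total t := by
  induction p with
  | nil => simp [append, total]
  | cons f p ih => simp only [append, total, ih]; ring

lemma map_append (g : O → O') (φ : ∀ X Y : O, Q X Y → Q' (g X) (g Y)) {X Y Z : O}
    (p : Chain Q Y Z) (q : Chain Q X Y) :
    (p.append q).map g φ = (p.map g φ).append (q.map g φ) := by
  induction p with
  | nil => simp [append, map]
  | cons f p ih => simp [append, map, ih]

@[simp] lemma len_map (g : O → O') (φ : ∀ X Y : O, Q X Y → Q' (g X) (g Y)) {X Y : O}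
    (p : Chain Q X Y) : (p.map g φ).len = p.len := by
  induction p with
  | nil => simp [len, map]
  | cons f p ih => simp [len, map, ih]

lemma len_eq_zero {X Y : O} (p : Chain Q X Y) (h : p.len = 0) :
    ∃ e : X = Y, p = e ▸ nil X := by
  cases p with
  | nil => exact ⟨rfl, rfl⟩
  | cons f p => simp [len] at h

lemma sum_splits_nil (X : O) (ψ : Split Q X X → N) :
    sumOver (nil X : Chain Q X X).splits ψ = ψ ⟨X, nil X, nil X⟩ := by simp [splits]

lemma sum_splits_cons {X Y Z : O} (f : Q Y Z) (p : Chain Q X Y) (ψ : Split Q X Z → N) :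
    sumOver (cons f p).splits ψ = ψ ⟨_, nil _, cons f p⟩ +
      sumOver p.splits (fun s => ψ ⟨s.mid, cons f s.left, s.right⟩) := by simp [splits]

lemma mem_splits {X Y : O} (p : Chain Q X Y) : ∀ s ∈ p.splits, s.left.append s.right = p := by
  induction p with
  | nil => simp [splits, append]
  | cons f p ih =>
    intro s hs
    simp only [splits, List.mem_cons, List.mem_map] at hs
    rcases hs with rfl | ⟨t, ht, rfl⟩
    · simp [append]
    · simp [append, ih t ht]

lemma splits_coassoc {X Y : O} (p : Chain Q X Y)
    (ψ : ∀ W Z : O, Chain Q Z Y → Chain Q W Z → Chain Q X W → N) :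
    sumOver p.splits (fun s => sumOver s.right.splits (fun t => ψ _ _ s.left t.left t.right)) =
    sumOver p.splits (fun s => sumOver s.left.splits (fun t => ψ _ _ t.left t.right s.right)) := by
  induction p with
  | nil => simp [sum_splits_nil]
  | cons f p ih =>
    simp only [sum_splits_cons, sum_splits_nil, sumOver_add]
    rw [ih (fun W Z a b c => ψ W Z (cons f a) b c)]
    abel

lemma sum_splits_right_nil {X Y : O} (p : Chain Q X Y) (ψ : Split Q X Y → N)
    (h : ∀ s : Split Q X Y, s.right.len ≠ 0 → ψ s = 0) :
    sumOver p.splits ψ = ψ ⟨X, p, nil X⟩ := by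
  induction p with
  | nil => simp [sum_splits_nil]
  | cons f p ih =>
    rw [sum_splits_cons, h _ (by simp [len]), ih _ (fun s hs => h _ hs), zero_add]

lemma splits_map (g : O → O') (φ : ∀ X Y : O, Q X Y → Q' (g X) (g Y)) {X Y : O}
    (p : Chain Q X Y) (ψ : Split Q' (g X) (g Y) → N) :
    sumOver (p.map g φ).splits ψ =
      sumOver p.splits (fun s => ψ ⟨g s.mid, s.left.map g φ, s.right.map g φ⟩) := by
  induction p with
  | nil => simp [map, sum_splits_nil]
  | cons f p ih => simp only [map, sum_splits_cons, ih]

/-- Sum over blocks, recursion on the first entry. -/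
lemma sum_blocks_cons' {X Y Z : O} (f : Q Y Z) (p : Chain Q X Y) (ψ : Chain (Chain Q) X Z → N) :
    sumOver (cons f p).blocks ψ = sumOver p.blocks (fun δ => ψ (cons (cons f (nil _)) δ) +
      sumOver (extendHead f δ) ψ) := by
  simp [blocks, sumOver_add]

lemma sum_blocks_nil (X : O) (ψ : Chain (Chain Q) X X → N) :
    sumOver (nil X : Chain Q X X).blocks ψ = ψ (nil X) := by simp [blocks]

/-- Sum over blocks, recursion on the leftmost block. -/
lemma sum_blocks_cons {X Y Z : O} (f : Q Y Z) (p : Chain Q X Y) (ψ : Chain (Chain Q) X Z → N) :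
    sumOver (cons f p).blocks ψ = sumOver p.splits (fun s => sumOver s.right.blocks (fun δ =>
      ψ (cons (cons f s.left) δ))) := by
  induction p generalizing Z with
  | nil => simp [sum_blocks_cons', sum_blocks_nil, sum_splits_nil, extendHead]
  | cons g q ih =>
    rw [sum_blocks_cons', sumOver_add, sum_splits_cons]
    congr 1
    rw [ih g (fun δ => sumOver (extendHead f δ) ψ)]
    simp [extendHead]

lemma blocks_splits {X Y : O} (p : Chain Q X Y)
    (ψ : ∀ Z : O, Chain (Chain Q) Z Y → Chain (Chain Q) X Z → N) :
    sumOver p.blocks (fun δ => sumOver δ.splits (fun s => ψ _ s.left s.right)) =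
    sumOver p.splits (fun s => sumOver s.left.blocks (fun α => sumOver s.right.blocks (fun β =>
      ψ _ α β))) := by
  induction p with
  | nil => simp [sum_blocks_nil, sum_splits_nil]
  | cons f p ih =>
    have hext : ∀ δ : Chain (Chain Q) _ _,
        sumOver (extendHead f δ) (fun δ' => sumOver δ'.splits (fun s => ψ _ s.left s.right)) =
        sumOver (extendHead f δ) (fun δ' => ψ _ (nil _) δ') +
        sumOver δ.splits (fun s => sumOver (extendHead f s.left) (fun α' => ψ _ α' s.right)) := by
      intro δ
      cases δ with
      | nil => simp [extendHead, sum_splits_nil]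
      | cons b δ => simp [extendHead, sum_splits_cons]
    have key := ih (fun Z α β => ψ Z (cons (cons f (nil _)) α) β +
      sumOver (extendHead f α) (fun α' => ψ Z α' β))
    rw [sum_blocks_cons', sum_splits_cons]
    simp only [sum_blocks_cons', sum_blocks_nil, sum_splits_cons, hext, sumOver_add] at key ⊢
    have comm : ∀ (Z : O) (l : List (Chain (Chain Q) Z _)) (l' : List (Chain (Chain Q) _ Z)),
        sumOver l (fun α =>
          sumOver l' (fun β => sumOver (extendHead f α) (fun α' => ψ _ α' β))) =
        sumOver l (fun α => sumOver (extendHead f α) (fun α' =>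
          sumOver l' (fun β => ψ _ α' β))) := by
      intro Z l l'
      refine sumOver_congr _ fun α _ => ?_
      cases α <;> simp [extendHead, sumOver_zero]
    simp only [comm] at key
    rw [add_add_add_comm, key]

/-- A letter of a string marked inside a decomposition of the string into blocks. -/
structure Ctx (Q : O → O → Type u) (X Y Z Z' : O) where
  src : O
  tgt : O
  α : Chain (Chain Q) tgt Y
  u' : Chain Q Z' tgt
  w' : Chain Q src Z
  β : Chain (Chain Q) X src

/-- The string of blocks with the marked letter equal to `y`. -/
def Ctx.fill {X Y Z Z' : O} (c : Ctx Q X Y Z Z') (y : Q Z Z') : Chain (Chain Q) X Y :=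
  c.α.append (cons (c.u'.append (cons y c.w')) c.β)

/-- The marked letter put in the leftmost block. -/
def extCtx {X Y Z : O} : Chain (Chain Q) X Y → List (Ctx Q X Z Y Z)
  | nil _ => []
  | cons b δ => [⟨_, _, nil _, nil _, b, δ⟩]

/-- Put `x` on the left of the leftmost block of a marked decomposition. -/
def Ctx.ext {X Y Y' Z Z' : O} (x : Q Y Y') : Ctx Q X Y Z Z' → Ctx Q X Y' Z Z'
  | ⟨_, _, nil _, u', w', β⟩ => ⟨_, _, nil _, cons x u', w', β⟩
  | ⟨_, _, cons b α, u', w', β⟩ => ⟨_, _, cons (cons x b) α, u', w', β⟩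

lemma len_eq_total {X Y : O} (p : Chain Q X Y) : (p.len : ℤ) = p.total (fun _ _ _ => 1) := by
  induction p with
  | nil => rfl
  | cons f p ih => simp only [len, total, ← ih]; push_cast; ring

lemma total_blocks (t : ∀ X Y : O, Q X Y → ℤ) {X Y : O} (p : Chain Q X Y) :
    ∀ δ ∈ p.blocks, δ.total (fun _ _ b => b.total t) = p.total t := by
  induction p with
  | nil => intro δ hδ; simp only [blocks, List.mem_singleton] at hδ; subst hδ; rfl
  | cons f p ih =>
    intro δ hδ
    simp only [blocks, List.mem_append, List.mem_map, List.mem_flatMap] at hδ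
    rcases hδ with ⟨δ', h, rfl⟩ | ⟨δ', h, h'⟩
    · simp [total, ih δ' h]
    · rw [total, ← ih δ' h]
      cases δ' with
      | nil => simp [extendHead] at h'
      | cons b δ' =>
        simp only [extendHead, List.mem_singleton] at h'
        subst h'
        simp [total, add_assoc]

lemma len_blocks {X Y : O} (p : Chain Q X Y) :
    ∀ δ ∈ p.blocks, δ.total (fun _ _ b => (b.len : ℤ)) = p.len := by
  intro δ hδ
  simp only [len_eq_total]
  exact total_blocks _ p δ hδ

lemma blocks_mid {X Y Z Z' : O} (u : Chain Q Z' Y) (w : Chain Q X Z) :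
    ∃ L : List (Ctx Q X Y Z Z'), (∀ y : Q Z Z', (u.append (cons y w)).blocks = L.map (·.fill y)) ∧
      ∀ c ∈ L, (u.len : ℤ) = c.α.total (fun _ _ b => (b.len : ℤ)) + c.u'.len ∧
        (w.len : ℤ) = c.w'.len + c.β.total (fun _ _ b => (b.len : ℤ)) := by
  induction u with
  | nil =>
    refine ⟨w.blocks.map (fun δ => ⟨_, _, nil _, nil _, nil _, δ⟩) ++
      w.blocks.flatMap (fun δ => extCtx δ), fun y => ?_, ?_⟩
    · simp only [append, blocks, List.map_append, List.map_map, List.map_flatMap]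
      congr 1
      refine congrArg (fun F => List.flatMap F _) (funext fun δ => ?_)
      cases δ <;> rfl
    · intro c hc
      simp only [List.mem_append, List.mem_map, List.mem_flatMap] at hc
      rcases hc with ⟨δ, hδ, rfl⟩ | ⟨δ, hδ, h⟩
      · simp [total, len, len_blocks _ _ hδ]
      · have := len_blocks _ _ hδ
        cases δ with
        | nil => simp [extCtx] at h
        | cons b δ =>
          simp only [extCtx, List.mem_singleton] at h
          subst h
          simp only [total] at this ⊢
          simp [len, this]
  | cons x u ih =>
    obtain ⟨L, h1, h2⟩ := ih
    refine ⟨L.map (fun c => ⟨_, _, cons (cons x (nil _)) c.α, c.u', c.w', c.β⟩) ++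
      L.map (fun c => c.ext x), fun y => ?_, ?_⟩
    · simp only [append, blocks, h1, List.map_append, List.map_map, List.flatMap_map]
      congr 1
      conv_rhs => rw [List.map_eq_flatMap]
      refine congrArg (fun F => List.flatMap F _) (funext fun c => ?_)
      obtain ⟨s, t, α, u', w', β⟩ := c
      cases α <;> rfl
    · intro c hc
      simp only [List.mem_append, List.mem_map] at hc
      rcases hc with ⟨c, hc, rfl⟩ | ⟨c, hc, rfl⟩
      · have := h2 c hc
        simp only [total, len]
        push_cast
        constructor <;> omega
      · have := h2 c hc
        obtain ⟨s, t, α, u', w', β⟩ := c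
        cases α <;> (simp only [Ctx.ext, total, len] at this ⊢; push_cast; constructor <;> omega)

end Chain

/-- A graded `K`-linear quiver: objects and, for all objects `X, Y`, a `ℤ`-graded vector space,
`Hom X Y d` being its component of degree `d`. -/
structure GQuiver (K : Type u) [Field K] where
  Ob : Type u
  Hom : Ob → Ob → ℤ → Type u
  [addCommGroup : ∀ X Y d, AddCommGroup (Hom X Y d)]
  [module : ∀ X Y d, Module K (Hom X Y d)]

attribute [instance] GQuiver.addCommGroup GQuiver.module

namespace GQuiver

variable {K : Type u} [Field K]

/-- Homogeneous morphisms together with their degree. -/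
def El (V : GQuiver K) (X Y : V.Ob) : Type u := Σ d : ℤ, V.Hom X Y d

/-- Composable strings of homogeneous morphisms. -/
abbrev Word (V : GQuiver K) (X Y : V.Ob) : Type u := Chain V.El X Y

/-- A homogeneous morphism, as the entry of a string. -/
def el (V : GQuiver K) {X Y : V.Ob} (d : ℤ) (f : V.Hom X Y d) : V.El X Y := ⟨d, f⟩

/-- The sum of the degrees of the entries. -/
def deg {V : GQuiver K} {X Y : V.Ob} (p : V.Word X Y) : ℤ := p.total (fun _ _ x => x.1)

/-- Linearity in every entry of a function on composable strings of homogeneous morphisms. -/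
structure IsMultilinear {V : GQuiver K} {N : Type*} [AddCommGroup N] [Module K N] {X Y : V.Ob}
    (φ : V.Word X Y → N) : Prop where
  add : ∀ {Z Z' : V.Ob} {d : ℤ} (u : V.Word Z' Y) (f g : V.Hom Z Z' d) (w : V.Word X Z),
    φ (u.append (.cons (V.el d (f + g)) w)) =
      φ (u.append (.cons (V.el d f) w)) + φ (u.append (.cons (V.el d g) w))
  smul : ∀ {Z Z' : V.Ob} {d : ℤ} (u : V.Word Z' Y) (a : K) (f : V.Hom Z Z' d) (w : V.Word X Z),
    φ (u.append (.cons (V.el d (a • f)) w)) = a • φ (u.append (.cons (V.el d f) w))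

/-- Functions taking a string in `V` to a (not necessarily homogeneous) element of `W` between the
images of its end points under `g`; `ω X Y p e` is the component of degree `e` of the value. -/
abbrev Op (V W : GQuiver K) (g : V.Ob → W.Ob) : Type u :=
  ∀ X Y : V.Ob, V.Word X Y → ∀ e : ℤ, W.Hom (g X) (g Y) e

/-- A graded operation from `V` to `W` along the map `g` on objects: for every string `p` of length
`n` in `V` an element of `W` of degree `deg p + c - n`, depending linearly on every entry of `p`,
and zero on the empty strings. In other words, maps of degree `c - n`
`V(X_{n-1}, X_n) ⊗ ... ⊗ V(X_0, X_1) → W(g X_0, g X_n)` for all `n ≥ 1`. -/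
structure IsOperation {V W : GQuiver K} (g : V.Ob → W.Ob) (c : ℤ)
    (ω : Op V W g) : Prop where
  nil : ∀ X : V.Ob, ω _ _ (.nil X) = 0
  degree : ∀ {X Y : V.Ob} (p : V.Word X Y) (e : ℤ), e ≠ deg p + c - p.len → ω _ _ p e = 0
  multilinear : ∀ X Y : V.Ob, IsMultilinear (fun p : V.Word X Y => ω X Y p)

/-- The value of an operation on a string, as a homogeneous element. -/
def val {V W : GQuiver K} {g : V.Ob → W.Ob} (c : ℤ)
    (ω : Op V W g) {X Y : V.Ob}
    (p : V.Word X Y) : W.El (g X) (g Y) :=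
  W.el (deg p + c - p.len) (ω _ _ p (deg p + c - p.len))

/-- `∑ (-1)^{jk + l} φ (id^{⊗ j} ⊗ m_k ⊗ id^{⊗ l})`, evaluated on a string `p` of homogeneous
elements: the sum over all `p = u · v · w` with `j`, `k`, `l` the lengths of `u`, `v`, `w`
(terms with `k = 0` vanish, `m` being zero on empty strings). The sign
`(-1)^{(2 - k) deg u}` is the Koszul sign for moving `m_k`, of degree `2 - k`, past `u`. -/
def insertSum {V : GQuiver K} (m : Op V V id)
    {N : Type*} [AddCommGroup N] {X Y : V.Ob} (φ : V.Word X Y → N) (p : V.Word X Y) : N :=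
  sumOver p.splits fun s => sumOver s.right.splits fun t =>
    (((s.left.len : ℤ) * t.left.len + t.right.len) +
        (2 - (t.left.len : ℤ)) * deg s.left).negOnePow •
      φ (s.left.append (.cons (val 2 m t.left) t.right))

/-- The exponent of the sign of `F^{s_r} ⊗ ... ⊗ F^{s_1}` evaluated on a string of blocks
`(B_r, ..., B_1)` of lengths `s_r, ..., s_1`. It is the sum over all `u` of `1 - s_u` (the degree
of `F^{s_u}`) times the sum over all `v > u` (the blocks on the left of `B_u`) of `s_v + deg B_v`. -/
def blockSign {V : GQuiver K} {X : V.Ob} : {Y : V.Ob} → Chain V.Word X Y → ℤ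
  | _, .nil _ => 0
  | _, .cons b δ => ((b.len : ℤ) + deg b) * δ.total (fun _ _ b' => 1 - (b'.len : ℤ)) + blockSign δ

/-- `∑ ± φ_r (F^{s_r} ⊗ ... ⊗ F^{s_1})`, evaluated on a string `p` of homogeneous elements: the sum
over all ways of cutting `p` into nonempty blocks, with `F` applied to each block. -/
def blockSum {V W : GQuiver K} {g : V.Ob → W.Ob}
    (F : Op V W g)
    {N : Type*} [AddCommGroup N] {X Y : V.Ob} (φ : W.Word (g X) (g Y) → N) (p : V.Word X Y) : N :=
  sumOver p.blocks fun δ => (blockSign δ).negOnePow • φ (δ.map g (fun _ _ b => val 1 F b))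

/-! Signs are absorbed by the shift: `kap p` is the exponent of the sign by which an operation on
`p` differs from the corresponding operation on the shifted quiver. -/

/-- The sum of the shifted degrees. -/
def eps {V : GQuiver K} {X Y : V.Ob} (p : V.Word X Y) : ℤ := deg p + p.len

def kap {V : GQuiver K} {X : V.Ob} : {Y : V.Ob} → V.Word X Y → ℤ
  | _, .nil _ => 0
  | _, .cons x p => (x.1 + 1) * p.len + kap p

def twist {V W : GQuiver K} {g : V.Ob → W.Ob}
    (ω : Op V W g) : Op V W g := fun _ _ p e => (kap p).negOnePow • ω _ _ p e

/-- `insertSum` with shifted signs. -/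
def ins {V : GQuiver K} (m : Op V V id)
    {N : Type*} [AddCommGroup N] {X Y : V.Ob} (φ : V.Word X Y → N) (p : V.Word X Y) : N :=
  sumOver p.splits fun s => sumOver s.right.splits fun t =>
    (eps s.left).negOnePow • φ (s.left.append (.cons (val 2 m t.left) t.right))

/-- `blockSum` with shifted signs. -/
def pull {V W : GQuiver K} {g : V.Ob → W.Ob}
    (F : Op V W g)
    {N : Type*} [AddCommGroup N] {X Y : V.Ob} (φ : W.Word (g X) (g Y) → N) (p : V.Word X Y) : N :=
  sumOver p.blocks fun δ => φ (δ.map g (fun _ _ b => val 1 F b))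

section words

variable {V : GQuiver K} {N : Type*} [AddCommGroup N]

@[simp] lemma deg_nil (X : V.Ob) : deg (.nil X : V.Word X X) = 0 := rfl
@[simp] lemma deg_cons {X Y Z : V.Ob} (x : V.El Y Z) (p : V.Word X Y) :
    deg (.cons x p : V.Word X Z) = x.1 + deg p := rfl
@[simp] lemma deg_append {X Y Z : V.Ob} (p : V.Word Y Z) (q : V.Word X Y) :
    deg (p.append q) = deg p + deg q := by simp [deg]
@[simp] lemma len_nil (X : V.Ob) : Chain.len (.nil X : V.Word X X) = 0 := rfl
@[simp] lemma len_cons {X Y Z : V.Ob} (x : V.El Y Z) (p : V.Word X Y) :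
    Chain.len (.cons x p : V.Word X Z) = p.len + 1 := rfl
@[simp] lemma el_fst {X Y : V.Ob} (d : ℤ) (f : V.Hom X Y d) : (V.el d f).1 = d := rfl
@[simp] lemma eps_nil (X : V.Ob) : eps (.nil X : V.Word X X) = 0 := by simp [eps]
lemma eps_cons {X Y Z : V.Ob} (x : V.El Y Z) (p : V.Word X Y) :
    eps (.cons x p : V.Word X Z) = (x.1 + 1) + eps p := by simp [eps]; ring
lemma eps_append {X Y Z : V.Ob} (p : V.Word Y Z) (q : V.Word X Y) :
    eps (p.append q) = eps p + eps q := by simp [eps]; ring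
@[simp] lemma kap_nil (X : V.Ob) : kap (.nil X : V.Word X X) = 0 := rfl
lemma kap_cons {X Y Z : V.Ob} (x : V.El Y Z) (p : V.Word X Y) :
    kap (.cons x p : V.Word X Z) = (x.1 + 1) * p.len + kap p := rfl
lemma kap_append {X Y Z : V.Ob} (p : V.Word Y Z) (q : V.Word X Y) :
    kap (p.append q) = kap p + kap q + eps p * q.len := by
  induction p with
  | nil => simp [Chain.append]
  | cons x p ih => simp only [Chain.append, kap_cons, ih, eps_cons, Chain.len_append]; push_cast; ring

lemma el_congr {X Y : V.Ob} (φ : ∀ e, V.Hom X Y e) {d e : ℤ} (h : d = e) :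
    V.el d (φ d) = V.el e (φ e) := by subst h; rfl

lemma val_eq {V W : GQuiver K} {g : V.Ob → W.Ob} (c : ℤ)
    (ω : Op V W g) {X Y : V.Ob}
    (p : V.Word X Y) {e : ℤ} (h : deg p + c - p.len = e) : val c ω p = W.el e (ω _ _ p e) :=
  el_congr _ h

@[simp] lemma val_fst {V W : GQuiver K} {g : V.Ob → W.Ob} (c : ℤ)
    (ω : Op V W g) {X Y : V.Ob}
    (p : V.Word X Y) : (val c ω p).1 = deg p + c - p.len := rfl

variable [Module K N]

namespace IsMultilinear

variable {X Y : V.Ob} {φ : V.Word X Y → N}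

lemma zero (h : IsMultilinear φ) {Z Z' : V.Ob} {d : ℤ} (u : V.Word Z' Y) (w : V.Word X Z) :
    φ (u.append (.cons (V.el d (0 : V.Hom Z Z' d)) w)) = 0 := by
  have := h.smul u 0 (0 : V.Hom Z Z' d) w
  simpa using this

lemma add' (h : IsMultilinear φ) {Z : V.Ob} {d : ℤ} (f g : V.Hom Z Y d) (w : V.Word X Z) :
    φ (.cons (V.el d (f + g)) w) = φ (.cons (V.el d f) w) + φ (.cons (V.el d g) w) :=
  h.add (.nil Y) f g w

lemma smul' (h : IsMultilinear φ) {Z : V.Ob} {d : ℤ} (a : K) (f : V.Hom Z Y d) (w : V.Word X Z) :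
    φ (.cons (V.el d (a • f)) w) = a • φ (.cons (V.el d f) w) :=
  h.smul (.nil Y) a f w

lemma zero' (h : IsMultilinear φ) {Z : V.Ob} {d : ℤ} (w : V.Word X Z) :
    φ (.cons (V.el d (0 : V.Hom Z Y d)) w) = 0 := h.zero (.nil Y) w

lemma neg (h : IsMultilinear φ) {Z Z' : V.Ob} {d : ℤ} (u : V.Word Z' Y) (f : V.Hom Z Z' d)
    (w : V.Word X Z) :
    φ (u.append (.cons (V.el d (-f)) w)) = - φ (u.append (.cons (V.el d f) w)) := by
  have := h.smul u (-1) f w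
  simpa using this

lemma units_smul (h : IsMultilinear φ) {Z Z' : V.Ob} {d : ℤ} (u : V.Word Z' Y) (s : ℤˣ)
    (f : V.Hom Z Z' d) (w : V.Word X Z) :
    φ (u.append (.cons (V.el d (s • f)) w)) = s • φ (u.append (.cons (V.el d f) w)) := by
  rcases Int.units_eq_one_or s with rfl | rfl
  · simp
  · simpa using h.neg u f w

lemma cons (h : IsMultilinear φ) {Z : V.Ob} (x : V.El Z Y) :
    IsMultilinear (fun p : V.Word X Z => φ (.cons x p)) where
  add u f g w := h.add (.cons x u) f g w
  smul u a f w := h.smul (.cons x u) a f w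

/-- Insertion of an entry of fixed degree, as an additive map. -/
def insHom (h : IsMultilinear φ) {Z Z' : V.Ob} (d : ℤ) (u : V.Word Z' Y) (w : V.Word X Z) :
    V.Hom Z Z' d →+ N where
  toFun f := φ (u.append (.cons (V.el d f) w))
  map_zero' := h.zero u w
  map_add' f g := h.add u f g w

lemma units_smul_fun (h : IsMultilinear φ) (s : V.Word X Y → ℤ)
    (hs : ∀ {Z Z' : V.Ob} {d : ℤ} (u : V.Word Z' Y) (f g : V.Hom Z Z' d) (w : V.Word X Z),
      s (u.append (.cons (V.el d f) w)) = s (u.append (.cons (V.el d g) w))) :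
    IsMultilinear (fun p => (s p).negOnePow • φ p) where
  add u f g w := by
    rw [h.add, hs u f (f + g), hs u g (f + g), smul_add]
  smul u a f w := by
    rw [h.smul, hs u f (a • f), smul_comm]

lemma kap (h : IsMultilinear φ) : IsMultilinear (fun p => (kap p).negOnePow • φ p) :=
  h.units_smul_fun _ fun u f g w => by simp only [kap_append, kap_cons, el_fst, len_cons]

end IsMultilinear

end words

section ops

variable {V W : GQuiver K} {g : V.Ob → W.Ob} {N : Type*} [AddCommGroup N]

lemma IsOperation.twist {c : ℤ}
    {ω : Op V W g}
    (h : IsOperation g c ω) : IsOperation g c (twist ω) where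
  nil X := by
    funext e
    simp [GQuiver.twist, h.nil]
  degree p e he := by simp [GQuiver.twist, h.degree p e he]
  multilinear X Y := (h.multilinear X Y).kap

lemma kap_ins [Module K N] (m : Op V V id) {X Y : V.Ob}
    {φ : V.Word X Y → N} (hφ : IsMultilinear φ) (p : V.Word X Y) :
    (kap p).negOnePow • insertSum m φ p =
      ins (twist m) (fun q => (kap q).negOnePow • φ q) p := by
  have aux : ∀ {Z Z' : V.Ob} (u : V.Word Z Y) (v : V.Word Z' Z) (w : V.Word X Z'),
      (kap (u.append (v.append w))).negOnePow •
        (((u.len : ℤ) * v.len + w.len) + (2 - (v.len : ℤ)) * deg u).negOnePow •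
          φ (u.append (.cons (val 2 m v) w)) =
      (eps u).negOnePow • (kap (u.append (.cons (val 2 (twist m) v) w))).negOnePow •
          φ (u.append (.cons (val 2 (twist m) v) w)) := by
    intro Z Z' u v w
    have h1 := hφ.units_smul u (kap v).negOnePow (m _ _ v (deg v + 2 - v.len)) w
    have h2 : val 2 (twist m) v =
      V.el (deg v + 2 - v.len) ((kap v).negOnePow • m _ _ v (deg v + 2 - v.len)) := rfl
    rw [← h2] at h1
    have h3 : val 2 m v = V.el (deg v + 2 - v.len) (m _ _ v (deg v + 2 - v.len)) := rfl
    have h4 : kap (u.append (.cons (val 2 (twist m) v) w) : V.Word X Y) =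
      kap u + ((deg v + 2 - v.len + 1) * w.len + kap w) + eps u * (w.len + 1) := by
      simp only [kap_append, kap_cons, val_fst, len_cons]
      push_cast
      rfl
    rw [h1, h3, h4]
    simp only [smul_smul, ← Int.negOnePow_add]
    congr 1
    rw [Int.negOnePow_eq_iff]
    simp only [kap_append, eps, Chain.len_append]
    push_cast
    refine ⟨(u.len : ℤ) * v.len - w.len + v.len * w.len - u.len, ?_⟩
    ring
  unfold insertSum ins
  rw [← sumOver_smul]
  refine sumOver_congr _ fun s hs => ?_
  rw [← sumOver_smul]
  refine sumOver_congr _ fun t ht => ?_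
  have := aux s.left t.left t.right
  rw [Chain.mem_splits _ _ ht, Chain.mem_splits _ _ hs] at this
  exact this

/-- Concatenation of blocks. -/
def flat {X : V.Ob} : {Y : V.Ob} → Chain V.Word X Y → V.Word X Y
  | _, .nil _ => .nil _
  | _, .cons b δ => b.append (flat δ)

lemma flat_blocks {X Y : V.Ob} (p : V.Word X Y) : ∀ δ ∈ p.blocks, flat δ = p := by
  induction p with
  | nil => intro δ hδ; simp only [Chain.blocks, List.mem_singleton] at hδ; subst hδ; rfl
  | cons f p ih =>
    intro δ hδ
    simp only [Chain.blocks, List.mem_append, List.mem_map, List.mem_flatMap] at hδ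
    rcases hδ with ⟨δ', h, rfl⟩ | ⟨δ', h, h'⟩
    · simp [flat, Chain.append, ih δ' h]
    · cases δ' with
      | nil => simp [Chain.extendHead] at h'
      | cons b δ' =>
        simp only [Chain.extendHead, List.mem_singleton] at h'
        subst h'
        have := ih _ h
        simp only [flat] at this
        simp [flat, Chain.append, this]

lemma len_flat {X Y : V.Ob} (δ : Chain V.Word X Y) :
    ((flat δ).len : ℤ) = δ.total (fun _ _ b => (b.len : ℤ)) := by
  induction δ with
  | nil => rfl
  | cons b δ ih => simp [flat, Chain.total, ih]

lemma deg_flat {X Y : V.Ob} (δ : Chain V.Word X Y) :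
    deg (flat δ) = δ.total (fun _ _ b => deg b) := by
  induction δ with
  | nil => rfl
  | cons b δ ih => simp [flat, Chain.total, ih]

lemma total_one_sub {X Y : V.Ob} (δ : Chain V.Word X Y) :
    δ.total (fun _ _ b => 1 - (b.len : ℤ)) = δ.len - (flat δ).len := by
  induction δ with
  | nil => rfl
  | cons b δ ih => simp only [flat, Chain.total, ih, Chain.len, Chain.len_append]; push_cast; ring

lemma deg_map (F : Op V W g) {X Y : V.Ob}
    (δ : Chain V.Word X Y) :
    deg (δ.map g (fun _ _ b => val 1 F b) : W.Word (g X) (g Y)) =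
      deg (flat δ) + δ.len - (flat δ).len := by
  induction δ with
  | nil => rfl
  | cons b δ ih =>
    simp only [flat, Chain.map, deg_cons, ih, Chain.len, Chain.len_append, deg_append, val_fst]
    push_cast; ring

lemma map_twist [Module K N] (F : Op V W g) {X Y : V.Ob}
    {φ : W.Word (g X) (g Y) → N} (hφ : IsMultilinear φ) (δ : Chain V.Word X Y) :
    φ (δ.map g (fun _ _ b => val 1 (twist F) b)) =
      (δ.total (fun _ _ b => kap b)).negOnePow • φ (δ.map g (fun _ _ b => val 1 F b)) := by
  induction δ with
  | nil => simp [Chain.map, Chain.total]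
  | cons b δ ih =>
    simp only [Chain.map, Chain.total]
    rw [ih (hφ.cons _)]
    have : val 1 (twist F) b =
      W.el (deg b + 1 - b.len) ((kap b).negOnePow • F _ _ b (deg b + 1 - b.len)) := rfl
    have h2 := hφ.units_smul (.nil _) (kap b).negOnePow (F _ _ b (deg b + 1 - b.len))
      (δ.map g (fun _ _ b => val 1 F b))
    simp only [Chain.append] at h2
    rw [this, h2, smul_smul, Int.negOnePow_add, mul_comm]
    rfl

lemma sign_blocks (F : Op V W g) {X Y : V.Ob}
    (δ : Chain V.Word X Y) :
    (kap (flat δ) + blockSign δ).negOnePow =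
      (kap (δ.map g (fun _ _ b => val 1 F b) : W.Word (g X) (g Y)) +
        δ.total (fun _ _ b => kap b)).negOnePow := by
  induction δ with
  | nil => rfl
  | cons b δ ih =>
    rw [Int.negOnePow_eq_iff] at ih ⊢
    simp only [flat, blockSign, Chain.map, kap_append, kap_cons, Chain.total, total_one_sub,
      Chain.len_map, eps, val_fst] at ih ⊢
    generalize blockSign δ = a1 at *
    generalize kap (flat δ) = a2 at *
    generalize (kap (δ.map g (fun _ _ b => val 1 F b) : W.Word (g _) (g _))) = a3 at *
    generalize δ.total (fun _ _ b => kap b) = a4 at *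
    obtain ⟨c, hc⟩ := ih
    refine ⟨c + ((b.len : ℤ) - 1) * δ.len, ?_⟩
    linear_combination hc

lemma kap_pull [Module K N] (F : Op V W g) {X Y : V.Ob}
    {φ : W.Word (g X) (g Y) → N} (hφ : IsMultilinear φ) (p : V.Word X Y) :
    (kap p).negOnePow • blockSum F φ p =
      pull (twist F) (fun q => (kap q).negOnePow • φ q) p := by
  unfold blockSum pull
  rw [← sumOver_smul]
  refine sumOver_congr _ fun δ hδ => ?_
  have := map_twist F hφ.kap δ
  dsimp only at this ⊢
  rw [this, smul_smul, smul_smul, ← Int.negOnePow_add, ← Int.negOnePow_add,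
    ← flat_blocks p δ hδ, sign_blocks F, add_comm]

lemma pull_nil (F : Op V W g) {X : V.Ob}
    (φ : W.Word (g X) (g X) → N) : pull F φ (.nil X) = φ (.nil (g X)) := by
  simp [pull, Chain.sum_blocks_nil, Chain.map]

lemma pull_cons (F : Op V W g) {X Y Z : V.Ob}
    (x : V.El Y Z) (p : V.Word X Y) (φ : W.Word (g X) (g Z) → N) :
    pull F φ (.cons x p) = sumOver p.splits fun s =>
      pull F (fun q => φ (.cons (val 1 F (.cons x s.left)) q)) s.right := by
  simp [pull, Chain.sum_blocks_cons, Chain.map]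

section additive

lemma pull_add (F : Op V W g) {X Y : V.Ob} (φ ψ : W.Word (g X) (g Y) → N) (p : V.Word X Y) :
    pull F (fun q => φ q + ψ q) p = pull F φ p + pull F ψ p := sumOver_add _ _ _

lemma pull_zero (F : Op V W g) {X Y : V.Ob} (p : V.Word X Y) :
    pull F (fun _ => (0 : N)) p = 0 := sumOver_zero _

lemma pull_units_smul (F : Op V W g) {X Y : V.Ob} (s : ℤˣ) (φ : W.Word (g X) (g Y) → N)
    (p : V.Word X Y) : pull F (fun q => s • φ q) p = s • pull F φ p := sumOver_smul _ _ _

lemma pull_congr (F : Op V W g) {X Y : V.Ob} {φ ψ : W.Word (g X) (g Y) → N} (p : V.Word X Y)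
    (hp : p.len ≠ 0) (h : ∀ q : W.Word (g X) (g Y), q.len ≠ 0 → φ q = ψ q) :
    pull F φ p = pull F ψ p := by
  cases p with
  | nil => simp at hp
  | cons x p =>
    rw [pull_cons, pull_cons]
    refine sumOver_congr _ fun s _ => congrArg (fun F' => pull F F' _) (funext fun q => h _ ?_)
    simp

lemma pull_splits (F : Op V W g) {X Y : V.Ob}
    (Ψ : ∀ Z : W.Ob, W.Word Z (g Y) → W.Word (g X) Z → N) (p : V.Word X Y) :
    pull F (fun q => sumOver q.splits (fun s => Ψ s.mid s.left s.right)) p =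
      sumOver p.splits (fun s =>
        pull F (fun v => pull F (fun w => Ψ (g s.mid) v w) s.right) s.left) := by
  unfold pull
  simp only [Chain.splits_map]
  exact Chain.blocks_splits p (fun Z α β => Ψ (g Z) (α.map g (fun _ _ b => val 1 F b))
    (β.map g (fun _ _ b => val 1 F b)))

lemma pull_val {U : GQuiver K} {h : W.Ob → U.Ob} (F : Op V W g) (c : ℤ) (μ : Op W U h)
    {X Y : V.Ob} (L : U.El (h (g X)) (h (g Y)) → N)
    (h0 : ∀ d, L (U.el d 0) = 0)
    (hadd : ∀ d (a b : U.Hom (h (g X)) (h (g Y)) d), L (U.el d (a + b)) =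
      L (U.el d a) + L (U.el d b)) (v : V.Word X Y) :
    pull F (fun q => L (val c μ q)) v =
      L (U.el (deg v + c - v.len) (pull F (fun q => μ (g X) (g Y) q) v (deg v + c - v.len))) := by
  unfold pull
  rw [sumOver_apply]
  let L' : U.Hom (h (g X)) (h (g Y)) (deg v + c - v.len) →+ N :=
    { toFun := fun a => L (U.el _ a), map_zero' := h0 _, map_add' := hadd _ }
  refine Eq.trans ?_ (sumOver_hom L' _ _).symm
  refine sumOver_congr _ fun δ hδ => ?_
  dsimp only
  rw [val_eq c μ _ (e := deg v + c - v.len)]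
  · rfl
  · rw [deg_map, Chain.len_map, flat_blocks v δ hδ]
    ring

lemma ins_add (m : Op V V id) {X Y : V.Ob} (φ ψ : V.Word X Y → N) (p : V.Word X Y) :
    ins m (fun q => φ q + ψ q) p = ins m φ p + ins m ψ p := by
  unfold ins
  simp only [smul_add, sumOver_add]

lemma ins_zero (m : Op V V id) {X Y : V.Ob} (p : V.Word X Y) :
    ins m (fun _ => (0 : N)) p = 0 := by
  unfold ins
  simp only [smul_zero, sumOver_zero]

lemma ins_congr (m : Op V V id) {X Y : V.Ob} {φ ψ : V.Word X Y → N} (p : V.Word X Y)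
    (h : ∀ q : V.Word X Y, q.len ≠ 0 → φ q = ψ q) : ins m φ p = ins m ψ p := by
  unfold ins
  refine sumOver_congr _ fun s _ => sumOver_congr _ fun t _ => ?_
  rw [h]
  simp

/-- The part of `ins` where the operation is inserted on the left. -/
def ins0 (m : Op V V id) {X Y : V.Ob} (φ : V.Word X Y → N) (p : V.Word X Y) : N :=
  sumOver p.splits fun t => φ (.cons (val 2 m t.left) t.right)

lemma ins_nil (m : Op V V id) {X : V.Ob} (φ : V.Word X X → N) :
    ins m φ (.nil X) = φ (.cons (val 2 m (.nil X)) (.nil X)) := by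
  simp [ins, Chain.sum_splits_nil, Chain.append]

lemma ins_cons (m : Op V V id) {X Y Z : V.Ob} (x : V.El Y Z) (p : V.Word X Y)
    (φ : V.Word X Z → N) :
    ins m φ (.cons x p) = ins0 m φ (.cons x p) +
      (x.1 + 1).negOnePow • ins m (fun q => φ (.cons x q)) p := by
  unfold ins
  rw [Chain.sum_splits_cons]
  congr 1
  · simp [ins0, Chain.append]
  · rw [← sumOver_smul]
    refine sumOver_congr _ fun s _ => ?_
    rw [← sumOver_smul]
    refine sumOver_congr _ fun t _ => ?_
    rw [smul_smul, ← Int.negOnePow_add, eps_cons]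
    rfl

lemma ins_splits (m : Op V V id) {X Y : V.Ob}
    (Ψ : ∀ Z : V.Ob, V.Word Z Y → V.Word X Z → N) (p : V.Word X Y) :
    ins m (fun q => sumOver q.splits (fun s => Ψ s.mid s.left s.right)) p =
      sumOver p.splits (fun s => ins m (fun v => Ψ s.mid v s.right) s.left +
        (eps s.left).negOnePow • ins m (fun w => Ψ s.mid s.left w) s.right) := by
  induction p with
  | nil => simp [ins_nil, Chain.sum_splits_nil, Chain.sum_splits_cons, add_comm]
  | cons x p ih =>
    have h0 : ins0 m (fun q => sumOver q.splits (fun s => Ψ s.mid s.left s.right)) (.cons x p) =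
        ins0 m (fun q => Ψ _ (.nil _) q) (.cons x p) +
          sumOver (Chain.cons x p).splits (fun s => ins0 m (fun v => Ψ s.mid v s.right) s.left) := by
      unfold ins0
      simp only [Chain.sum_splits_cons (val 2 m _)]
      rw [sumOver_add]
      congr 1
      exact Chain.splits_coassoc (Chain.cons x p)
        (fun _ Z a b c => Ψ _ (.cons (val 2 m a) b) c)
    rw [ins_cons, h0]
    simp only [Chain.sum_splits_cons x]
    rw [ins_add, ih (fun Z v w => Ψ Z (.cons x v) w)]
    simp only [ins_cons, eps_nil, eps_cons, Int.negOnePow_zero, one_smul, Int.negOnePow_add _ (eps _),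
      ← smul_smul, sumOver_add, sumOver_smul, smul_add, ins_nil]
    simp only [ins0, Chain.sum_splits_nil]
    abel

lemma ins_val {h : V.Ob → W.Ob} (m : Op V V id) (F : Op V W h)
    {X Y : V.Ob} (L : W.El (h X) (h Y) → N)
    (h0 : ∀ d, L (W.el d 0) = 0)
    (hadd : ∀ d (a b : W.Hom (h X) (h Y) d), L (W.el d (a + b)) =
      L (W.el d a) + L (W.el d b)) (v : V.Word X Y) :
    ins m (fun q => L (val 1 F q)) v =
      L (W.el (deg v + 2 - v.len) (ins m (fun q => F X Y q) v (deg v + 2 - v.len))) := by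
  unfold ins
  rw [sumOver_apply]
  let L' : W.Hom (h X) (h Y) (deg v + 2 - v.len) →+ N :=
    { toFun := fun a => L (W.el _ a), map_zero' := h0 _, map_add' := hadd _ }
  refine Eq.trans ?_ (sumOver_hom L' _ _).symm
  refine sumOver_congr _ fun s hs => ?_
  rw [sumOver_apply, sumOver_hom]
  refine sumOver_congr _ fun t ht => ?_
  have hL : ∀ (σ : ℤˣ) a, L' (σ • a) = σ • L' a := by
    intro σ a
    rcases Int.units_eq_one_or σ with rfl | rfl
    · simp
    · simp
  rw [Pi.smul_apply, hL]
  congr 1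
  dsimp only
  rw [val_eq 1 F _ (e := deg v + 2 - v.len)]
  · rfl
  · rw [← Chain.mem_splits _ s hs, ← Chain.mem_splits _ t ht]
    simp only [deg_append, deg_cons, Chain.len_append, len_cons, val_fst]
    push_cast
    ring

end additive

lemma pull_eq [Module K N] {F : Op V W g} (hF : IsOperation g 1 F) {X Y : V.Ob} {φ : W.Word (g X) (g Y) → N}
    (hφ : IsMultilinear φ) (p : V.Word X Y) (hp : p.len ≠ 0) :
    pull F φ p = sumOver p.splits fun s =>
      pull F (fun q => φ (.cons (val 1 F s.left) q)) s.right := by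
  cases p with
  | nil => simp at hp
  | cons x p =>
    have : ∀ q, φ (.cons (val 1 F (.nil _)) q) = 0 := by
      intro q
      have := hφ.zero' (d := deg (.nil Y : V.Word Y Y) + 1 - Chain.len (.nil Y : V.Word Y Y)) q
      simp only [val, hF.nil]
      exact this
    rw [pull_cons, Chain.sum_splits_cons]
    simp only [this, pull_zero, zero_add]

lemma pull_multilinear [Module K N] {F : Op V W g} (hF : IsOperation g 1 F) {X Y : V.Ob}
    {φ : W.Word (g X) (g Y) → N} (hφ : IsMultilinear φ) : IsMultilinear (pull F φ) where
  add {Z Z' d} u a b w := by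
    have hv : ∀ {A B : V.Ob} (u' : V.Word Z' B) (w' : V.Word A Z) (y : V.Hom Z Z' d),
        val 1 F (u'.append (.cons (V.el d y) w')) =
          W.el (deg u' + (d + deg w') + 1 - ((u'.len + (w'.len + 1) : ℕ) : ℤ))
            (F _ _ (u'.append (.cons (V.el d y) w')) _) := fun u' w' y =>
      val_eq 1 F _ (by simp only [deg_append, deg_cons, Chain.len_append, len_cons, el_fst])
    obtain ⟨L, h1, -⟩ := Chain.blocks_mid u w
    unfold pull
    rw [h1, h1, h1, sumOver_map, sumOver_map, sumOver_map, ← sumOver_add]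
    refine sumOver_congr _ fun c _ => ?_
    simp only [Chain.Ctx.fill, Chain.map_append, Chain.map]
    rw [hv, hv, hv, (hF.multilinear _ _).add]
    exact hφ.add _ _ _ _
  smul {Z Z' d} u a f w := by
    have hv : ∀ {A B : V.Ob} (u' : V.Word Z' B) (w' : V.Word A Z) (y : V.Hom Z Z' d),
        val 1 F (u'.append (.cons (V.el d y) w')) =
          W.el (deg u' + (d + deg w') + 1 - ((u'.len + (w'.len + 1) : ℕ) : ℤ))
            (F _ _ (u'.append (.cons (V.el d y) w')) _) := fun u' w' y =>
      val_eq 1 F _ (by simp only [deg_append, deg_cons, Chain.len_append, len_cons, el_fst])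
    obtain ⟨L, h1, -⟩ := Chain.blocks_mid u w
    unfold pull
    rw [h1, h1, sumOver_map, sumOver_map, ← sumOver_smul]
    refine sumOver_congr _ fun c _ => ?_
    simp only [Chain.Ctx.fill, Chain.map_append, Chain.map]
    rw [hv, hv, (hF.multilinear _ _).smul]
    exact hφ.smul _ _ _ _

section comp

variable {U : GQuiver K} {h : W.Ob → U.Ob}

/-- Composition of operations (for shifted signs). -/
def compOp (G : Op W U h) (F : Op V W g) : Op V U (fun X => h (g X)) :=
  fun X Y p => pull F (fun q => G (g X) (g Y) q) p

lemma IsOperation.compOp {G : Op W U h} {F : Op V W g} (hG : IsOperation h 1 G)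
    (hF : IsOperation g 1 F) : IsOperation (fun X => h (g X)) 1 (compOp G F) where
  nil X := by simp [GQuiver.compOp, pull_nil, hG.nil]
  degree {X Y} p e he := by
    unfold GQuiver.compOp pull
    rw [sumOver_apply]
    refine sumOver_eq_zero _ fun δ hδ => hG.degree _ _ ?_
    rw [deg_map, Chain.len_map, flat_blocks p δ hδ]
    intro h'
    apply he
    rw [h']
    ring
  multilinear X Y := pull_multilinear hF (hG.multilinear _ _)

lemma pull_compOp [Module K N] {G : Op W U h} {F : Op V W g} (hG : IsOperation h 1 G)
    {X Y : V.Ob} {φ : U.Word (h (g X)) (h (g Y)) → N} (hφ : IsMultilinear φ) (p : V.Word X Y) :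
    pull (compOp G F) φ p = pull F (pull G φ) p := by
  induction hn : p.len using Nat.strong_induction_on generalizing Y with
  | _ n ih =>
    cases p with
    | nil => simp [pull_nil]
    | cons x p =>
      have hw : ∀ (s : Split V.El X _), pull F (fun v => pull F (fun w => pull G
          (fun r => φ (.cons (val 1 G v) r)) w) s.right) s.left =
          pull F (pull G (fun r => φ (.cons (val 1 (compOp G F) s.left) r))) s.right := fun s =>
        pull_val F 1 G (L := fun y => pull F (pull G (fun r => φ (.cons y r))) s.right)
          (fun d => by simp only [hφ.zero']; unfold pull; simp only [sumOver_zero])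
          (fun d a b => by simp only [hφ.add']; unfold pull; simp only [sumOver_add]) s.left
      rw [pull_congr F _ (by simp) (fun q hq => pull_eq hG hφ q hq),
        pull_splits F (fun _ v w => pull G (fun r => φ (.cons (val 1 G v) r)) w)]
      rw [sumOver_congr _ (fun s _ => hw s), Chain.sum_splits_cons, pull_cons]
      have hz : ∀ r, φ (.cons (val 1 (compOp G F) (.nil _)) r) = 0 := by
        intro r
        simp only [val, compOp, pull_nil, hG.nil]
        exact hφ.zero' (d := deg (.nil _ : V.Word _ _) + 1 - Chain.len (.nil _ : V.Word _ _)) r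
      simp only [hz]
      have hz2 : pull F (pull G (fun _ => (0 : N))) (.cons x p) = 0 := by
        unfold pull; simp only [sumOver_zero]
      rw [hz2, zero_add]
      refine sumOver_congr _ fun s hs => ?_
      refine ih _ ?_ (hφ.cons _) s.right rfl
      rw [← hn, len_cons, ← Chain.mem_splits _ s hs, Chain.len_append]
      omega

lemma ins_pull [Module K N] {F : Op V W g} (hF : IsOperation g 1 F) {mV : Op V V id}
    (hmV : IsOperation id 2 mV) {mW : Op W W id}
    (hmW : IsOperation id 2 mW)
    (hrel : ∀ {X Y : V.Ob} (p : V.Word X Y), ins mV (fun q => F X Y q) p =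
      pull F (fun q => mW (g X) (g Y) q) p)
    {X Y : V.Ob} {φ : W.Word (g X) (g Y) → N} (hφ : IsMultilinear φ) (p : V.Word X Y) :
    ins mV (pull F φ) p = pull F (ins mW φ) p := by
  induction hn : p.len using Nat.strong_induction_on generalizing Y with
  | _ n ih =>
    cases p with
    | nil =>
      have hm : IsMultilinear (pull F φ) := pull_multilinear hF hφ
      rw [ins_nil, pull_nil, ins_nil]
      have e1 : val 2 mV (.nil X) = V.el (0 + 2 - 0) 0 := by simp only [val, hmV.nil]; rfl
      have e2 : val 2 mW (.nil (g X)) = W.el (0 + 2 - 0) 0 := by simp only [val, hmW.nil]; rfl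
      rw [e1, e2]
      exact (hm.zero' _).trans (hφ.zero' _).symm
    | @cons Y' Y x p =>
      have hz0 : ∀ (r : W.Word (g X) (g Y)), φ (.cons (val 1 F (.nil Y)) r) = 0 := by
        intro r
        simp only [val, hF.nil]
        exact hφ.zero' (d := deg (.nil Y : V.Word _ _) + 1 - Chain.len (.nil Y : V.Word _ _)) r
      have h1 : ∀ s : Split V.El X Y,
          ins mV (fun v => pull F (fun q => φ (.cons (val 1 F v) q)) s.right) s.left =
          pull F (fun v => pull F (fun w => φ (.cons (val 2 mW v) w)) s.right) s.left := by
        intro s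
        have hL0 : ∀ d, pull F (fun r => φ (.cons (W.el d (0 : W.Hom (g s.mid) (g Y) d)) r))
            s.right = 0 := fun d => by simp only [hφ.zero']; exact pull_zero _ _
        have hL1 : ∀ d (a b : W.Hom (g s.mid) (g Y) d),
            pull F (fun r => φ (.cons (W.el d (a + b)) r)) s.right =
            pull F (fun r => φ (.cons (W.el d a) r)) s.right +
            pull F (fun r => φ (.cons (W.el d b) r)) s.right := fun d a b => by
          simp only [hφ.add']; exact pull_add _ _ _ _
        refine (ins_val mV F (L := fun y => pull F (fun r => φ (.cons y r)) s.right)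
          hL0 hL1 s.left).trans ?_
        rw [hrel]
        exact (pull_val F 2 mW (h := id) (L := fun y => pull F (fun r => φ (.cons y r)) s.right)
          hL0 hL1 s.left).symm
      rw [ins_congr mV _ (fun q hq => pull_eq hF hφ q hq),
        ins_splits mV (fun _ v w => pull F (fun q => φ (.cons (val 1 F v) q)) w), sumOver_add,
        sumOver_congr _ (fun s _ => h1 s),
        ← pull_splits F (fun _ v w => φ (.cons (val 2 mW v) w)), Chain.sum_splits_cons]
      simp only [hz0, pull_zero, ins_zero, smul_zero, zero_add]
      rw [pull_cons]
      rw [pull_cons, ← sumOver_add]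
      refine sumOver_congr _ fun s hs => ?_
      simp only [ins_cons]
      rw [pull_add, pull_units_smul]
      congr 1
      have hlt : s.right.len < n := by
        rw [← hn, len_cons, ← Chain.mem_splits _ s hs, Chain.len_append]
        omega
      have := ih _ hlt (hφ.cons (val 1 F (.cons x s.left))) s.right rfl
      rw [← this]
      congr 1
      rw [Int.negOnePow_eq_iff]
      refine ⟨(Chain.len (.cons x s.left : V.Word _ _) : ℤ) - 1, ?_⟩
      simp only [eps, val_fst]
      ring

/-! The same for the operations without shift. -/

/-- `∑ ± G_r (F^{s_r} ⊗ ... ⊗ F^{s_1})`. -/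
def comp (G : Op W U h) (F : Op V W g) : Op V U (fun X => h (g X)) :=
  fun X Y p => blockSum F (fun q => G (g X) (g Y) q) p

lemma twist_injective {ω ω' : Op V W g} (H : twist ω = twist ω') : ω = ω' := by
  funext X Y p e
  have := congrFun (congrFun (congrFun (congrFun H X) Y) p) e
  exact smul_left_cancel _ this

lemma twist_comp {G : Op W U h} (hG : IsOperation h 1 G) (F : Op V W g) :
    twist (comp G F) = compOp (twist G) (twist F) := by
  funext X Y p
  exact kap_pull F (hG.multilinear _ _) p

lemma IsOperation.of_twist {c : ℤ} {ω : Op V W g} (H : IsOperation g c (GQuiver.twist ω)) :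
    IsOperation g c ω := by
  have := H.twist
  have e : GQuiver.twist (GQuiver.twist ω) = ω := by
    funext X Y p e
    simp only [GQuiver.twist, smul_smul, Int.units_mul_self, one_smul]
  rwa [e] at this

lemma IsOperation.comp {G : Op W U h} {F : Op V W g} (hG : IsOperation h 1 G)
    (hF : IsOperation g 1 F) : IsOperation (fun X => h (g X)) 1 (comp G F) := by
  apply IsOperation.of_twist
  rw [twist_comp hG]
  exact hG.twist.compOp hF.twist

lemma relation_iff {F : Op V W g} (hF : IsOperation g 1 F) (mV : Op V V id) {mW : Op W W id}
    (hmW : IsOperation id 2 mW) {X Y : V.Ob} (p : V.Word X Y) :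
    insertSum mV (fun q => F X Y q) p = blockSum F (fun q => mW (g X) (g Y) q) p ↔
    ins (twist mV) (fun q => twist F X Y q) p =
      pull (twist F) (fun q => twist mW (g X) (g Y) q) p := by
  have h1 := kap_ins mV (hF.multilinear X Y) p
  have h2 := kap_pull F (hmW.multilinear (g X) (g Y)) p
  rw [← smul_left_cancel_iff (kap p).negOnePow, h1]
  refine Eq.congr rfl ?_
  exact h2

lemma comp_relation {G : Op W U h} {F : Op V W g} (hG : IsOperation h 1 G)
    (hF : IsOperation g 1 F) {mV : Op V V id} (hmV : IsOperation id 2 mV) {mW : Op W W id}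
    (hmW : IsOperation id 2 mW) {mU : Op U U id} (hmU : IsOperation id 2 mU)
    (rF : ∀ {X Y : V.Ob} (p : V.Word X Y),
      insertSum mV (fun q => F X Y q) p = blockSum F (fun q => mW (g X) (g Y) q) p)
    (rG : ∀ {X Y : W.Ob} (p : W.Word X Y),
      insertSum mW (fun q => G X Y q) p = blockSum G (fun q => mU (h X) (h Y) q) p)
    {X Y : V.Ob} (p : V.Word X Y) :
    insertSum mV (fun q => comp G F X Y q) p =
      blockSum (comp G F) (fun q => mU (h (g X)) (h (g Y)) q) p := by
  rw [relation_iff (hG.comp hF) mV hmU, twist_comp hG]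
  rw [pull_compOp hG.twist (hmU.twist.multilinear _ _)]
  have key : ∀ q : W.Word (g X) (g Y), ins (twist mW) (fun r => twist G _ _ r) q =
      pull (twist G) (fun r => twist mU _ _ r) q := fun q => (relation_iff hG mW hmU q).1 (rG q)
  have := ins_pull hF.twist hmV.twist hmW.twist
    (fun p => (relation_iff hF mV hmW p).1 (rF p)) (hG.twist.multilinear (g X) (g Y)) p
  refine this.trans ?_
  exact congrArg (fun φ => pull (twist F) φ p) (funext key)

lemma comp_assoc {T : GQuiver K} {k : U.Ob → T.Ob} {H : Op U T k} {G : Op W U h} {F : Op V W g}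
    (hH : IsOperation k 1 H) (hG : IsOperation h 1 G) :
    comp H (comp G F) = comp (comp H G) F := by
  apply twist_injective
  rw [twist_comp hH, twist_comp hG, twist_comp (hH.comp hG), twist_comp hH]
  funext X Y p
  exact pull_compOp hG.twist (hH.twist.multilinear _ _) p

/-- The identity operation: it is the identity on strings of length one, and zero otherwise. -/
def idOp (V : GQuiver K) : Op V V id := fun X _ p =>
  match p with
  | .cons x (.nil _) => Pi.single x.1 x.2
  | _ => 0

lemma idOp_single {X Y : V.Ob} (x : V.El X Y) :
    idOp V X Y (.cons x (.nil X)) = Pi.single x.1 x.2 := rfl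

lemma idOp_of_len {X Y : V.Ob} (p : V.Word X Y) (hp : p.len ≠ 1) : idOp V X Y p = 0 := by
  rcases p with _ | ⟨x, _ | ⟨y, p⟩⟩
  · rfl
  · simp at hp
  · rfl

lemma isOperation_idOp (V : GQuiver K) : IsOperation id 1 (idOp V) where
  nil X := rfl
  degree {X Y} p e he := by
    rcases p with _ | ⟨x, _ | ⟨y, p⟩⟩
    · rfl
    · rw [idOp_single, Pi.single_eq_of_ne]
      intro h'
      apply he
      simp [h']
    · rfl
  multilinear X Y :=
    { add := fun u f g w => by
        rcases u with _ | ⟨x, u⟩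
        · rcases w with _ | ⟨y, w⟩
          · exact Pi.single_add _ _ _
          · exact (add_zero (0 : ∀ e, V.Hom _ _ e)).symm
        · have hl : ∀ z, (Chain.append (.cons x u) (.cons z w) : V.Word X Y).len ≠ 1 := by
            intro z
            rw [Chain.len_append, len_cons, len_cons]
            omega
          simp only [idOp_of_len _ (hl _), add_zero]
      smul := fun u a f w => by
        rcases u with _ | ⟨x, u⟩
        · rcases w with _ | ⟨y, w⟩
          · exact Pi.single_smul _ _ _
          · exact (smul_zero a (A := ∀ e, V.Hom _ _ e)).symm
        · have hl : ∀ z, (Chain.append (.cons x u) (.cons z w) : V.Word X Y).len ≠ 1 := by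
            intro z
            rw [Chain.len_append, len_cons, len_cons]
            omega
          simp only [idOp_of_len _ (hl _), smul_zero] }

lemma twist_idOp (V : GQuiver K) : twist (idOp V) = idOp V := by
  funext X Y p e
  rcases p with _ | ⟨x, _ | ⟨y, p⟩⟩
  · exact smul_zero _
  · simp [twist, kap_cons]
  · exact smul_zero _

lemma idOp_val {c : ℤ} {ω : Op V W g} (hω : IsOperation g c ω) {X Y : V.Ob} (p : V.Word X Y) :
    idOp W (g X) (g Y) (.cons (val c ω p) (.nil (g X))) = ω X Y p := by
  rw [idOp_single]
  funext e
  by_cases he : e = deg p + c - p.len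
  · subst he
    exact Pi.single_eq_same _ _
  · rw [hω.degree p e he]
    exact Pi.single_eq_of_ne he _

lemma idOp_cons_of_len {X Y Z : V.Ob} (x : V.El Y Z) (p : V.Word X Y) (hp : p.len ≠ 0) :
    idOp V X Z (.cons x p) = 0 := idOp_of_len _ (by simpa using hp)

lemma pull_idOp [Module K N] {X Y : V.Ob} {φ : V.Word X Y → N} (hφ : IsMultilinear φ) (p : V.Word X Y) :
    pull (idOp V) φ p = φ p := by
  induction p with
  | nil => exact pull_nil (idOp V) φ
  | cons x p ih =>
    refine (pull_cons (idOp V) x p φ).trans ?_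
    have h0 : ∀ (Z Z' : V.Ob) (y : V.El Z _) (q : V.Word Z' Z) (r : V.Word X Z'), q.len + 1 ≠ 1 →
        φ (.cons (val 1 (idOp V) (.cons y q)) r) = 0 := by
      intro Z Z' y q r hq
      have : val 1 (idOp V) (.cons y q) = V.el (deg (.cons y q : V.Word _ _) + 1 -
          Chain.len (.cons y q : V.Word _ _)) 0 := by
        simp only [val, idOp_of_len _ (by simpa using hq : Chain.len (.cons y q : V.Word _ _) ≠ 1)]
        rfl
      rw [this]
      exact hφ.zero' _
    cases p with
    | nil =>
      rw [Chain.sum_splits_nil]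
      refine (pull_nil (idOp V) _).trans ?_
      rw [val_eq 1 (idOp V) _ (e := x.1) (by simp)]
      congr 2
      simp only [idOp_single, Pi.single_eq_same]
      rfl
    | cons y p =>
      rw [Chain.sum_splits_cons]
      have : val 1 (idOp V) (.cons x (.nil _)) = x := by
        rw [val_eq 1 (idOp V) _ (e := x.1) (by simp)]
        simp only [idOp_single, Pi.single_eq_same]
        rfl
      simp only [this]
      have e1 := ih (hφ.cons x)
      refine Eq.trans (congrArg₂ (· + ·) e1 ?_) (add_zero _)
      refine sumOver_eq_zero _ fun s _ => ?_
      refine Eq.trans (congrArg (fun F => pull (idOp V) F s.right) (funext fun r => ?_))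
        (pull_zero (idOp V) s.right)
      exact h0 _ _ _ _ _ (by simp)

lemma comp_idOp {G : Op V W g} (hG : IsOperation g 1 G) : comp G (idOp V) = G := by
  apply twist_injective
  have := twist_comp hG (idOp V)
  refine this.trans ?_
  rw [twist_idOp]
  funext X Y p
  exact pull_idOp (hG.twist.multilinear X Y) p

lemma compOp_idOp {F : Op V W g} (hF : IsOperation g 1 F) : compOp (idOp W) F = F := by
  funext X Y p
  cases p with
  | nil => rw [hF.nil]; exact pull_nil F _
  | cons x p =>
    refine (pull_cons F x p _).trans ?_
    rw [Chain.sum_splits_right_nil]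
    · refine (pull_nil F _).trans ?_
      exact idOp_val hF (.cons x p)
    · intro s hs
      refine (pull_congr F s.right hs fun q hq => ?_).trans (pull_zero F s.right)
      exact idOp_cons_of_len _ q hq

lemma idOp_comp {F : Op V W g} (hF : IsOperation g 1 F) : comp (idOp W) F = F := by
  apply twist_injective
  refine (twist_comp (isOperation_idOp W) F).trans ?_
  rw [twist_idOp]
  exact compOp_idOp hF.twist

lemma ins_idOp {m : Op V V id} (hm : IsOperation id 2 m) {X Y : V.Ob} (p : V.Word X Y) :
    ins m (fun q => idOp V X Y q) p = m X Y p := by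
  cases p with
  | nil =>
    rw [ins_nil]
    exact idOp_val hm (.nil X)
  | cons x p =>
    rw [ins_cons, ins_congr m p (ψ := fun _ => 0) (fun q hq => idOp_cons_of_len x q hq), ins_zero,
      smul_zero, add_zero]
    unfold ins0
    rw [Chain.sum_splits_right_nil]
    · exact idOp_val hm (.cons x p)
    · intro s hs
      exact idOp_cons_of_len _ _ hs

lemma idOp_relation {m : Op V V id} (hm : IsOperation id 2 m) {X Y : V.Ob} (p : V.Word X Y) :
    insertSum m (fun q => idOp V X Y q) p = blockSum (idOp V) (fun q => m X Y q) p := by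
  refine (relation_iff (isOperation_idOp V) m hm p).2 ?_
  rw [twist_idOp]
  exact (ins_idOp hm.twist p).trans (pull_idOp (hm.twist.multilinear X Y) p).symm

lemma blockSum_single (F : Op V W g) {X Y : V.Ob} (φ : W.Word (g X) (g Y) → N) (x : V.El X Y) :
    blockSum F φ (.cons x (.nil X)) = φ (.cons (val 1 F (.cons x (.nil X))) (.nil (g X))) := by
  simp [blockSum, Chain.blocks, Chain.extendHead, blockSign, Chain.total, Chain.map]

lemma insertSum_single [Module K N] {m : Op V V id} (hm : IsOperation id 2 m) {X Y : V.Ob}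
    {φ : V.Word X Y → N} (hφ : IsMultilinear φ) (x : V.El X Y) :
    insertSum m φ (.cons x (.nil X)) = φ (.cons (val 2 m (.cons x (.nil X))) (.nil X)) := by
  have h0 : ∀ Z, val 2 m (.nil Z) = V.el (0 + 2 - 0) 0 := by
    intro Z
    simp only [val, hm.nil]
    rfl
  simp only [insertSum, Chain.sum_splits_cons, Chain.sum_splits_nil, h0]
  have h1 := hφ.zero (d := 0 + 2 - 0) (.cons x (.nil X)) (.nil X)
  have h2 := hφ.zero (d := 0 + 2 - 0) (.nil Y) (.cons x (.nil X))
  refine Eq.trans (congrArg₂ (· + ·) (congrArg₂ (· + ·) (congrArg _ h2) rfl) (congrArg _ h1)) ?_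
  simp [Chain.append]

end comp

end ops


end GQuiver

open GQuiver

/-- A non-unital `A_∞` category over `K`. `m X Y p e` is the component of degree `e` of
`m_n (f_n, ..., f_1)`, where `p = (f_n, ..., f_1)` has length `n`. -/
structure NUAInfCat (K : Type u) [Field K] extends GQuiver K where
  m : Op toGQuiver toGQuiver id
  isOperation : IsOperation id 2 m
  relation : ∀ {X Y : Ob} (p : toGQuiver.Word X Y), insertSum m (fun q => m X Y q) p = 0

/-- A strictly unital `A_∞` category over `K`. -/
structure AInfCat (K : Type u) [Field K] extends NUAInfCat K where
  one : ∀ X : Ob, Hom X X 0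
  m_one : ∀ X : Ob, m _ _ (.cons (toGQuiver.el 0 (one X)) (.nil X)) = 0
  one_comp : ∀ {X Y : Ob} {d : ℤ} (f : Hom X Y d),
    m _ _ (.cons (toGQuiver.el 0 (one Y)) (.cons (toGQuiver.el d f) (.nil X))) d = f
  comp_one : ∀ {X Y : Ob} {d : ℤ} (f : Hom X Y d),
    m _ _ (.cons (toGQuiver.el d f) (.cons (toGQuiver.el 0 (one X)) (.nil X))) d = f
  m_unit : ∀ {X Y Z : Ob} (u : toGQuiver.Word Z Y) (w : toGQuiver.Word X Z),
    2 < u.len + 1 + w.len → m _ _ (u.append (.cons (toGQuiver.el 0 (one Z)) w)) = 0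

/-- The linear map `m_1` between the components of degrees `i` and `j` (zero unless `j = i + 1`). -/
def NUAInfCat.m₁ {K : Type u} [Field K] (A : NUAInfCat K) (X Y : A.Ob) (i j : ℤ) :
    A.Hom X Y i →ₗ[K] A.Hom X Y j where
  toFun f := A.m X Y (.cons (A.el i f) (.nil X)) j
  map_add' f g := congrFun ((A.isOperation.multilinear X Y).add' f g (.nil X)) j
  map_smul' a f := congrFun ((A.isOperation.multilinear X Y).smul' a f (.nil X)) j

/-- The complex of morphisms from `X` to `Y`, with differential `m_1`. -/
def NUAInfCat.homComplex {K : Type u} [Field K] (A : NUAInfCat K) (X Y : A.Ob) :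
    CochainComplex (ModuleCat.{u} K) ℤ where
  X i := ModuleCat.of K (A.Hom X Y i)
  d i j := ModuleCat.ofHom (A.m₁ X Y i j)
  shape i j h := by
    refine ModuleCat.hom_ext (LinearMap.ext fun f => ?_)
    refine A.isOperation.degree _ _ fun h' => h ?_
    simp only [deg_cons, deg_nil, len_cons, len_nil, el_fst] at h'
    change i + 1 = j
    push_cast at h'
    omega
  d_comp_d' i j k hij hjk := by
    refine ModuleCat.hom_ext (LinearMap.ext fun f => ?_)
    have h := A.relation (.cons (A.el i f) (.nil X))
    rw [insertSum_single A.isOperation (A.isOperation.multilinear X Y),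
      val_eq 2 A.m _ (e := j)] at h
    · exact congrFun h k
    · change i + 1 = j at hij
      simp
      omega

/-- A non-unital `A_∞` functor. `map X Y p e` is the component of degree `e` of
`F^n (f_n, ..., f_1)`, where `p = (f_n, ..., f_1)` has length `n`. -/
structure NUAInfFunctor {K : Type u} [Field K] (A B : NUAInfCat K) where
  obj : A.Ob → B.Ob
  map : Op A.toGQuiver B.toGQuiver obj
  isOperation : IsOperation obj 1 map
  relation : ∀ {X Y : A.Ob} (p : A.Word X Y),
    insertSum A.m (fun q => map X Y q) p = blockSum map (fun q => B.m (obj X) (obj Y) q) p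

/-- A strictly unital `A_∞` functor. -/
structure AInfFunctor {K : Type u} [Field K] (A B : AInfCat K) extends
    NUAInfFunctor A.toNUAInfCat B.toNUAInfCat where
  map_one : ∀ X : A.Ob, map _ _ (.cons (A.el 0 (A.one X)) (.nil X)) 0 = B.one (obj X)
  map_unit : ∀ {X Y Z : A.Ob} (u : A.Word Z Y) (w : A.Word X Z),
    0 < u.len + w.len → map _ _ (u.append (.cons (A.el 0 (A.one Z)) w)) = 0

lemma NUAInfFunctor.map_m₁ {K : Type u} [Field K] {A B : NUAInfCat K} (F : NUAInfFunctor A B)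
    {X Y : A.Ob} {i j : ℤ} (f : A.Hom X Y i) (hij : i + 1 = j) :
    F.map X Y (.cons (A.el j (A.m₁ X Y i j f)) (.nil X)) j =
      B.m₁ (F.obj X) (F.obj Y) i j (F.map X Y (.cons (A.el i f) (.nil X)) i) := by
  have h := F.relation (.cons (A.el i f) (.nil X))
  rw [insertSum_single A.isOperation (F.isOperation.multilinear X Y), blockSum_single,
    val_eq 2 A.m _ (e := j) (by rw [deg_cons, deg_nil, len_cons, len_nil, el_fst]; omega),
    val_eq 1 F.map _ (e := i) (by rw [deg_cons, deg_nil, len_cons, len_nil, el_fst]; omega)] at h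
  exact congrFun h j

/-- The map induced by `F^1` on complexes of morphisms. -/
def NUAInfFunctor.homMap {K : Type u} [Field K] {A B : NUAInfCat K} (F : NUAInfFunctor A B)
    (X Y : A.Ob) : A.homComplex X Y ⟶ B.homComplex (F.obj X) (F.obj Y) where
  f i := ModuleCat.ofHom
    { toFun := fun f => F.map X Y (.cons (A.el i f) (.nil X)) i
      map_add' := fun f g => congrFun ((F.isOperation.multilinear X Y).add' f g (.nil X)) i
      map_smul' := fun a f => congrFun ((F.isOperation.multilinear X Y).smul' a f (.nil X)) i }
  comm' i j hij := by
    refine ModuleCat.hom_ext (LinearMap.ext fun f => ?_)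
    have h := F.relation (.cons (A.el i f) (.nil X))
    exact (F.map_m₁ f hij).symm

/-- `F` is a quasi-isomorphism if `H(F)` is an isomorphism of (graded, non-unital) categories: it is
bijective on objects and induces isomorphisms on the cohomology of the complexes of morphisms. -/
def NUAInfFunctor.IsQuasiIso {K : Type u} [Field K] {A B : NUAInfCat K} (F : NUAInfFunctor A B) :
    Prop :=
  Function.Bijective F.obj ∧ ∀ X Y : A.Ob, QuasiIso (F.homMap X Y)

namespace AInfFunctor

variable {K : Type u} [Field K] {A B C D : AInfCat K}

lemma ext' {F G : AInfFunctor A B} (h : F.obj = G.obj) (h' : HEq F.map G.map) : F = G := by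
  rcases F with ⟨⟨o, m, _, _⟩, _, _⟩
  rcases G with ⟨⟨o', m', _, _⟩, _, _⟩
  dsimp only at h
  subst h
  obtain rfl := eq_of_heq h'
  rfl

/-- The identity functor: `F^1 = id` and `F^n = 0` for `n ≠ 1`. -/
def idFunctor (A : AInfCat K) : AInfFunctor A A where
  obj := id
  map := idOp A.toGQuiver
  isOperation := isOperation_idOp _
  relation := idOp_relation A.isOperation
  map_one X := by
    rw [idOp_single]
    exact Pi.single_eq_same _ _
  map_unit u w h := by
    refine idOp_of_len _ ?_
    rw [Chain.len_append, len_cons]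
    omega

/-- The composition of `A_∞` functors: `(G F)^n = ∑ ± G^r (F^{s_r} ⊗ ... ⊗ F^{s_1})`. -/
def comp (F : AInfFunctor A B) (G : AInfFunctor B C) : AInfFunctor A C where
  obj X := G.obj (F.obj X)
  map := GQuiver.comp G.map F.map
  isOperation := G.isOperation.comp F.isOperation
  relation p := comp_relation G.isOperation F.isOperation A.isOperation B.isOperation
    C.isOperation F.relation G.relation p
  map_one X := by
    unfold GQuiver.comp
    rw [blockSum_single, val_eq 1 F.map _ (e := 0) (by simp), F.map_one]
    exact G.map_one _
  map_unit {X Y Z} u w hl := by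
    obtain ⟨L, h1, h2⟩ := Chain.blocks_mid u w
    unfold GQuiver.comp blockSum
    rw [h1, sumOver_map]
    refine sumOver_eq_zero _ fun c hc => ?_
    refine (congrArg _ ?_).trans (smul_zero _)
    simp only [Chain.Ctx.fill, Chain.map_append, Chain.map]
    have h3 := h2 c hc
    obtain ⟨S, T, α, u', w', β⟩ := c
    dsimp only at h3 ⊢
    by_cases hz : u'.len + w'.len = 0
    · rcases u' with _ | ⟨y, u'⟩
      · rcases w' with _ | ⟨z, w'⟩
        · have e : val 1 F.map (Chain.append (.nil _) (.cons (A.el 0 (A.one Z)) (.nil Z))) =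
              B.el 0 (B.one (F.obj Z)) := by
            rw [val_eq 1 F.map _ (e := 0) (by simp [Chain.append]), ← F.map_one]
            rfl
          rw [e]
          refine G.map_unit _ _ ?_
          rw [Chain.len_map, Chain.len_map]
          by_contra hab
          rcases α with _ | ⟨a, α⟩
          · rcases β with _ | ⟨b, β⟩
            · simp [Chain.total] at h3
              omega
            · simp [Chain.len] at hab
          · simp [Chain.len] at hab
        · simp at hz
      · simp at hz
    · have e := F.map_unit u' w' (by omega)
      simp only [val, e]
      exact (G.isOperation.multilinear _ _).zero _ _

lemma id_comp' (F : AInfFunctor A B) : (idFunctor A).comp F = F :=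
  ext' (F := (idFunctor A).comp F) (G := F) rfl
    (heq_of_eq (comp_idOp (V := A.toGQuiver) (W := B.toGQuiver) F.isOperation))

lemma comp_id' (F : AInfFunctor A B) : F.comp (idFunctor B) = F :=
  ext' (F := F.comp (idFunctor B)) (G := F) rfl
    (heq_of_eq (idOp_comp (V := A.toGQuiver) (W := B.toGQuiver) F.isOperation))

lemma assoc' (F : AInfFunctor A B) (G : AInfFunctor B C) (H : AInfFunctor C D) :
    (F.comp G).comp H = F.comp (G.comp H) :=
  ext' (F := (F.comp G).comp H) (G := F.comp (G.comp H)) rfl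
    (heq_of_eq (comp_assoc (F := F.map) H.isOperation G.isOperation))

end AInfFunctor

/-- The category of strictly unital `A_∞` categories and strictly unital `A_∞` functors. -/
instance AInfCat.category (K : Type u) [Field K] : Category.{u} (AInfCat.{u} K) where
  Hom A B := AInfFunctor A B
  id A := AInfFunctor.idFunctor A
  comp F G := F.comp G
  id_comp := AInfFunctor.id_comp'
  comp_id := AInfFunctor.comp_id'
  assoc := AInfFunctor.assoc'

/-- A dg category: a strictly unital `A_∞` category with `m_n = 0` for `n > 2`. -/
structure DGCat (K : Type u) [Field K] extends AInfCat K where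
  m_higher : ∀ {X Y : Ob} (p : toGQuiver.Word X Y), 2 < p.len → m _ _ p = 0

/-- A dg functor: a strictly unital `A_∞` functor which is strict, that is `F^n = 0` for `n > 1`. -/
structure DGFunctor {K : Type u} [Field K] (A B : DGCat K) extends
    AInfFunctor A.toAInfCat B.toAInfCat where
  strict : ∀ {X Y : A.Ob} (p : A.Word X Y), 1 < p.len → map _ _ p = 0

namespace DGFunctor

variable {K : Type u} [Field K] {A B C : DGCat K}

lemma ext' {F G : DGFunctor A B} (h : F.toAInfFunctor = G.toAInfFunctor) : F = G := by
  cases F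
  cases G
  dsimp only at h
  subst h
  rfl

/-- The identity dg functor. -/
def idFunctor (A : DGCat K) : DGFunctor A A where
  toAInfFunctor := AInfFunctor.idFunctor A.toAInfCat
  strict p h := idOp_of_len p (by omega)

/-- Composition of dg functors. -/
def comp (F : DGFunctor A B) (G : DGFunctor B C) : DGFunctor A C where
  toAInfFunctor := F.toAInfFunctor.comp G.toAInfFunctor
  strict {X Y} p hp := by
    refine sumOver_eq_zero _ fun δ hδ => (congrArg _ ?_).trans (smul_zero _)
    have hl := len_flat δ
    rw [flat_blocks p δ hδ] at hl
    rcases δ with _ | ⟨b, _ | ⟨b', δ⟩⟩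
    · simp [Chain.total] at hl
      omega
    · have hb : 1 < b.len := by
        simp only [Chain.total] at hl
        omega
      simp only [Chain.map, val, F.strict b hb]
      exact (G.isOperation.multilinear _ _).zero' _
    · refine G.strict _ ?_
      rw [Chain.len_map, Chain.len, Chain.len]
      omega

end DGFunctor

/-- The category of dg categories and dg functors. -/
instance DGCat.category (K : Type u) [Field K] : Category.{u} (DGCat.{u} K) where
  Hom A B := DGFunctor A B
  id A := DGFunctor.idFunctor A
  comp F G := F.comp G
  id_comp F := DGFunctor.ext' (AInfFunctor.id_comp' F.toAInfFunctor)
  comp_id F := DGFunctor.ext' (AInfFunctor.comp_id' F.toAInfFunctor)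
  assoc F G H := DGFunctor.ext' (AInfFunctor.assoc' F.toAInfFunctor G.toAInfFunctor H.toAInfFunctor)

/-- The inclusion of dg categories into strictly unital `A_∞` categories. -/
def DGCat.inclusion (K : Type u) [Field K] : DGCat.{u} K ⥤ AInfCat.{u} K where
  obj A := A.toAInfCat
  map F := F.toAInfFunctor

end AInf

/-! The dg category `freeDG A` has the objects of `A`. Its morphisms are formal expressions built
from symbols F(p), one for each string p in `A`, by identities, differential, composition and linear
combinations. Two expressions are identified when they take the same value under every strictly
unital A∞ functor from `A` to a dg category. An identity in `freeDG A` can therefore be checked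
after evaluation: this yields the dg axioms (`freeData`) and the fact that p ↦ F(p) is an A∞ functor
η (`freeUnit`). Evaluation along a given functor is a dg functor (`freeLift`), and it is the only
one extending that functor because the symbols generate (`eval_freeUnit_comp`). The bijection
`freeEquiv` follows, and with it the adjunction.

The morphism spaces of `freeDG A` are thus not explicit, and proving that η is a quasi-isomorphism
requires functors from `A` to dg categories that see enough. For each object X₀ a single one
suffices. If F is an A∞ functor from `A` to a dg category B, the cone of F¹ on morphisms out of X₀,
that is Y ↦ A(X₀,Y) ⊕ B(FX₀,FY) with the second summand shifted by one, is a strictly unital A∞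
module over `A` (`Cone.module`). An A∞ module is turned into an A∞ functor to a dg category of
complexes (`AInfModule.functor`).

Taking F = η, the category `freeDG A` itself acts on the cone. The element (1,0) over X₀ has
differential (0,1), and v sends (0,g) to (0,v∘g) (`ev_of_fst_eq_zero`). Write v·(1,0) = ±(r v, h v).
Comparing D(v·(1,0)) with (dv)·(1,0) and v·(0,1), the first coordinates say that r is a chain map
(`ret_diff`), and the second coordinates say that v = η(r v) + d(h v) + h(dv) (`htpy_diff`). Strict
unitality gives r∘η¹ = id (`ret_unitLin`), so η¹ is a homotopy equivalence.

For the counit ε, a triangle identity says that η followed by the inclusion of ε is the identity,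
and two out of three applies.

Throughout, `twist` passes to shifted signs, for which an insertion carries only the sign of the
shifted degree on its left and substitution into blocks carries no sign. -/

namespace AInf

/-! ### Composition of maps of strings, and splittings of a string extended on the right. -/

namespace Chain

variable {O O' O'' : Type u} {Q : O → O → Type u} {Q' : O' → O' → Type u} {Q'' : O'' → O'' → Type u}

lemma map_map (g : O → O') (φ : ∀ X Y : O, Q X Y → Q' (g X) (g Y)) (g' : O' → O'')
    (φ' : ∀ X Y : O', Q' X Y → Q'' (g' X) (g' Y)) {X Y : O} (p : Chain Q X Y) :
    (p.map g φ).map g' φ' = p.map (fun X => g' (g X)) (fun X Y f => φ' _ _ (φ X Y f)) := by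
  induction p with
  | nil => rfl
  | cons f p ih => simp only [map, ih]

/-- The mirror image of `sum_splits_cons`. It serves strings whose rightmost entry plays the role of
a module element. -/
lemma sum_splits_snoc {N : Type*} [AddCommGroup N] {X X' Y : O} (p : Chain Q X Y) (a : Q X' X)
    (ψ : Split Q X' Y → N) :
    sumOver (p.append (cons a (nil X'))).splits ψ =
      sumOver p.splits (fun s => ψ ⟨s.mid, s.left, s.right.append (cons a (nil X'))⟩) +
        ψ ⟨X', p.append (cons a (nil X')), nil X'⟩ := by
  induction p with
  | nil => simp [append, sum_splits_cons, sum_splits_nil]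
  | cons f p ih => simp only [append, sum_splits_cons, ih, add_assoc]

end Chain

/-! ### Operations concentrated on strings of length one. -/

namespace GQuiver

variable {K : Type u} [Field K] {V W : GQuiver K} {g : V.Ob → W.Ob}

/-- A degreewise linear map on the morphisms, applied to homogeneous morphisms. -/
def elMap (φ : ∀ X Y d, V.Hom X Y d →ₗ[K] W.Hom (g X) (g Y) d) (X Y : V.Ob) (x : V.El X Y) :
    W.El (g X) (g Y) := ⟨x.1, φ X Y x.1 x.2⟩

/-- A degreewise linear map on the morphisms, regarded as an operation concentrated on strings of
length one. -/
def strictOp (φ : ∀ X Y d, V.Hom X Y d →ₗ[K] W.Hom (g X) (g Y) d) : Op V W g :=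
  fun X Y p e => φ X Y e (idOp V X Y p e)

section strict

variable (φ : ∀ X Y d, V.Hom X Y d →ₗ[K] W.Hom (g X) (g Y) d)

lemma isOperation_strictOp : IsOperation g 1 (strictOp φ) where
  nil X := by
    funext e
    exact (congrArg _ (congrFun ((isOperation_idOp V).nil X) e)).trans (map_zero _)
  degree {X Y} p e he := (congrArg _ ((isOperation_idOp V).degree p e he)).trans (map_zero _)
  multilinear X Y :=
    { add := fun u f h w => by
        funext e
        exact (congrArg _ (congrFun (((isOperation_idOp V).multilinear X Y).add u f h w) e)).trans
          (map_add _ _ _)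
      smul := fun u a f w => by
        funext e
        exact (congrArg _ (congrFun (((isOperation_idOp V).multilinear X Y).smul u a f w) e)).trans
          (map_smul _ _ _) }

lemma strictOp_single {X Y : V.Ob} {d : ℤ} (f : V.Hom X Y d) :
    strictOp φ X Y (.cons (V.el d f) (.nil X)) d = φ X Y d f := by
  unfold strictOp
  rw [idOp_single]
  exact congrArg _ (Pi.single_eq_same _ _)

lemma strictOp_of_len {X Y : V.Ob} (p : V.Word X Y) (hp : p.len ≠ 1) :
    strictOp φ X Y p = 0 := by
  funext e
  exact (congrArg _ (congrFun (idOp_of_len p hp) e)).trans (map_zero _)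

/-- The linear part of an operation. -/
def linPart {c : ℤ} {F : Op V W g} (hF : IsOperation g c F) (X Y : V.Ob) (d e : ℤ) :
    V.Hom X Y d →ₗ[K] W.Hom (g X) (g Y) e where
  toFun f := F X Y (.cons (V.el d f) (.nil X)) e
  map_add' f h := congrFun ((hF.multilinear X Y).add' f h (.nil X)) e
  map_smul' a f := congrFun ((hF.multilinear X Y).smul' a f (.nil X)) e

lemma eq_strictOp {F : Op V W g} (hF : IsOperation g 1 F)
    (h : ∀ {X Y : V.Ob} (p : V.Word X Y), 1 < p.len → F X Y p = 0) :
    F = strictOp (fun X Y d => linPart hF X Y d d) := by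
  funext X Y p
  rcases p with _ | ⟨x, _ | ⟨y, p⟩⟩
  · exact (hF.nil X).trans ((isOperation_strictOp _).nil X).symm
  · funext e
    by_cases he : e = x.1
    · subst he
      exact (strictOp_single (fun X Y d => linPart hF X Y d d) x.2).symm
    · have he' : e ≠ deg (.cons x (.nil X) : V.Word _ _) + 1 -
          Chain.len (.cons x (.nil X) : V.Word _ _) := by simpa using he
      rw [hF.degree _ e he', (isOperation_strictOp _).degree _ e he']
  · rw [h _ (by simp), strictOp_of_len _ _ (by simp)]

lemma isMultilinear_map {N : Type*} [AddCommGroup N] [Module K N] {X Y : V.Ob}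
    {ψ : W.Word (g X) (g Y) → N} (hψ : IsMultilinear ψ) :
    IsMultilinear (fun p : V.Word X Y => ψ (p.map g (elMap φ))) where
  add u f h w := by
    simp only [Chain.map_append, Chain.map, elMap, el, map_add]
    exact hψ.add _ _ _ _
  smul u a f w := by
    simp only [Chain.map_append, Chain.map, elMap, el, map_smul]
    exact hψ.smul _ _ _ _

/-- The value of `strictOp φ` on a block is φ applied to the value of `idOp`, so the claim is
`pull_idOp` for the function obtained from ψ by precomposing with φ. -/
lemma pull_strictOp {N : Type*} [AddCommGroup N] [Module K N] {X Y : V.Ob}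
    {ψ : W.Word (g X) (g Y) → N} (hψ : IsMultilinear ψ) (p : V.Word X Y) :
    pull (strictOp φ) ψ p = ψ (p.map g (elMap φ)) := by
  rw [← pull_idOp (isMultilinear_map φ hψ) p]
  unfold pull
  refine sumOver_congr _ fun δ _ => ?_
  exact congrArg ψ (Chain.map_map id (fun _ _ b => val 1 (idOp V) b) g (elMap φ) δ).symm

lemma twist_strictOp : twist (strictOp φ) = strictOp φ := by
  funext X Y p e
  have := congrFun (congrFun (congrFun (congrFun (twist_idOp V) X) Y) p) e
  refine Eq.trans ?_ (congrArg (φ X Y e) this)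
  simp only [twist, strictOp]
  rcases Int.units_eq_one_or (kap p).negOnePow with h | h <;> rw [h] <;> simp

lemma sumOver_linear {α M N : Type*} [AddCommGroup M] [AddCommGroup N] [Module K M] [Module K N]
    (F : M →ₗ[K] N) (l : List α) (f : α → M) :
    F (sumOver l f) = sumOver l (fun a => F (f a)) := sumOver_hom F.toAddMonoidHom l f

lemma map_units_smul' {M N : Type*} [AddCommGroup M] [AddCommGroup N] [Module K M] [Module K N]
    (F : M →ₗ[K] N) (s : ℤˣ) (x : M) : F (s • x) = s • F x := by
  rcases Int.units_eq_one_or s with h | h <;> rw [h] <;> simp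

lemma insertSum_linear {M N : Type*} [AddCommGroup M] [AddCommGroup N] [Module K M] [Module K N]
    (F : M →ₗ[K] N) (m : Op V V id) {X Y : V.Ob} (ψ : V.Word X Y → M) (p : V.Word X Y) :
    F (insertSum m ψ p) = insertSum m (fun q => F (ψ q)) p := by
  simp only [insertSum, sumOver_linear, map_units_smul']

lemma ins_linear {M N : Type*} [AddCommGroup M] [AddCommGroup N] [Module K M] [Module K N]
    (F : M →ₗ[K] N) (m : Op V V id) {X Y : V.Ob} (ψ : V.Word X Y → M) (p : V.Word X Y) :
    F (ins m ψ p) = ins m (fun q => F (ψ q)) p := by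
  simp only [ins, sumOver_linear, map_units_smul']

lemma blockSum_linear {M N : Type*} [AddCommGroup M] [AddCommGroup N] [Module K M] [Module K N]
    (L : M →ₗ[K] N) (F : Op V W g) {X Y : V.Ob} (ψ : W.Word (g X) (g Y) → M) (p : V.Word X Y) :
    L (blockSum F ψ p) = blockSum F (fun q => L (ψ q)) p := by
  simp only [blockSum, sumOver_linear, map_units_smul']

lemma pull_linear {M N : Type*} [AddCommGroup M] [AddCommGroup N] [Module K M] [Module K N]
    (L : M →ₗ[K] N) (F : Op V W g) {X Y : V.Ob} (ψ : W.Word (g X) (g Y) → M) (p : V.Word X Y) :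
    L (pull F ψ p) = pull F (fun q => L (ψ q)) p := by
  simp only [pull, sumOver_linear]

/-- By linearity φ can be moved outside the sum over blocks; what remains is composition with the
identity operation. -/
lemma strictOp_comp {U : GQuiver K} {h : W.Ob → U.Ob}
    (φ : ∀ X Y d, W.Hom X Y d →ₗ[K] U.Hom (h X) (h Y) d) {F : Op V W g} (hF : IsOperation g 1 F)
    (X Y : V.Ob) (p : V.Word X Y) (e : ℤ) :
    comp (strictOp φ) F X Y p e = φ (g X) (g Y) e (F X Y p e) := by
  have h0 : comp (idOp W) F = F := idOp_comp (V := V) (W := W) hF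
  have h1 : comp (idOp W) F X Y p e = F X Y p e :=
    congrFun (congrFun (congrFun (congrFun h0 X) Y) p) e
  rw [← h1]
  refine (congrFun (?_ : _ = fun e => φ (g X) (g Y) e (comp (idOp W) F X Y p e)) e)
  exact (blockSum_linear (LinearMap.pi fun e => (φ (g X) (g Y) e).comp (LinearMap.proj e)) F
    (fun q => idOp W (g X) (g Y) q) p).symm

lemma kap_map {X Y : V.Ob} (p : V.Word X Y) :
    kap (p.map g (elMap φ) : W.Word (g X) (g Y)) = kap p := by
  induction p with
  | nil => rfl
  | cons x p ih =>
    refine (kap_cons _ _).trans ?_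
    rw [ih, Chain.len_map]
    rfl

/-- In shifted signs the left side is φ applied to m and the right side is m of the φ-images. Since
φ preserves degrees and lengths, both carry the same sign `kap p`, which cancels. -/
lemma strictOp_relation_iff {mV : Op V V id} (hV : IsOperation id 2 mV) {mW : Op W W id}
    (hW : IsOperation id 2 mW) {X Y : V.Ob} (p : V.Word X Y) :
    insertSum mV (fun q => strictOp φ X Y q) p =
      blockSum (strictOp φ) (fun q => mW (g X) (g Y) q) p ↔
    ∀ e, φ X Y e (mV X Y p e) = mW (g X) (g Y) (p.map g (elMap φ)) e := by
  have h : ins (twist mV) (fun q => strictOp φ X Y q) p = fun e => φ X Y e (twist mV X Y p e) :=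
    (ins_linear (LinearMap.pi fun e => (φ X Y e).comp (LinearMap.proj e)) (twist mV)
      (fun q => idOp V X Y q) p).symm.trans (congrArg _ (ins_idOp hV.twist p))
  rw [relation_iff (isOperation_strictOp φ) mV hW p, twist_strictOp,
    pull_strictOp φ (hW.twist.multilinear (g X) (g Y)), h, funext_iff]
  simp only [twist, map_units_smul', kap_map, smul_left_cancel_iff]

end strict

/-! ### Sums simplified for targets without higher operations, and for strings ending in a marked
entry. -/

section expand

variable {N : Type*} [AddCommGroup N] [Module K N]

lemma val_eq_zero {c : ℤ} {ω : Op V W g} {X Y : V.Ob} {p : V.Word X Y} (h : ω X Y p = 0) :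
    val c ω p = W.el (deg p + c - p.len) 0 := by
  simp only [val, h]
  rfl

lemma IsMultilinear.val_zero {X Y : W.Ob} {φ : W.Word X Y → N} (hφ : IsMultilinear φ) {c : ℤ}
    {ω : Op V W g} {A B : V.Ob} {p : V.Word A B} (h : ω A B p = 0) (u : W.Word (g B) Y)
    (w : W.Word X (g A)) : φ (u.append (.cons (val c ω p) w)) = 0 := by
  rw [val_eq_zero h]
  exact hφ.zero u w

lemma IsMultilinear.val_zero' {X : W.Ob} {c : ℤ} {ω : Op V W g} {A B : V.Ob}
    {φ : W.Word X (g B) → N} (hφ : IsMultilinear φ)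
    {p : V.Word A B} (h : ω A B p = 0) (w : W.Word X (g A)) : φ (.cons (val c ω p) w) = 0 :=
  hφ.val_zero h (.nil _) w

/-- Pulling back a function that vanishes on strings with more than two entries. -/
lemma pull_of_len_le_two {F : Op V W g} (hF : IsOperation g 1 F) {X Y : V.Ob}
    {φ : W.Word (g X) (g Y) → N} (hφ : IsMultilinear φ) (h : ∀ q, 2 < q.len → φ q = 0)
    (p : V.Word X Y) (hp : p.len ≠ 0) :
    pull F φ p = φ (.cons (val 1 F p) (.nil (g X))) + sumOver p.splits (fun s =>
      φ (.cons (val 1 F s.left) (.cons (val 1 F s.right) (.nil (g X))))) := by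
  have key : ∀ {Z : V.Ob} (u : V.Word Z Y) (v : V.Word X Z), v.len ≠ 0 →
      pull F (fun q => φ (.cons (val 1 F u) q)) v =
        φ (.cons (val 1 F u) (.cons (val 1 F v) (.nil (g X)))) := by
    intro Z u v hv
    rw [pull_eq hF (hφ.cons _) v hv, Chain.sum_splits_right_nil]
    · exact pull_nil F _
    · intro s hs
      refine (pull_congr F s.right hs fun q hq => h _ ?_).trans (pull_zero F s.right)
      simp only [len_cons]
      omega
  rw [pull_eq hF hφ p hp]
  -- The family T records entries already moved into the left piece, so that the induction on the
  -- remaining string q goes through; the case needed is T = id.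
  have hsum : ∀ {Z : V.Ob} (q : V.Word X Z) (T : ∀ Z' : V.Ob, V.Word Z' Z → V.Word Z' Y),
      sumOver q.splits (fun s => pull F (fun r => φ (.cons (val 1 F (T _ s.left)) r)) s.right) =
      φ (.cons (val 1 F (T _ q)) (.nil (g X))) + sumOver q.splits (fun s =>
        φ (.cons (val 1 F (T _ s.left)) (.cons (val 1 F s.right) (.nil (g X))))) := by
    intro Z q
    induction q with
    | nil =>
      intro T
      rw [Chain.sum_splits_nil, Chain.sum_splits_nil, (hφ.cons _).val_zero' (hF.nil X), add_zero]
      exact pull_nil F _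
    | cons x q ih =>
      intro T
      rw [Chain.sum_splits_cons, Chain.sum_splits_cons, ih (fun Z' r => T Z' (.cons x r)),
        key _ _ (by simp)]
      abel
  exact hsum p (fun _ r => r)

/-- An insertion into p·a either leaves a untouched or swallows it as its last argument. The
remaining possibility, an empty insertion to the right of a, vanishes because m₀ = 0. -/
lemma ins_snoc {m : Op V V id} (hm : IsOperation id 2 m) {X X' Y : V.Ob}
    {φ : V.Word X' Y → N} (hφ : IsMultilinear φ) (p : V.Word X Y) (a : V.El X' X) :
    ins m φ (p.append (.cons a (.nil X'))) =
      ins m (fun q => φ (q.append (.cons a (.nil X')))) p +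
        sumOver p.splits (fun s => (eps s.left).negOnePow •
          φ (s.left.append (.cons (val 2 m (s.right.append (.cons a (.nil X')))) (.nil X')))) := by
  induction p with
  | nil =>
    simp only [Chain.append, ins_cons, ins_nil, Chain.sum_splits_nil, ins0, Chain.sum_splits_cons,
      eps_nil, Int.negOnePow_zero, one_smul]
    have := (hφ.cons a).val_zero' (c := 2) (hm.nil X') (.nil X')
    dsimp only [id] at this
    rw [this, smul_zero, add_zero]
  | cons x p ih =>
    have := ih (hφ.cons x)
    rw [Chain.append, ins_cons, this, Chain.sum_splits_cons, ins_cons]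
    simp only [Chain.append, eps_nil, Int.negOnePow_zero, one_smul, eps_cons,
      Int.negOnePow_add _ (eps _), ← smul_smul, sumOver_smul, smul_add]
    have h0 : ins0 m φ (.cons x (p.append (.cons a (.nil X')))) =
        ins0 m (fun q => φ (q.append (.cons a (.nil X')))) (.cons x p) +
          φ (.cons (val 2 m (.cons x (p.append (.cons a (.nil X'))))) (.nil X')) := by
      exact Chain.sum_splits_snoc (.cons x p) a (fun s => φ (.cons (val 2 m s.left) s.right))
    rw [h0]
    abel

end expand

end GQuiver

end AInf

/-! ### The A∞ relations on short strings. -/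

namespace AInf

open GQuiver

namespace GQuiver

section expand

variable {K : Type u} [Field K] {V : GQuiver K} {N : Type*} [AddCommGroup N] [Module K N]
  {m : Op V V id}

/-- With φ = m₂ and m₁ this is the Leibniz rule. The three terms come from inserting m₂ once and m₁
in two places; insertions of m₀ vanish. -/
lemma insertSum_pair (hm : IsOperation id 2 m) {X Y Z : V.Ob} {φ : V.Word X Z → N}
    (hφ : IsMultilinear φ) (x : V.El Y Z) (y : V.El X Y) :
    insertSum m φ (.cons x (.cons y (.nil X))) =
      φ (.cons (val 2 m (.cons x (.cons y (.nil X)))) (.nil X)) -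
      φ (.cons (val 2 m (.cons x (.nil Y))) (.cons y (.nil X))) -
      x.1.negOnePow • φ (.cons x (.cons (val 2 m (.cons y (.nil X))) (.nil X))) := by
  have h0 := hφ.val_zero' (c := 2) (hm.nil _) (.cons x (.cons y (.nil X)))
  have h1 := (hφ.cons x).val_zero' (c := 2) (hm.nil _) (.cons y (.nil X))
  have h2 := ((hφ.cons x).cons y).val_zero' (c := 2) (hm.nil _) (.nil X)
  dsimp only [id] at h0 h1 h2
  simp only [insertSum, Chain.sum_splits_cons, Chain.sum_splits_nil, Chain.append, h0, h1, h2]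
  simp [Int.negOnePow_add, Int.negOnePow_one]
  abel

/-- Insertions of m₁ leave three entries, on which φ vanishes, and m₃ is zero. Only the two
insertions of m₂ survive, which for φ = m₂ express associativity. -/
lemma insertSum_triple
    (h : ∀ {X Y : V.Ob} (p : V.Word X Y), 2 < p.len → m X Y p = 0) {X Y Z W : V.Ob}
    {φ : V.Word X W → N} (hφ : IsMultilinear φ) (h' : ∀ p, 2 < p.len → φ p = 0)
    (x : V.El Z W) (y : V.El Y Z) (z : V.El X Y) :
    insertSum m φ (.cons x (.cons y (.cons z (.nil X)))) =
      φ (.cons x (.cons (val 2 m (.cons y (.cons z (.nil X)))) (.nil X))) -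
      φ (.cons (val 2 m (.cons x (.cons y (.nil Y)))) (.cons z (.nil X))) := by
  have h0 := hφ.val_zero' (c := 2) (h (.cons x (.cons y (.cons z (.nil X)))) (by simp)) (.nil X)
  have h1 : ∀ {A B C : V.Ob} (a : V.El C W) (b : V.El B C) (c : V.El A B) (q : V.Word X A),
      φ (.cons a (.cons b (.cons c q))) = 0 := fun a b c q => h' _ (by simp)
  dsimp only [id] at h0
  simp only [insertSum, Chain.sum_splits_cons, Chain.sum_splits_nil, Chain.append, h0]
  simp [h1, Int.negOnePow_add, Int.negOnePow_one, Int.negOnePow_even 2 even_two]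
  abel

/-- Inserting an operation with at most two arguments into a string of length at least four leaves
at least three entries, where φ vanishes. -/
lemma insertSum_of_three_lt
    (h : ∀ {X Y : V.Ob} (p : V.Word X Y), 2 < p.len → m X Y p = 0) {X Y : V.Ob}
    {φ : V.Word X Y → N} (hφ : IsMultilinear φ) (h' : ∀ p, 2 < p.len → φ p = 0)
    (p : V.Word X Y) (hp : 3 < p.len) : insertSum m φ p = 0 := by
  refine sumOver_eq_zero _ fun s hs => sumOver_eq_zero _ fun t ht => ?_
  refine (congrArg _ ?_).trans (smul_zero _)
  by_cases hl : 2 < t.left.len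
  · exact hφ.val_zero (h _ hl) _ _
  · refine h' _ ?_
    have e1 := congrArg Chain.len (Chain.mem_splits _ s hs)
    have e2 := congrArg Chain.len (Chain.mem_splits _ t ht)
    rw [Chain.len_append] at e1 e2
    rw [Chain.len_append, len_cons]
    omega

end expand

end GQuiver

/-! ### From a differential and a composition to a dg category. -/

/-- A dg category given in the classical way: a differential and a composition, subject to the
Leibniz rule, associativity and the unit laws. Both are recorded between components of arbitrary
degrees and vanish where they are not defined. -/
structure DGData (K : Type u) [Field K] extends GQuiver K where
  d : ∀ X Y i j, Hom X Y i →ₗ[K] Hom X Y j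
  comp : ∀ X Y Z i j k, Hom Y Z i →ₗ[K] Hom X Y j →ₗ[K] Hom X Z k
  one : ∀ X, Hom X X 0
  d_degree : ∀ {X Y i j} (f : Hom X Y i), i + 1 ≠ j → d X Y i j f = 0
  comp_degree : ∀ {X Y Z i j k} (g : Hom Y Z i) (f : Hom X Y j), i + j ≠ k →
    comp X Y Z i j k g f = 0
  d_d : ∀ {X Y i} (j k) (f : Hom X Y i), d X Y j k (d X Y i j f) = 0
  leibniz : ∀ {X Y Z i j} (i' j' k k') (g : Hom Y Z i) (f : Hom X Y j), i + 1 = i' → j + 1 = j' →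
    i + j = k → k + 1 = k' → d X Z k k' (comp X Y Z i j k g f) =
      comp X Y Z i' j k' (d Y Z i i' g) f + i.negOnePow • comp X Y Z i j' k' g (d X Y j j' f)
  assoc : ∀ {X Y Z W i j k} (l l' n) (h : Hom Z W i) (g : Hom Y Z j) (f : Hom X Y k), i + j = l →
    j + k = l' → comp X Y W l k n (comp Y Z W i j l h g) f =
      comp X Z W i l' n h (comp X Y Z j k l' g f)
  d_one : ∀ X j, d X X 0 j (one X) = 0
  one_comp : ∀ {X Y i} (f : Hom X Y i), comp X Y Y 0 i i (one Y) f = f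
  comp_one : ∀ {X Y i} (f : Hom X Y i), comp X X Y i 0 i f (one X) = f

namespace DGData

variable {K : Type u} [Field K] (D : DGData K)

/-- The operations `m_n` of a dg category. -/
def op : Op D.toGQuiver D.toGQuiver id := fun X _ p e =>
  match p with
  | .cons x (.nil _) => D.d _ _ x.1 e x.2
  | .cons x (.cons y (.nil _)) => D.comp _ _ _ x.1 y.1 e x.2 y.2
  | _ => 0

lemma op_of_len {X Y : D.Ob} (p : D.Word X Y) (hp : 2 < p.len) : D.op X Y p = 0 := by
  rcases p with _ | ⟨x, _ | ⟨y, _ | ⟨z, p⟩⟩⟩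
  · simp at hp
  · simp at hp
  · simp at hp
  · rfl

lemma isOperation_op : IsOperation id 2 D.op where
  nil X := rfl
  degree {X Y} p e he := by
    rcases p with _ | ⟨x, _ | ⟨y, _ | ⟨z, p⟩⟩⟩
    · rfl
    · refine D.d_degree _ fun h => he ?_
      simp only [deg_cons, deg_nil, len_cons, len_nil]
      push_cast
      omega
    · refine D.comp_degree _ _ fun h => he ?_
      simp only [deg_cons, deg_nil, len_cons, len_nil]
      push_cast
      omega
    · rfl
  multilinear X Y :=
    { add := fun u f g w => by
        funext e
        rcases u with _ | ⟨x, _ | ⟨x', u⟩⟩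
        · rcases w with _ | ⟨y, _ | ⟨z, w⟩⟩
          · exact map_add _ _ _
          · exact LinearMap.map_add₂ _ _ _ _
          · exact (add_zero _).symm
        · rcases w with _ | ⟨y, w⟩
          · exact map_add _ _ _
          · exact (add_zero _).symm
        · have : ∀ y, D.op X Y ((Chain.cons x (.cons x' u)).append (.cons y w)) = 0 :=
            fun y => D.op_of_len _ (by simp; omega)
          simp only [this, add_zero]
      smul := fun u a f w => by
        funext e
        rcases u with _ | ⟨x, _ | ⟨x', u⟩⟩
        · rcases w with _ | ⟨y, _ | ⟨z, w⟩⟩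
          · exact map_smul _ _ _
          · exact LinearMap.map_smul₂ _ _ _ _
          · exact (smul_zero (A := D.Hom _ _ _) a).symm
        · rcases w with _ | ⟨y, w⟩
          · exact map_smul _ _ _
          · exact (smul_zero (A := D.Hom _ _ _) a).symm
        · have : ∀ y, D.op X Y ((Chain.cons x (.cons x' u)).append (.cons y w)) = 0 :=
            fun y => D.op_of_len _ (by simp; omega)
          simp only [this, smul_zero] }

lemma op_relation {X Y : D.Ob} (p : D.Word X Y) : insertSum D.op (fun q => D.op X Y q) p = 0 := by
  have hop := D.isOperation_op
  rcases p with _ | ⟨x, _ | ⟨y, _ | ⟨z, _ | ⟨w, p⟩⟩⟩⟩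
  · simp only [insertSum, Chain.sum_splits_nil, Chain.append]
    exact (congrArg _ ((hop.multilinear X X).val_zero' (hop.nil X) _)).trans (smul_zero _)
  · rw [insertSum_single hop (hop.multilinear X Y)]
    funext e
    exact D.d_d _ _ _
  · rw [insertSum_pair hop (hop.multilinear X Y),
      val_eq 2 D.op _ (e := x.1 + y.1) (by simp),
      val_eq 2 D.op _ (e := x.1 + 1) (by simp; ring),
      val_eq 2 D.op _ (e := y.1 + 1) (by simp; ring)]
    funext e
    -- The Leibniz rule concerns the single output degree |x| + |y| + 1; in every other degree each
    -- of the three terms is zero.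
    by_cases he : x.1 + y.1 + 1 = e
    · have := D.leibniz _ _ _ _ x.2 y.2 rfl rfl rfl he
      simp only [Pi.sub_apply, Pi.smul_apply, Pi.zero_apply]
      rw [sub_sub, sub_eq_zero]
      exact this
    · have h1 : D.op X Y (.cons (D.el (x.1 + y.1) (D.op _ _ (.cons x (.cons y (.nil X)))
          (x.1 + y.1))) (.nil X)) e = 0 := D.d_degree _ he
      have h2 : D.op X Y (.cons (D.el (x.1 + 1) (D.op _ _ (.cons x (.nil _)) (x.1 + 1)))
          (.cons y (.nil X))) e = 0 := D.comp_degree _ _ (by simp only [el_fst]; omega)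
      have h3 : D.op X Y (.cons x (.cons (D.el (y.1 + 1) (D.op _ _ (.cons y (.nil X)) (y.1 + 1)))
          (.nil X))) e = 0 := D.comp_degree _ _ (by simp only [el_fst]; omega)
      simp only [Pi.sub_apply, Pi.smul_apply, Pi.zero_apply]
      refine (congrArg₂ (· - ·) (congrArg₂ (· - ·) h1 h2) (congrArg _ h3)).trans ?_
      simp
  · rw [insertSum_triple D.op_of_len (hop.multilinear X Y) D.op_of_len,
      val_eq 2 D.op (.cons y (.cons z (.nil X))) (e := y.1 + z.1) (by simp),
      val_eq 2 D.op _ (e := x.1 + y.1) (by simp)]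
    funext e
    exact sub_eq_zero.2 (D.assoc _ _ e x.2 y.2 z.2 rfl rfl).symm
  · exact insertSum_of_three_lt D.op_of_len (hop.multilinear X Y) D.op_of_len _ (by simp)

/-- The dg category determined by a differential and a composition. -/
abbrev toDGCat : DGCat K where
  toGQuiver := D.toGQuiver
  m := D.op
  isOperation := D.isOperation_op
  relation := D.op_relation
  one := D.one
  m_one X := funext fun e => D.d_one X e
  one_comp f := D.one_comp f
  comp_one f := D.comp_one f
  m_unit u w h := D.op_of_len _ (by rw [Chain.len_append, len_cons]; omega)
  m_higher := D.op_of_len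

lemma twist_single {X Y : D.Ob} (x : D.El X Y) (e : ℤ) :
    twist D.toDGCat.m X Y (.cons x (.nil X)) e = D.d X Y x.1 e x.2 := by
  simp only [twist, kap_cons, kap_nil, len_nil, Nat.cast_zero, mul_zero, add_zero,
    Int.negOnePow_zero, one_smul]
  rfl

lemma twist_pair {X Y Z : D.Ob} (x : D.El Y Z) (y : D.El X Y) (e : ℤ) :
    twist D.toDGCat.m X Z (.cons x (.cons y (.nil X))) e =
      (x.1 + 1).negOnePow • D.comp X Y Z x.1 y.1 e x.2 y.2 := by
  simp only [twist, kap_cons, kap_nil, len_nil, len_cons, Nat.cast_zero, mul_zero, add_zero,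
    zero_add, Nat.cast_one, mul_one]
  rfl

lemma twist_of_len {X Y : D.Ob} (p : D.Word X Y) (hp : 2 < p.len) :
    twist D.toDGCat.m X Y p = 0 := by
  funext e
  exact (congrArg _ (congrFun (D.op_of_len p hp) e)).trans (smul_zero _)

end DGData

/-! ### The classical axioms recovered from the A∞ relations of a dg category. -/

namespace DGCat

variable {K : Type u} [Field K] (B : DGCat K)

/-- The composition of a dg category, between components of arbitrary degrees. -/
def comp₂ (X Y Z : B.Ob) (i j k : ℤ) : B.Hom Y Z i →ₗ[K] B.Hom X Y j →ₗ[K] B.Hom X Z k :=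
  LinearMap.mk₂ K (fun g f => B.m X Z (.cons (B.el i g) (.cons (B.el j f) (.nil X))) k)
    (fun g g' f => congrFun ((B.isOperation.multilinear X Z).add' g g' (.cons (B.el j f) (.nil X))) k)
    (fun a g f => congrFun ((B.isOperation.multilinear X Z).smul' a g (.cons (B.el j f) (.nil X))) k)
    (fun g f f' => congrFun (((B.isOperation.multilinear X Z).cons (B.el i g)).add' f f' (.nil X)) k)
    (fun a g f => congrFun (((B.isOperation.multilinear X Z).cons (B.el i g)).smul' a f (.nil X)) k)

variable {B}

lemma d_degree {X Y : B.Ob} {i j : ℤ} (f : B.Hom X Y i) (h : i + 1 ≠ j) : B.m₁ X Y i j f = 0 :=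
  B.isOperation.degree _ _ (by
    simp only [deg_cons, deg_nil, len_cons, len_nil, el_fst]
    push_cast
    omega)

lemma comp_degree {X Y Z : B.Ob} {i j k : ℤ} (g : B.Hom Y Z i) (f : B.Hom X Y j) (h : i + j ≠ k) :
    B.comp₂ X Y Z i j k g f = 0 :=
  B.isOperation.degree _ _ (by
    simp only [deg_cons, deg_nil, len_cons, len_nil, el_fst]
    push_cast
    omega)

lemma d_d {X Y : B.Ob} {i : ℤ} (j k : ℤ) (f : B.Hom X Y i) :
    B.m₁ X Y j k (B.m₁ X Y i j f) = 0 := by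
  by_cases hij : i + 1 = j
  · have h := B.relation (.cons (B.el i f) (.nil X))
    rw [insertSum_single B.isOperation (B.isOperation.multilinear X Y),
      val_eq 2 B.m _ (e := j) (by simp; omega)] at h
    exact congrFun h k
  · rw [d_degree f hij, map_zero]

lemma leibniz {X Y Z : B.Ob} {i j : ℤ} (i' j' k k' : ℤ) (g : B.Hom Y Z i) (f : B.Hom X Y j)
    (hi : i + 1 = i') (hj : j + 1 = j') (hk : i + j = k) :
    B.m₁ X Z k k' (B.comp₂ X Y Z i j k g f) = B.comp₂ X Y Z i' j k' (B.m₁ Y Z i i' g) f +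
      i.negOnePow • B.comp₂ X Y Z i j' k' g (B.m₁ X Y j j' f) := by
  have h := B.relation (.cons (B.el i g) (.cons (B.el j f) (.nil X)))
  rw [insertSum_pair B.isOperation (B.isOperation.multilinear X Z),
    val_eq 2 B.m _ (e := k) (by simp; omega),
    val_eq 2 B.m _ (e := i') (by simp; omega),
    val_eq 2 B.m _ (e := j') (by simp; omega), sub_sub, sub_eq_zero] at h
  exact congrFun h k'

lemma assoc {X Y Z W : B.Ob} {i j k : ℤ} (l l' n : ℤ) (h : B.Hom Z W i) (g : B.Hom Y Z j)
    (f : B.Hom X Y k) (hl : i + j = l) (hl' : j + k = l') :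
    B.comp₂ X Y W l k n (B.comp₂ Y Z W i j l h g) f =
      B.comp₂ X Z W i l' n h (B.comp₂ X Y Z j k l' g f) := by
  have H := B.relation (.cons (B.el i h) (.cons (B.el j g) (.cons (B.el k f) (.nil X))))
  rw [insertSum_triple B.m_higher (B.isOperation.multilinear X W) B.m_higher,
    val_eq 2 B.m (.cons (B.el j g) (.cons (B.el k f) (.nil X))) (e := l') (by simp; omega),
    val_eq 2 B.m _ (e := l) (by simp; omega), sub_eq_zero] at H
  exact (congrFun H n).symm

lemma d_one (X : B.Ob) (j : ℤ) : B.m₁ X X 0 j (B.one X) = 0 := congrFun (B.m_one X) j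

lemma one_comp₂ {X Y : B.Ob} {i : ℤ} (f : B.Hom X Y i) :
    B.comp₂ X Y Y 0 i i (B.one Y) f = f := B.one_comp f

lemma comp₂_one {X Y : B.Ob} {i : ℤ} (f : B.Hom X Y i) :
    B.comp₂ X X Y i 0 i f (B.one X) = f := B.comp_one f

end DGCat

end AInf

namespace AInf

open GQuiver

variable {K : Type u} [Field K]

/-! ### The free dg category on an A∞ category. -/

/-- Formal expressions in the values of an `A_∞` functor from `A` to an unspecified dg category. -/
inductive Expr (A : AInfCat.{u} K) : A.Ob → A.Ob → ℤ → Type u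
  -- The recorded degrees are not required to match. An ill-graded symbol, differential or composite
  -- evaluates to zero in every dg category, hence vanishes in the quotient.
  | gen {X Y : A.Ob} (p : A.Word X Y) (e : ℤ) : Expr A X Y e
  | one (X : A.Ob) : Expr A X X 0
  | diff {X Y : A.Ob} {i : ℤ} (j : ℤ) (f : Expr A X Y i) : Expr A X Y j
  | comp {X Y Z : A.Ob} {i j : ℤ} (k : ℤ) (g : Expr A Y Z i) (f : Expr A X Y j) : Expr A X Z k
  | zero (X Y : A.Ob) (e : ℤ) : Expr A X Y e
  | add {X Y : A.Ob} {e : ℤ} (f g : Expr A X Y e) : Expr A X Y e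
  | smul {X Y : A.Ob} {e : ℤ} (a : K) (f : Expr A X Y e) : Expr A X Y e

/-- The value of a formal expression under an `A_∞` functor to a dg category. -/
def Expr.eval {A : AInfCat.{u} K} {B : DGCat.{u} K} (F : AInfFunctor A B.toAInfCat) :
    {X Y : A.Ob} → {e : ℤ} → Expr A X Y e → B.Hom (F.obj X) (F.obj Y) e
  | _, _, _, gen p e => F.map _ _ p e
  | _, _, _, one X => B.one (F.obj X)
  | _, _, _, diff j f => B.m₁ _ _ _ j (f.eval F)
  | _, _, _, comp k g f => B.comp₂ _ _ _ _ _ k (g.eval F) (f.eval F)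
  | _, _, _, zero _ _ _ => 0
  | _, _, _, add f g => f.eval F + g.eval F
  | _, _, _, smul a f => a • f.eval F

/-- Expressions are identified if they have the same value under every `A_∞` functor to a dg
category. -/
instance Expr.setoid (A : AInfCat.{u} K) (X Y : A.Ob) (e : ℤ) : Setoid (Expr A X Y e) where
  -- The quantification over all dg categories of the universe does not enlarge the quotient: only
  -- the expressions themselves contribute to its size.
  r f g := ∀ (B : DGCat.{u} K) (F : AInfFunctor A B.toAInfCat), f.eval F = g.eval F
  iseqv := ⟨fun _ _ _ => rfl, fun h B F => (h B F).symm, fun h h' B F => (h B F).trans (h' B F)⟩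

/-- The morphisms of the dg category freely generated by an `A_∞` category. -/
def FreeHom (A : AInfCat.{u} K) (X Y : A.Ob) (e : ℤ) : Type u := Quotient (Expr.setoid A X Y e)

namespace FreeHom

variable {A : AInfCat.{u} K}

/-- The class of an expression. -/
def mk {X Y : A.Ob} {e : ℤ} (f : Expr A X Y e) : FreeHom A X Y e := Quotient.mk _ f

/-- Evaluation of classes of expressions. -/
def evalFun {B : DGCat.{u} K} (F : AInfFunctor A B.toAInfCat) {X Y : A.Ob} {e : ℤ}
    (f : FreeHom A X Y e) : B.Hom (F.obj X) (F.obj Y) e :=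
  Quotient.lift (fun f => f.eval F) (fun _ _ h => congrFun (congrFun (funext₂ h) B) F) f

lemma ext {X Y : A.Ob} {e : ℤ} {f g : FreeHom A X Y e}
    (h : ∀ (B : DGCat.{u} K) (F : AInfFunctor A B.toAInfCat), evalFun F f = evalFun F g) :
    f = g := by
  induction f using Quotient.ind
  induction g using Quotient.ind
  exact Quotient.sound h

/-- The values of a class of expressions under all functors. -/
def values {X Y : A.Ob} {e : ℤ} (f : FreeHom A X Y e) :
    ∀ (B : DGCat.{u} K) (F : AInfFunctor A B.toAInfCat), B.Hom (F.obj X) (F.obj Y) e :=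
  fun _ F => evalFun F f

/-- This embeds the quotient into a product of morphism spaces, possibly in a larger universe, from
which the group and module laws are pulled back. -/
lemma values_injective {X Y : A.Ob} {e : ℤ} :
    Function.Injective (values : FreeHom A X Y e → _) :=
  fun _ _ h => ext fun B F => congrFun (congrFun h B) F

variable {X Y : A.Ob} {e : ℤ}

instance : Zero (FreeHom A X Y e) := ⟨mk (.zero X Y e)⟩
instance : Add (FreeHom A X Y e) := ⟨Quotient.map₂ .add
  (fun _ _ h _ _ h' B F => congrArg₂ (· + ·) (h B F) (h' B F))⟩
instance : SMul K (FreeHom A X Y e) := ⟨fun a => Quotient.map (.smul a)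
  (fun _ _ h B F => congrArg (a • ·) (h B F))⟩
-- Expressions have no symbol for negation or integer multiples; these are scalar multiples, and
-- injectivity of `values` shows that they agree with the group operations.
instance : Neg (FreeHom A X Y e) := ⟨fun f => (-1 : K) • f⟩
instance : Sub (FreeHom A X Y e) := ⟨fun f g => f + -g⟩
instance : SMul ℕ (FreeHom A X Y e) := ⟨fun n f => (n : K) • f⟩
instance : SMul ℤ (FreeHom A X Y e) := ⟨fun n f => (n : K) • f⟩

lemma values_add (f g : FreeHom A X Y e) : values (f + g) = values f + values g := by
  induction f using Quotient.ind
  induction g using Quotient.ind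
  rfl

lemma values_smul (a : K) (f : FreeHom A X Y e) : values (a • f) = a • values f := by
  induction f using Quotient.ind
  rfl

instance : AddCommGroup (FreeHom A X Y e) :=
  Function.Injective.addCommGroup values values_injective rfl values_add
    (fun f => (values_smul _ f).trans (by simp))
    (fun f g => (values_add _ _).trans (by
      rw [sub_eq_add_neg]
      exact congrArg _ ((values_smul _ g).trans (by simp))))
    (fun f n => (values_smul _ f).trans (Nat.cast_smul_eq_nsmul K n _))
    (fun f n => (values_smul _ f).trans (Int.cast_smul_eq_zsmul K n _))

instance : Module K (FreeHom A X Y e) :=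
  Function.Injective.module K
    { toFun := values, map_zero' := rfl, map_add' := values_add } values_injective values_smul

/-- Evaluation, as a linear map. -/
def eval {B : DGCat.{u} K} (F : AInfFunctor A B.toAInfCat) (X Y : A.Ob) (e : ℤ) :
    FreeHom A X Y e →ₗ[K] B.Hom (F.obj X) (F.obj Y) e where
  toFun := evalFun F
  map_add' f g := congrFun (congrFun (values_add f g) B) F
  map_smul' a f := congrFun (congrFun (values_smul a f) B) F

lemma ext_eval {f g : FreeHom A X Y e}
    (h : ∀ (B : DGCat.{u} K) (F : AInfFunctor A B.toAInfCat), eval F X Y e f = eval F X Y e g) :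
    f = g := ext h

/-- The differential. -/
def diff (X Y : A.Ob) (i j : ℤ) : FreeHom A X Y i →ₗ[K] FreeHom A X Y j where
  toFun := Quotient.map (.diff j) (fun _ _ h B F => congrArg (B.m₁ _ _ i j) (h B F))
  map_add' f g := by
    induction f using Quotient.ind
    induction g using Quotient.ind
    exact Quotient.sound fun B F => map_add (B.m₁ _ _ i j) _ _
  map_smul' a f := by
    induction f using Quotient.ind
    exact Quotient.sound fun B F => map_smul (B.m₁ _ _ i j) _ _

/-- The composition. -/
def comp (X Y Z : A.Ob) (i j k : ℤ) :
    FreeHom A Y Z i →ₗ[K] FreeHom A X Y j →ₗ[K] FreeHom A X Z k :=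
  LinearMap.mk₂ K (Quotient.map₂ (.comp k)
    (fun _ _ h _ _ h' B F => congrArg₂ (fun g f => B.comp₂ _ _ _ i j k g f) (h B F) (h' B F)))
    (fun g g' f => by
      induction f using Quotient.ind
      induction g using Quotient.ind
      induction g' using Quotient.ind
      exact Quotient.sound fun B F => LinearMap.map_add₂ _ _ _ _)
    (fun a g f => by
      induction f using Quotient.ind
      induction g using Quotient.ind
      exact Quotient.sound fun B F => LinearMap.map_smul₂ _ _ _ _)
    (fun g f f' => by
      induction f using Quotient.ind
      induction g using Quotient.ind
      induction f' using Quotient.ind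
      exact Quotient.sound fun B F => map_add _ _ _)
    (fun a g f => by
      induction f using Quotient.ind
      induction g using Quotient.ind
      exact Quotient.sound fun B F => map_smul _ _ _)

variable {B : DGCat.{u} K} (F : AInfFunctor A B.toAInfCat)

lemma eval_diff {i j : ℤ} (f : FreeHom A X Y i) :
    eval F X Y j (diff X Y i j f) = B.m₁ _ _ i j (eval F X Y i f) := by
  induction f using Quotient.ind
  rfl

lemma eval_comp {Z : A.Ob} {i j k : ℤ} (g : FreeHom A Y Z i) (f : FreeHom A X Y j) :
    eval F X Z k (comp X Y Z i j k g f) =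
      B.comp₂ _ _ _ i j k (eval F Y Z i g) (eval F X Y j f) := by
  induction f using Quotient.ind
  induction g using Quotient.ind
  rfl

lemma eval_one : eval F X X 0 (mk (.one X)) = B.one (F.obj X) := rfl

/-- Induction on the expressions. -/
lemma induction (P : ∀ {X Y : A.Ob} {e : ℤ}, FreeHom A X Y e → Prop)
    (gen : ∀ {X Y : A.Ob} (p : A.Word X Y) (e : ℤ), P (mk (.gen p e)))
    (one : ∀ X : A.Ob, P (mk (.one X)))
    (diff : ∀ {X Y : A.Ob} {i : ℤ} (j : ℤ) (f : FreeHom A X Y i), P f → P (diff X Y i j f))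
    (comp : ∀ {X Y Z : A.Ob} {i j : ℤ} (k : ℤ) (g : FreeHom A Y Z i) (f : FreeHom A X Y j),
      P g → P f → P (comp X Y Z i j k g f))
    (zero : ∀ (X Y : A.Ob) (e : ℤ), P (0 : FreeHom A X Y e))
    (add : ∀ {X Y : A.Ob} {e : ℤ} (f g : FreeHom A X Y e), P f → P g → P (f + g))
    (smul : ∀ {X Y : A.Ob} {e : ℤ} (a : K) (f : FreeHom A X Y e), P f → P (a • f))
    {X Y : A.Ob} {e : ℤ} (f : FreeHom A X Y e) : P f := by
  induction f using Quotient.ind with | _ f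
  induction f with
  | gen p e => exact gen p e
  | one X => exact one X
  | diff j f h => exact diff j _ h
  | comp k g f h h' => exact comp k _ _ h h'
  | zero X Y e => exact zero X Y e
  | add f g h h' => exact add _ _ h h'
  | smul a f h => exact smul a _ h

end FreeHom

open FreeHom

/-- The differential and the composition of the dg category freely generated by an `A_∞`
category. -/
abbrev freeData (A : AInfCat.{u} K) : DGData K where
  Ob := A.Ob
  Hom := FreeHom A
  d := diff
  comp := comp
  one X := mk (.one X)
  -- Each axiom below is tested under an arbitrary A∞ functor, where it becomes the same axiom of
  -- the target dg category.
  d_degree f h := ext_eval fun B F => by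
    rw [eval_diff, DGCat.d_degree _ h, map_zero]
  comp_degree g f h := ext_eval fun B F => by
    rw [eval_comp, DGCat.comp_degree _ _ h, map_zero]
  d_d j k f := ext_eval fun B F => by
    rw [eval_diff, eval_diff, DGCat.d_d, map_zero]
  leibniz i' j' k k' g f hi hj hk hk' := ext_eval fun B F => by
    rw [map_add, map_units_smul']
    simp only [eval_diff, eval_comp]
    exact DGCat.leibniz i' j' k k' _ _ hi hj hk
  assoc l l' n h g f hl hl' := ext_eval fun B F => by
    simp only [eval_comp]
    exact DGCat.assoc l l' n _ _ _ hl hl'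
  d_one X j := ext_eval fun B F => by
    rw [eval_diff, eval_one, DGCat.d_one, map_zero]
  one_comp f := ext_eval fun B F => by
    rw [eval_comp, eval_one, DGCat.one_comp₂]
  comp_one f := ext_eval fun B F => by
    rw [eval_comp, eval_one, DGCat.comp₂_one]

/-- The dg category freely generated by an `A_∞` category. -/
abbrev freeDG (A : AInfCat.{u} K) : DGCat K := (freeData A).toDGCat

/-! ### The universal property and the adjunction. -/

section universal

variable {A : AInfCat.{u} K} {B : DGCat.{u} K} (F : AInfFunctor A B.toAInfCat)

/-- Evaluation commutes with differential and composition by construction, and neither side has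
operations of any other arity. -/
lemma eval_m {X Y : A.Ob} (q : (freeDG A).Word X Y) (e : ℤ) :
    eval F X Y e ((freeDG A).m X Y q e) =
      B.m (F.obj X) (F.obj Y)
        (q.map F.obj (elMap (V := (freeDG A).toGQuiver) (W := B.toGQuiver) (eval F))) e := by
  rcases q with _ | ⟨x, _ | ⟨y, _ | ⟨z, q⟩⟩⟩
  · exact (map_zero _).trans (congrFun (B.isOperation.nil _) e).symm
  · exact eval_diff F x.2
  · exact eval_comp F x.2 y.2
  · exact (map_zero _).trans (congrFun (B.m_higher _ (by simp [Chain.map, Chain.len])) e).symm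

/-- The universal operation. -/
def unitOp (A : AInfCat.{u} K) : Op A.toGQuiver (freeDG A).toGQuiver id :=
  fun _ _ p e => mk (.gen p e)

lemma isOperation_unitOp (A : AInfCat.{u} K) :
    IsOperation (V := A.toGQuiver) (W := (freeDG A).toGQuiver) id 1 (unitOp A) where
  nil X := funext fun e => ext_eval fun _ F =>
    (congrFun (F.isOperation.nil X) e).trans (map_zero _).symm
  degree p e he := ext_eval fun _ F => (F.isOperation.degree p e he).trans (map_zero _).symm
  multilinear X Y :=
    { add := fun u f g w => funext fun e => ext_eval fun _ F =>
        (congrFun ((F.isOperation.multilinear X Y).add u f g w) e).trans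
          (map_add (eval F X Y e) (unitOp A X Y (u.append (.cons (A.el _ f) w)) e)
            (unitOp A X Y (u.append (.cons (A.el _ g) w)) e)).symm
      smul := fun u a f w => funext fun e => ext_eval fun _ F =>
        (congrFun ((F.isOperation.multilinear X Y).smul u a f w) e).trans
          (map_smul (eval F X Y e) a
            (unitOp A X Y (u.append (.cons (A.el _ f) w)) e)).symm }

/-- The symbol of p evaluates under F to F(p). Since evaluation commutes with all m_n, the equation
becomes the functor equation of F, which holds for each F. -/
lemma unitOp_relation (A : AInfCat.{u} K) {X Y : A.Ob} (p : A.Word X Y) :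
    insertSum A.m (fun q => unitOp A X Y q) p =
      blockSum (unitOp A) (fun q => (freeDG A).m X Y q) p := by
  funext e
  refine ext_eval fun B F => ?_
  let L : (∀ e, (freeDG A).Hom X Y e) →ₗ[K] B.Hom (F.obj X) (F.obj Y) e :=
    (eval F X Y e).comp (LinearMap.proj e)
  have h1 := insertSum_linear L A.m (fun q => unitOp A X Y q) p
  have h2 := blockSum_linear L (unitOp A) (fun q => (freeDG A).m X Y q) p
  refine h1.trans (Eq.trans ?_ h2.symm)
  let P : (∀ e, B.Hom (F.obj X) (F.obj Y) e) →ₗ[K] B.Hom (F.obj X) (F.obj Y) e := LinearMap.proj e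
  have h3 := insertSum_linear P A.m (fun q => F.map X Y q) p
  have h4 := blockSum_linear P F.map (fun q => B.m (F.obj X) (F.obj Y) q) p
  refine h3.symm.trans ((congrArg P (F.relation p)).trans (h4.trans ?_))
  refine sumOver_congr _ fun δ _ => congrArg _ ?_
  refine Eq.trans ?_ (eval_m F _ e).symm
  exact congrArg (fun q => B.m (F.obj X) (F.obj Y) q e)
    (Chain.map_map id (fun _ _ b => val 1 (unitOp A) b) F.obj
      (elMap (V := (freeDG A).toGQuiver) (W := B.toGQuiver) (eval F)) δ).symm

/-- The universal `A_∞` functor. -/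
abbrev freeUnit (A : AInfCat.{u} K) : AInfFunctor A (freeDG A).toAInfCat where
  obj := id
  map := unitOp A
  isOperation := isOperation_unitOp A
  relation := unitOp_relation A
  map_one X := ext_eval fun _ F => F.map_one X
  map_unit u w h := funext fun e => ext_eval fun _ F =>
    (congrFun (F.map_unit u w h) e).trans (map_zero _).symm

/-- The dg functor induced by an `A_∞` functor to a dg category. -/
def freeLift : DGFunctor (freeDG A) B where
  obj := F.obj
  map := strictOp (V := (freeDG A).toGQuiver) (W := B.toGQuiver) (eval F)
  isOperation := isOperation_strictOp _
  relation p := (strictOp_relation_iff _ (freeDG A).isOperation B.isOperation p).2 (eval_m F p)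
  map_one X := strictOp_single (V := (freeDG A).toGQuiver) (W := B.toGQuiver) (eval F) _
  map_unit u w h := strictOp_of_len _ _ (by rw [Chain.len_append, len_cons]; omega)
  strict p h := strictOp_of_len _ p (by omega)

/-- The action of a dg functor on morphisms. -/
def DGFunctor.lin {B C : DGCat.{u} K} (G : DGFunctor B C) (X Y : B.Ob) (d : ℤ) :
    B.Hom X Y d →ₗ[K] C.Hom (G.obj X) (G.obj Y) d := linPart G.isOperation X Y d d

lemma DGFunctor.map_eq_strictOp {B C : DGCat.{u} K} (G : DGFunctor B C) :
    G.map = strictOp G.lin := eq_strictOp G.isOperation G.strict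

lemma DGFunctor.lin_m {B C : DGCat.{u} K} (G : DGFunctor B C) {X Y : B.Ob} (p : B.Word X Y)
    (e : ℤ) : G.lin X Y e (B.m X Y p e) =
      C.m (G.obj X) (G.obj Y) (p.map G.obj (elMap G.lin)) e := by
  have h := G.relation p
  rw [G.map_eq_strictOp] at h
  exact (strictOp_relation_iff _ B.isOperation C.isOperation p).1 h e

lemma DGFunctor.lin_d {B C : DGCat.{u} K} (G : DGFunctor B C) {X Y : B.Ob} {i j : ℤ}
    (f : B.Hom X Y i) : G.lin X Y j (B.m₁ X Y i j f) = C.m₁ _ _ i j (G.lin X Y i f) :=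
  G.lin_m (.cons (B.el i f) (.nil X)) j

lemma DGFunctor.lin_comp {B C : DGCat.{u} K} (G : DGFunctor B C) {X Y Z : B.Ob} {i j k : ℤ}
    (g : B.Hom Y Z i) (f : B.Hom X Y j) :
    G.lin X Z k (B.comp₂ X Y Z i j k g f) =
      C.comp₂ _ _ _ i j k (G.lin Y Z i g) (G.lin X Y j f) :=
  G.lin_m (.cons (B.el i g) (.cons (B.el j f) (.nil X))) k

lemma DGFunctor.lin_one {B C : DGCat.{u} K} (G : DGFunctor B C) (X : B.Ob) :
    G.lin X X 0 (B.one X) = C.one (G.obj X) := G.map_one X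

lemma comp_strict_map {A : AInfCat.{u} K} {B C : DGCat.{u} K} (F : AInfFunctor A B.toAInfCat)
    (G : DGFunctor B C) {X Y : A.Ob} (p : A.Word X Y) (e : ℤ) :
    (F.comp G.toAInfFunctor).map X Y p e =
      G.lin (F.obj X) (F.obj Y) e (F.map X Y p e) := by
  have h := strictOp_comp (h := G.obj) G.lin F.isOperation X Y p e
  rw [← G.map_eq_strictOp] at h
  exact h

lemma freeUnit_comp_freeLift : (freeUnit A).comp (freeLift F).toAInfFunctor = F := by
  refine AInfFunctor.ext' (F := (freeUnit A).comp (freeLift F).toAInfFunctor) (G := F) rfl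
    (heq_of_eq ?_)
  funext X Y p e
  exact (comp_strict_map (freeUnit A) (freeLift F) p e).trans
    (strictOp_single (V := (freeDG A).toGQuiver) (W := B.toGQuiver) (eval F) _)

/-- Uniqueness in the universal property: both sides are linear, respect identities, differentials
and composites, and agree on the symbols, which generate all morphisms. -/
lemma eval_freeUnit_comp (G : DGFunctor (freeDG A) B) {X Y : A.Ob} {e : ℤ}
    (f : FreeHom A X Y e) :
    eval ((freeUnit A).comp G.toAInfFunctor) X Y e f = G.lin X Y e f := by
  induction f using FreeHom.induction with
  | gen p e => exact comp_strict_map (freeUnit A) G p e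
  | one X => exact (G.lin_one X).symm
  | diff j f h => exact (eval_diff _ f).trans ((congrArg _ h).trans (G.lin_d f).symm)
  | comp k g f h h' =>
    exact (eval_comp _ g f).trans ((congrArg₂ (fun g f => B.comp₂ _ _ _ _ _ k g f) h h').trans
      (G.lin_comp g f).symm)
  | zero X Y e => exact (map_zero _).trans (map_zero _).symm
  | add f g h h' => exact (map_add _ _ _).trans ((congrArg₂ _ h h').trans (map_add _ _ _).symm)
  | smul a f h =>
    exact (map_smul (eval ((freeUnit A).comp G.toAInfFunctor) _ _ _) a f).trans
      ((congrArg _ h).trans (map_smul (G.lin _ _ _) a f).symm)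

lemma freeLift_freeUnit_comp (G : DGFunctor (freeDG A) B) :
    freeLift ((freeUnit A).comp G.toAInfFunctor) = G := by
  refine DGFunctor.ext' (AInfFunctor.ext' rfl (heq_of_eq ?_))
  rw [G.map_eq_strictOp]
  funext X Y p e
  exact eval_freeUnit_comp G _

/-- Dg functors out of the free dg category are `A_∞` functors. -/
def freeEquiv (A : AInfCat.{u} K) (B : DGCat.{u} K) :
    (freeDG A ⟶ B) ≃ (A ⟶ (DGCat.inclusion K).obj B) where
  toFun G := (freeUnit A).comp G.toAInfFunctor
  invFun F := freeLift F
  left_inv G := freeLift_freeUnit_comp G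
  right_inv F := freeUnit_comp_freeLift F

lemma freeEquiv_naturality (A : AInfCat.{u} K) (B C : DGCat.{u} K) (g : B ⟶ C)
    (h : freeDG A ⟶ B) :
    freeEquiv A C (h ≫ g) = freeEquiv A B h ≫ (DGCat.inclusion K).map g :=
  (AInfFunctor.assoc' (freeUnit A) h.toAInfFunctor g.toAInfFunctor).symm

end universal

/-- The dg category freely generated by an `A_∞` category, as a functor. -/
def freeFunctor (K : Type u) [Field K] : AInfCat.{u} K ⥤ DGCat.{u} K :=
  Adjunction.leftAdjointOfEquiv (G := DGCat.inclusion K) freeEquiv freeEquiv_naturality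

/-- The free dg category functor is left adjoint to the inclusion. -/
def freeAdjunction (K : Type u) [Field K] : freeFunctor.{u} K ⊣ DGCat.inclusion.{u} K :=
  Adjunction.adjunctionOfEquivLeft freeEquiv freeEquiv_naturality

/-- The unit of the adjunction corresponds under `freeEquiv` to the identity dg functor, and
composing `freeUnit` with it changes nothing. -/
lemma freeAdjunction_unit (A : AInfCat.{u} K) :
    (freeAdjunction K).unit.app A = freeUnit A := by
  have h : (freeAdjunction K).unit.app A = freeEquiv A (freeDG A) (𝟙 (freeDG A)) := by
    simp [freeAdjunction, Adjunction.adjunctionOfEquivLeft, Adjunction.mkOfHomEquiv]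
    rfl
  rw [h]
  exact AInfFunctor.comp_id' (freeUnit A)

/-! ### Splittings with an empty piece, and degrees under insertion. -/

lemma Chain.sum_splits_left_nil {O : Type u} {Q : O → O → Type u} {N : Type*} [AddCommGroup N]
    {X Y : O} (p : Chain Q X Y) (ψ : Split Q X Y → N) :
    sumOver p.splits ψ = ψ ⟨Y, .nil Y, p⟩ +
      sumOver p.splits (fun s => if s.left.len = 0 then 0 else ψ s) := by
  cases p with
  | nil => simp [sum_splits_nil, len]
  | cons f p => simp [sum_splits_cons, len]

/-- In the module relation the two splittings with an empty piece give the composites with D, hence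
the differential of the action, while the others give compositions of actions. Nonemptiness of p
makes the two ends distinct. -/
lemma Chain.sum_splits_ends {O : Type u} {Q : O → O → Type u} {N : Type*} [AddCommGroup N]
    {X Y : O} (p : Chain Q X Y) (hp : p.len ≠ 0) (ψ : Split Q X Y → N) :
    sumOver p.splits ψ = ψ ⟨Y, .nil Y, p⟩ + ψ ⟨X, p, .nil X⟩ +
      sumOver p.splits (fun s => if s.left.len = 0 ∨ s.right.len = 0 then 0 else ψ s) := by
  have key : ∀ {Z : O} (q : Chain Q X Z) (χ : Split Q X Z → N), sumOver q.splits χ =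
      χ ⟨X, q, .nil X⟩ + sumOver q.splits (fun s => if s.right.len = 0 then 0 else χ s) := by
    intro Z q
    induction q with
    | nil => simp [sum_splits_nil, len]
    | cons f q ih =>
      intro χ
      rw [sum_splits_cons, ih, sum_splits_cons, if_neg (by simp [len])]
      abel
  cases p with
  | nil => simp [len] at hp
  | cons f p =>
    rw [sum_splits_cons, key, sum_splits_cons]
    simp [len, add_assoc]

/-- All strings produced from p by one insertion share the same value of degree minus length, so a
formula for φ valid in that one degree is enough. -/
lemma GQuiver.ins_congr_degree {V : GQuiver K} {N : Type*} [AddCommGroup N] (m : Op V V id)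
    {X Y : V.Ob} {φ ψ : V.Word X Y → N} (p : V.Word X Y)
    (h : ∀ q : V.Word X Y, q.len ≠ 0 → deg q + 1 - q.len = deg p + 2 - p.len → φ q = ψ q) :
    ins m φ p = ins m ψ p := by
  unfold ins
  refine sumOver_congr _ fun s hs => sumOver_congr _ fun t ht => ?_
  rw [h]
  · simp
  · rw [← Chain.mem_splits _ s hs, ← Chain.mem_splits _ t ht]
    simp only [deg_append, deg_cons, Chain.len_append, len_cons, val_fst]
    push_cast
    ring

/-! ### Dg categories of complexes. -/

/-- A family of modules with a differential `D` and, for every `e`, a submodule `Z e` that plays the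
role of the elements whose component of degree `e` vanishes. -/
structure DGFamily (K : Type u) [Field K] (O : Type u) where
  T : O → Type u
  [addCommGroup : ∀ Y, AddCommGroup (T Y)]
  [module : ∀ Y, Module K (T Y)]
  Z : ∀ Y, ℤ → Submodule K (T Y)
  D : ∀ Y, T Y →ₗ[K] T Y
  D_mem : ∀ {Y} {e : ℤ} (e' : ℤ) (t : T Y), e + 1 = e' → t ∈ Z Y e → D Y t ∈ Z Y e'
  D_D : ∀ {Y} (t : T Y), D Y (D Y t) = 0

attribute [instance] DGFamily.addCommGroup DGFamily.module

namespace DGFamily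

variable {O : Type u} (M : DGFamily K O)

/-- The linear maps of degree `d`. -/
def homs (X Y : O) (d : ℤ) : Submodule K (M.T X →ₗ[K] M.T Y) where
  -- The modules may be infinite products of their components. Preserving the elements with
  -- vanishing component, up to a shift by d, means that the component e + d of f t depends only on
  -- the component e of t.
  carrier := {f | ∀ (e e' : ℤ) (t : M.T X), e + d = e' → t ∈ M.Z X e → f t ∈ M.Z Y e'}
  add_mem' hf hg e e' t h ht := add_mem (hf e e' t h ht) (hg e e' t h ht)
  zero_mem' _ _ _ _ _ := zero_mem _
  smul_mem' a _ hf e e' t h ht := Submodule.smul_mem _ a (hf e e' t h ht)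

lemma comp_mem {X Y Z : O} {i j k : ℤ} {g : M.T Y →ₗ[K] M.T Z} {f : M.T X →ₗ[K] M.T Y}
    (hg : g ∈ M.homs Y Z i) (hf : f ∈ M.homs X Y j) (h : i + j = k) : g ∘ₗ f ∈ M.homs X Z k :=
  fun e e' t he ht => hg (e + j) e' _ (by omega) (hf e (e + j) t rfl ht)

lemma D_mem_homs (Y : O) : M.D Y ∈ M.homs Y Y 1 := fun _ e' t he ht => M.D_mem e' t he ht

lemma units_smul_mem {X Y : O} {d : ℤ} (s : ℤˣ) {f : M.T X →ₗ[K] M.T Y} (hf : f ∈ M.homs X Y d) :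
    s • f ∈ M.homs X Y d := by
  rcases Int.units_eq_one_or s with rfl | rfl
  · simpa using hf
  · simpa using hf

lemma diff_mem {X Y : O} {i j : ℤ} {f : M.T X →ₗ[K] M.T Y} (hf : f ∈ M.homs X Y i)
    (h : i + 1 = j) : M.D Y ∘ₗ f - i.negOnePow • (f ∘ₗ M.D X) ∈ M.homs X Y j :=
  sub_mem (M.comp_mem (M.D_mem_homs Y) hf (by omega))
    (M.units_smul_mem _ (M.comp_mem hf (M.D_mem_homs X) h))

/-- The differential of a homogeneous linear map. -/
def dHom (X Y : O) (i j : ℤ) : M.homs X Y i →ₗ[K] M.homs X Y j where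
  toFun f := ⟨if i + 1 = j then M.D Y ∘ₗ f.1 - i.negOnePow • (f.1 ∘ₗ M.D X) else 0, by
    split_ifs with h
    · exact M.diff_mem f.2 h
    · exact zero_mem _⟩
  map_add' f g := by
    refine Subtype.ext ?_
    by_cases h : i + 1 = j
    · simp only [h, if_true, Submodule.coe_add, LinearMap.comp_add, LinearMap.add_comp, smul_add]
      abel
    · simp [h]
  map_smul' a f := by
    refine Subtype.ext ?_
    by_cases h : i + 1 = j
    · simp only [h, if_true, Submodule.coe_smul, LinearMap.comp_smul, LinearMap.smul_comp,
        RingHom.id_apply, smul_sub, smul_comm a]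
    · simp [h]

/-- The composition of homogeneous linear maps. -/
def compHom (X Y Z : O) (i j k : ℤ) : M.homs Y Z i →ₗ[K] M.homs X Y j →ₗ[K] M.homs X Z k :=
  LinearMap.mk₂ K (fun g f => ⟨if i + j = k then g.1 ∘ₗ f.1 else 0, by
    split_ifs with h
    · exact M.comp_mem g.2 f.2 h
    · exact zero_mem _⟩)
    (fun g g' f => by
      refine Subtype.ext ?_
      by_cases h : i + j = k <;> simp [h, LinearMap.add_comp])
    (fun a g f => by
      refine Subtype.ext ?_
      by_cases h : i + j = k <;> simp [h, LinearMap.smul_comp])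
    (fun g f f' => by
      refine Subtype.ext ?_
      by_cases h : i + j = k <;> simp [h, LinearMap.comp_add])
    (fun a g f => by
      refine Subtype.ext ?_
      by_cases h : i + j = k <;> simp [h, LinearMap.comp_smul])

variable {M}

lemma dHom_coe {X Y : O} {i j : ℤ} (f : M.homs X Y i) (h : i + 1 = j) :
    (M.dHom X Y i j f).1 = M.D Y ∘ₗ f.1 - i.negOnePow • (f.1 ∘ₗ M.D X) := if_pos h

lemma dHom_of_ne {X Y : O} {i j : ℤ} (f : M.homs X Y i) (h : i + 1 ≠ j) :
    M.dHom X Y i j f = 0 := Subtype.ext (if_neg h)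

lemma compHom_coe {X Y Z : O} {i j k : ℤ} (g : M.homs Y Z i) (f : M.homs X Y j) (h : i + j = k) :
    (M.compHom X Y Z i j k g f).1 = g.1 ∘ₗ f.1 := if_pos h

lemma compHom_of_ne {X Y Z : O} {i j k : ℤ} (g : M.homs Y Z i) (f : M.homs X Y j)
    (h : i + j ≠ k) : M.compHom X Y Z i j k g f = 0 := Subtype.ext (if_neg h)

variable (M)

/-- The dg category of homogeneous linear maps between the modules of the family. -/
abbrev data : DGData K where
  Ob := O
  Hom X Y d := M.homs X Y d
  d := M.dHom
  comp := M.compHom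
  one X := ⟨LinearMap.id, fun e e' t h ht => by
    obtain rfl : e = e' := by omega
    exact ht⟩
  d_degree := dHom_of_ne
  comp_degree := compHom_of_ne
  d_d {X Y i} j k f := by
    by_cases hj : i + 1 = j
    · by_cases hk : j + 1 = k
      · refine Subtype.ext (LinearMap.ext fun t => ?_)
        subst hj
        rw [dHom_coe _ hk, dHom_coe _ rfl]
        simp [M.D_D, Int.negOnePow_succ]
      · exact dHom_of_ne _ hk
    · rw [dHom_of_ne _ hj, map_zero]
  leibniz {X Y Z i j} i' j' k k' g f hi hj hk hk' := by
    refine Subtype.ext (LinearMap.ext fun t => ?_)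
    have h : ∀ (s : ℤˣ) (f : M.homs X Z k'), (s • f).1 = s • f.1 := fun s f => by
      rcases Int.units_eq_one_or s with rfl | rfl <;> simp
    rw [Submodule.coe_add, h, dHom_coe _ hk', compHom_coe _ _ hk, compHom_coe _ _ (by omega),
      compHom_coe _ _ (by omega), dHom_coe _ hi, dHom_coe _ hj]
    subst hk
    simp [Int.negOnePow_add, mul_smul, smul_sub]
  assoc {_ _ _ _ _ _ k} l l' n h g f hl hl' := by
    refine Subtype.ext ?_
    by_cases hn : l + k = n
    · rw [compHom_coe _ _ hn, compHom_coe _ _ hl, compHom_coe _ _ (by omega), compHom_coe _ _ hl']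
      rfl
    · rw [compHom_of_ne _ _ hn, compHom_of_ne _ _ (by omega)]
  d_one X j := by
    by_cases hj : 0 + 1 = j
    · refine Subtype.ext ?_
      rw [dHom_coe _ hj]
      simp
    · exact dHom_of_ne _ hj
  one_comp f := Subtype.ext (compHom_coe _ _ (zero_add _))
  comp_one f := Subtype.ext (compHom_coe _ _ (add_zero _))

/-- The dg category of homogeneous linear maps between the modules of the family. -/
abbrev endDG : DGCat K := M.data.toDGCat

end DGFamily

/-! ### A∞ modules as A∞ functors to dg categories of complexes. -/

/-- A strictly unital `A_∞` module over `A`, with signs absorbed by the shift. The value on the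
empty strings is the differential. -/
structure AInfModule (A : AInfCat.{u} K) extends DGFamily K A.Ob where
  act : ∀ X Y, A.Word X Y → T X →ₗ[K] T Y
  act_nil : ∀ X, act X X (.nil X) = D X
  act_mem : ∀ {X Y} (p : A.Word X Y), act X Y p ∈ toDGFamily.homs X Y (deg p + 1 - p.len)
  multilinear : ∀ X Y, IsMultilinear (act X Y)
  relation : ∀ {X Y} (p : A.Word X Y), ins (twist A.m) (act X Y) p =
    sumOver p.splits fun s => (eps s.left).negOnePow • (act _ _ s.left ∘ₗ act _ _ s.right)
  act_one : ∀ X, act X X (.cons (A.el 0 (A.one X)) (.nil X)) = LinearMap.id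
  act_unit : ∀ {X Y Z} (u : A.Word Z Y) (w : A.Word X Z), 0 < u.len + w.len →
    act X Y (u.append (.cons (A.el 0 (A.one Z)) w)) = 0

namespace AInfModule

variable {A : AInfCat.{u} K} (M : AInfModule A)

/-- The action of an `A_∞` module as an operation, with shifted signs. -/
def op : Op A.toGQuiver M.endDG.toGQuiver id := fun X Y p e =>
  -- An operation must vanish on empty strings, where `act` is D. The differential D enters instead
  -- through the dg category `endDG`.
  ⟨if p.len ≠ 0 ∧ deg p + 1 - p.len = e then M.act X Y p else 0, by
    split_ifs with h
    · rw [← h.2]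
      exact M.act_mem p
    · exact zero_mem _⟩

lemma op_coe {X Y : A.Ob} (p : A.Word X Y) {e : ℤ} (hp : p.len ≠ 0)
    (h : deg p + 1 - p.len = e) : (M.op X Y p e).1 = M.act X Y p := if_pos ⟨hp, h⟩

lemma op_coe_of_len {X Y : A.Ob} (p : A.Word X Y) (e : ℤ) (hp : p.len = 0) :
    (M.op X Y p e).1 = 0 := if_neg fun h => h.1 hp

lemma isOperation_op :
    IsOperation (V := A.toGQuiver) (W := M.endDG.toGQuiver) id 1 M.op where
  nil X := funext fun e => Subtype.ext (M.op_coe_of_len (.nil X) e rfl)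
  degree p e he := Subtype.ext (if_neg fun h => he h.2.symm)
  multilinear X Y :=
    { add := fun u f g w => funext fun e => Subtype.ext (by
        have h := (M.multilinear X Y).add u f g w
        simp only [op, Pi.add_apply, Submodule.coe_add, Chain.len_append, len_cons, deg_append,
          deg_cons, el_fst, h]
        split_ifs
        · rfl
        · exact (add_zero _).symm)
      smul := fun u a f w => funext fun e => Subtype.ext (by
        have h := (M.multilinear X Y).smul u a f w
        simp only [op, Pi.smul_apply, Submodule.coe_smul, Chain.len_append, len_cons, deg_append,
          deg_cons, el_fst, h]
        split_ifs
        · rfl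
        · exact (smul_zero _).symm) }

/-- The target is a dg category, so the right side has only an m₁ term and m₂ terms. The m₁ term is
the graded commutator of D with `act p`, which accounts for the two splittings of the module
relation with an empty piece; the m₂ terms account for the proper splittings. -/
lemma op_relation {X Y : A.Ob} (p : A.Word X Y) :
    ins (twist A.m) (fun q => M.op X Y q) p =
      pull M.op (fun q => twist M.endDG.m X Y q) p := by
  have hE := M.endDG.isOperation.twist
  have hO := M.isOperation_op
  by_cases hp : p.len = 0
  · obtain ⟨rfl, rfl⟩ := Chain.len_eq_zero p hp
    rw [ins_nil, pull_nil]
    exact ((hO.multilinear X X).val_zero' (A.isOperation.twist.nil X) (.nil X)).trans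
      (hE.nil X).symm
  funext e
  have hins : (ins (twist A.m) (fun q => M.op X Y q) p e).1 =
      ins (twist A.m) (fun q => (M.op X Y q e).1) p :=
    ins_linear ((M.homs X Y e).subtype.comp
      (LinearMap.proj (R := K) (φ := fun e => M.homs X Y e) e)) (twist A.m)
      (fun q => M.op X Y q) p
  have hpull : (pull M.op (fun q => twist M.endDG.m X Y q) p e).1 =
      pull M.op (fun q => (twist M.endDG.m X Y q e).1) p :=
    pull_linear ((M.homs X Y e).subtype.comp
      (LinearMap.proj (R := K) (φ := fun e => M.homs X Y e) e)) M.op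
      (fun q => twist M.endDG.m X Y q) p
  refine Subtype.ext (hins.trans (Eq.trans ?_ hpull.symm))
  have hφ : IsMultilinear (fun q : M.endDG.Word X Y => (twist M.endDG.m X Y q e).1) :=
    { add := fun u f g w => congrArg Subtype.val (congrFun ((hE.multilinear X Y).add u f g w) e)
      smul := fun u a f w =>
        congrArg Subtype.val (congrFun ((hE.multilinear X Y).smul u a f w) e) }
  have hlen : ∀ q : M.endDG.Word X Y, 2 < q.len → (twist M.endDG.m X Y q e).1 = 0 := by
    exact fun q hq => congrArg Subtype.val (congrFun (M.data.twist_of_len q hq) e)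
  refine Eq.trans ?_ (pull_of_len_le_two hO hφ hlen p hp).symm
  -- Both sides are concentrated in this output degree.
  by_cases he : deg p + 2 - p.len = e
  · have h1 : ins (twist A.m) (fun q => (M.op X Y q e).1) p = ins (twist A.m) (M.act X Y) p :=
      ins_congr_degree _ _ fun q hq hd => M.op_coe q hq (hd.trans he)
    rw [h1, M.relation, Chain.sum_splits_ends _ hp]
    have h2 : (twist M.endDG.m X Y (.cons (val 1 M.op p) (.nil X)) e).1 =
        M.D Y ∘ₗ M.act X Y p - (deg p + 1 - p.len).negOnePow • (M.act X Y p ∘ₗ M.D X) := by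
      refine (congrArg Subtype.val (M.data.twist_single (val 1 M.op p) e)).trans ?_
      refine (DGFamily.dHom_coe (M.op X Y p (deg p + 1 - p.len)) (by omega)).trans ?_
      rw [M.op_coe p hp rfl]
      rfl
    have h3 : ∀ s : Split A.El X Y, s ∈ p.splits → s.left.len ≠ 0 → s.right.len ≠ 0 →
        (twist M.endDG.m X Y (.cons (val 1 M.op s.left) (.cons (val 1 M.op s.right) (.nil X)))
          e).1 = (eps s.left).negOnePow • (M.act _ _ s.left ∘ₗ M.act _ _ s.right) := by
      intro s hs hl hr
      have h5 : ∀ (σ : ℤˣ) (f : M.homs X Y e), (σ • f).1 = σ • f.1 := fun σ f => by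
        rcases Int.units_eq_one_or σ with rfl | rfl <;> simp
      refine (congrArg Subtype.val (M.data.twist_pair (val 1 M.op s.left)
        (val 1 M.op s.right) e)).trans ((h5 _ _).trans (congrArg₂ (· • ·) ?_ ?_))
      · rw [Int.negOnePow_eq_iff]
        exact ⟨1 - s.left.len, by simp only [val_fst, eps]; ring⟩
      · refine (DGFamily.compHom_coe (M.op _ _ s.left (deg s.left + 1 - s.left.len))
          (M.op _ _ s.right (deg s.right + 1 - s.right.len)) ?_).trans ?_
        · rw [← he, ← Chain.mem_splits _ s hs, deg_append, Chain.len_append]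
          push_cast
          ring
        · rw [M.op_coe _ hl rfl, M.op_coe _ hr rfl]
    refine congrArg₂ (· + ·) (Eq.trans ?_ h2.symm) (sumOver_congr _ fun s hs => ?_)
    -- The minus sign of the commutator is absorbed into the exponent: `eps p` and deg p + 1 - len p
    -- differ in parity.
    · rw [sub_eq_add_neg, ← Units.neg_smul, ← Int.negOnePow_succ, eps_nil, Int.negOnePow_zero,
        one_smul, M.act_nil, M.act_nil]
      refine congrArg₂ (· + ·) rfl (congrArg₂ (· • ·) ?_ rfl)
      rw [Int.negOnePow_eq_iff]
      exact ⟨p.len - 1, by simp only [eps]; ring⟩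
    -- For a splitting with an empty piece the m₂ term is zero, because the operation vanishes on
    -- empty strings.
    · split_ifs with h
      · have h6 : ∀ {Z Z' : A.Ob} (q : A.Word Z Z'), q.len = 0 → M.op Z Z' q = 0 := fun q hq =>
          funext fun e => Subtype.ext (M.op_coe_of_len q e hq)
        rcases h with h | h
        · exact (hφ.val_zero' (h6 _ h) (.cons (val 1 M.op s.right) (.nil X))).symm
        · exact ((hφ.cons (val 1 M.op s.left)).val_zero' (h6 _ h) (.nil X)).symm
      · rw [not_or] at h
        exact (h3 s hs h.1 h.2).symm
  · have h1 : ins (twist A.m) (fun q => (M.op X Y q e).1) p = 0 :=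
      (ins_congr_degree _ _ fun q hq hd => if_neg fun h => he (hd.symm.trans h.2)).trans
        (ins_zero _ p)
    rw [h1]
    refine (Eq.trans (congrArg₂ (· + ·) ?_ (sumOver_eq_zero _ fun s hs => ?_)) (add_zero _)).symm
    · exact congrArg Subtype.val ((M.data.twist_single (val 1 M.op p) e).trans
        (DGFamily.dHom_of_ne _ (by simp only [val_fst]; omega)))
    · refine congrArg Subtype.val ((M.data.twist_pair (val 1 M.op s.left)
        (val 1 M.op s.right) e).trans ((congrArg _ (DGFamily.compHom_of_ne _ _ ?_)).trans
          (smul_zero _)))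
      rw [← Chain.mem_splits _ s hs, deg_append, Chain.len_append] at he
      simp only [val_fst]
      push_cast at he ⊢
      omega

/-- The `A_∞` functor to the dg category of complexes defined by an `A_∞` module. -/
def functor : AInfFunctor A M.endDG.toAInfCat where
  obj := id
  -- The module is given in shifted signs, and `twist` is its own inverse, so twisting returns to
  -- the unshifted convention.
  map := twist M.op
  isOperation := M.isOperation_op.twist
  relation p := by
    refine (relation_iff M.isOperation_op.twist A.m M.endDG.isOperation p).2 ?_
    have : twist (twist M.op) = M.op := by
      funext X Y p e
      simp only [twist, smul_smul, Int.units_mul_self, one_smul]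
    rw [this]
    exact M.op_relation p
  map_one X := by
    refine Subtype.ext ?_
    simp only [twist, kap_cons, kap_nil, len_nil, Nat.cast_zero, mul_zero, add_zero,
      Int.negOnePow_zero, one_smul]
    exact (M.op_coe _ (by simp) (by simp)).trans (M.act_one X)
  map_unit u w h := by
    funext e
    have h0 : M.op _ _ (u.append (.cons (A.el 0 (A.one _)) w)) e = 0 := by
      refine Subtype.ext ?_
      simp only [op, M.act_unit u w h, ite_self]
      rfl
    exact (congrArg _ h0).trans (smul_zero _)

end AInfModule

lemma NUAInfCat.twist_relation (A : NUAInfCat K) {X Y : A.Ob} (p : A.Word X Y) :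
    ins (twist A.m) (fun q => twist A.m X Y q) p = 0 := by
  have := kap_ins A.m (A.isOperation.multilinear X Y) p
  rw [A.relation, smul_zero] at this
  exact this.symm

lemma NUAInfFunctor.twist_relation {A B : NUAInfCat K} (F : NUAInfFunctor A B) {X Y : A.Ob}
    (p : A.Word X Y) : ins (twist A.m) (fun q => twist F.map X Y q) p =
      pull (twist F.map) (fun q => twist B.m (F.obj X) (F.obj Y) q) p :=
  (relation_iff F.isOperation A.m B.isOperation p).1 (F.relation p)

lemma GQuiver.twist_eq_zero {V W : GQuiver K} {g : V.Ob → W.Ob} {ω : Op V W g} {X Y : V.Ob}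
    {p : V.Word X Y} (h : ω X Y p = 0) : twist ω X Y p = 0 := by
  funext e
  simp only [twist, h, Pi.zero_apply, smul_zero]

namespace DGCat

variable (B : DGCat K)

lemma twist_single {X Y : B.Ob} (x : B.El X Y) (e : ℤ) :
    twist B.m X Y (.cons x (.nil X)) e = B.m₁ X Y x.1 e x.2 := by
  simp only [twist, kap_cons, kap_nil, len_nil, Nat.cast_zero, mul_zero, add_zero,
    Int.negOnePow_zero, one_smul]
  rfl

lemma twist_pair {X Y Z : B.Ob} (x : B.El Y Z) (y : B.El X Y) (e : ℤ) :
    twist B.m X Z (.cons x (.cons y (.nil X))) e =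
      (x.1 + 1).negOnePow • B.comp₂ X Y Z x.1 y.1 e x.2 y.2 := by
  simp only [twist, kap_cons, kap_nil, len_nil, len_cons, Nat.cast_zero, mul_zero, add_zero,
    zero_add, Nat.cast_one, mul_one]
  rfl

lemma twist_of_len {X Y : B.Ob} (p : B.Word X Y) (hp : 2 < p.len) : twist B.m X Y p = 0 := by
  funext e
  exact (congrArg _ (congrFun (B.m_higher p hp) e)).trans (smul_zero _)

end DGCat

/-! ### The cone of an A∞ functor to a dg category, as an A∞ module. -/

namespace Cone

variable {A : AInfCat.{u} K} {B : DGCat.{u} K} (F : AInfFunctor A B.toAInfCat) (X₀ : A.Ob)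

/-- The underlying modules of the cone of `F` on the morphisms out of `X₀`. -/
abbrev Carrier (Y : A.Ob) : Type u :=
  (∀ e, A.Hom X₀ Y e) × (∀ e, B.Hom (F.obj X₀) (F.obj Y) e)

variable {X₀}

/-- `a ↦ m (p, a)`, with shifted signs. -/
def mLast {X Y : A.Ob} (p : A.Word X Y) (i e : ℤ) : A.Hom X₀ X i →ₗ[K] A.Hom X₀ Y e where
  toFun a := twist A.m X₀ Y (p.append (.cons (A.el i a) (.nil X₀))) e
  map_add' a a' := congrFun ((A.isOperation.twist.multilinear X₀ Y).add p a a' (.nil X₀)) e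
  map_smul' c a := congrFun ((A.isOperation.twist.multilinear X₀ Y).smul p c a (.nil X₀)) e

/-- `a ↦ F (p, a)`, with shifted signs. -/
def fLast {X Y : A.Ob} (p : A.Word X Y) (i e : ℤ) :
    A.Hom X₀ X i →ₗ[K] B.Hom (F.obj X₀) (F.obj Y) e where
  toFun a := twist F.map X₀ Y (p.append (.cons (A.el i a) (.nil X₀))) e
  map_add' a a' := congrFun ((F.isOperation.twist.multilinear X₀ Y).add p a a' (.nil X₀)) e
  map_smul' c a := congrFun ((F.isOperation.twist.multilinear X₀ Y).smul p c a (.nil X₀)) e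

/-- `h ↦ F (p) h`, with shifted signs, and the differential for empty `p`. -/
def hAct {X : A.Ob} {W : B.Ob} : {Y : A.Ob} → A.Word X Y → (i e : ℤ) →
    B.Hom W (F.obj X) i →ₗ[K] B.Hom W (F.obj Y) e
  | _, .nil _, i, e => B.m₁ _ _ i e
  | _, .cons x p, i, e => B.comp₂ _ _ _ _ i e
      (twist F.map _ _ (.cons x p) (deg (.cons x p : A.Word _ _) + 1 - (p.len + 1 : ℕ)))

lemma hAct_of_len {X Y : A.Ob} {W : B.Ob} (p : A.Word X Y) (hp : p.len ≠ 0) {n : ℤ}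
    (hn : deg p + 1 - p.len = n) (i e : ℤ) :
    hAct (W := W) F p i e = B.comp₂ W _ _ n i e (twist F.map X Y p n) := by
  subst hn
  cases p with
  | nil => simp at hp
  | cons x p => rfl

variable (X₀)

/-- The action of strings on the cone. -/
def act (X Y : A.Ob) (p : A.Word X Y) : Carrier F X₀ X →ₗ[K] Carrier F X₀ Y where
  toFun t :=
    -- The string p sends (a, h) to (-m(p,a), F(p,a) + F(p)h). The second summand is shifted by one
    -- against the first, so its component e receives the component of a whose index is one higher
    -- than that of h.
    (fun e => -mLast p (e - (deg p + 1 - p.len)) e (t.1 _),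
      fun e => fLast F p (e + 1 - (deg p + 1 - p.len)) e (t.1 _) +
        hAct F p (e - (deg p + 1 - p.len)) e (t.2 _))
  map_add' s t := by
    refine Prod.ext (funext fun e => ?_) (funext fun e => ?_)
    · simp only [Prod.fst_add, Pi.add_apply, map_add, neg_add]
    · simp only [Prod.fst_add, Prod.snd_add, Pi.add_apply, map_add]
      abel
  map_smul' c t := by
    refine Prod.ext (funext fun e => ?_) (funext fun e => ?_)
    · simp only [Prod.smul_fst, Pi.smul_apply, map_smul, smul_neg, RingHom.id_apply]
    · simp only [Prod.smul_fst, Prod.smul_snd, Pi.smul_apply, map_smul, smul_add,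
        RingHom.id_apply]

variable {X₀}

lemma act_fst {X Y : A.Ob} (p : A.Word X Y) (t : Carrier F X₀ X) (i e : ℤ)
    (h : e - (deg p + 1 - p.len) = i) : (act F X₀ X Y p t).1 e = -mLast p i e (t.1 i) := by
  subst h
  rfl

lemma act_snd {X Y : A.Ob} (p : A.Word X Y) (t : Carrier F X₀ X) (i j e : ℤ)
    (h : e + 1 - (deg p + 1 - p.len) = i) (h' : e - (deg p + 1 - p.len) = j) :
    (act F X₀ X Y p t).2 e = fLast F p i e (t.1 i) + hAct F p j e (t.2 j) := by
  subst h h'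
  rfl

/-- This is the A∞ relation of `A` on the string p·a: the insertions that swallow a are moved to the
right side. -/
lemma ins_mLast {X Y : A.Ob} (p : A.Word X Y) (i e : ℤ) (a : A.Hom X₀ X i) :
    ins (twist A.m) (fun q => mLast q i e a) p = -sumOver p.splits (fun s =>
      (eps s.left).negOnePow • mLast s.left (deg s.right + i + 1 - s.right.len) e
        (mLast s.right i _ a)) := by
  have h := ins_snoc A.isOperation.twist (A.isOperation.twist.multilinear X₀ Y) p (A.el i a)
  rw [A.twist_relation] at h
  have h' := (congrFun h e).symm
  rw [Pi.add_apply, Pi.zero_apply, sumOver_apply] at h'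
  have h2 := ins_linear (LinearMap.proj (R := K) (φ := fun e => A.Hom X₀ Y e) e) (twist A.m)
    (fun q => twist A.m X₀ Y (q.append (.cons (A.el i a) (.nil X₀)))) p
  refine h2.symm.trans ((eq_neg_of_add_eq_zero_left h').trans (congrArg _ ?_))
  refine sumOver_congr _ fun s _ => congrArg _ ?_
  rw [val_eq 2 (twist A.m) _ (e := deg s.right + i + 1 - s.right.len)]
  · rfl
  · simp only [deg_append, deg_cons, deg_nil, el_fst, Chain.len_append, len_cons, len_nil]
    push_cast
    ring

/-- The functor equation for a target without higher operations. The sign of the shifted m₂ agrees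
with that of `eps s.left`, as the exponents have the same parity. -/
lemma pull_pair {X Y : A.Ob} (p : A.Word X Y) (hp : p.len ≠ 0) (e : ℤ) :
    ins (twist A.m) (fun q => twist F.map X Y q) p e =
      B.m₁ _ _ (deg p + 1 - p.len) e (twist F.map X Y p _) + sumOver p.splits (fun s =>
        (eps s.left).negOnePow • B.comp₂ _ _ _ (deg s.left + 1 - s.left.len)
          (deg s.right + 1 - s.right.len) e (twist F.map _ _ s.left _)
            (twist F.map _ _ s.right _)) := by
  rw [F.twist_relation, pull_of_len_le_two F.isOperation.twist
    (B.isOperation.twist.multilinear (F.obj X) (F.obj Y)) B.twist_of_len p hp, Pi.add_apply,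
    sumOver_apply, B.twist_single]
  refine congrArg₂ (· + ·) rfl (sumOver_congr _ fun s _ => ?_)
  rw [B.twist_pair]
  refine congrArg₂ (· • ·) ?_ rfl
  rw [Int.negOnePow_eq_iff]
  exact ⟨1 - s.left.len, by simp only [val_fst, eps]; ring⟩

lemma map_of_len {X Y : A.Ob} (p : A.Word X Y) (hp : p.len = 0) : twist F.map X Y p = 0 := by
  obtain ⟨rfl, rfl⟩ := Chain.len_eq_zero p hp
  exact F.isOperation.twist.nil X

/-- The functor equation for F on p is composed with h. The inner splittings match by associativity;
the differential of F(p) matches the two splittings with an empty piece by the Leibniz rule. For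
empty p the claim is d² = 0. -/
lemma ins_hAct {X Y : A.Ob} {W : B.Ob} (p : A.Word X Y) (i e : ℤ) (h : B.Hom W (F.obj X) i) :
    ins (twist A.m) (fun q => hAct F q i e h) p = sumOver p.splits (fun s =>
      (eps s.left).negOnePow • hAct F s.left (i + (deg s.right + 1 - s.right.len)) e
        (hAct F s.right i _ h)) := by
  let L : (∀ e, B.Hom (F.obj X) (F.obj Y) e) →ₗ[K] B.Hom W (F.obj Y) e :=
    ((B.comp₂ W _ _ (deg p + 2 - p.len) i e).flip h).comp (LinearMap.proj _)
  have h1 : ins (twist A.m) (fun q => hAct F q i e h) p =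
      L (ins (twist A.m) (fun q => twist F.map X Y q) p) :=
    (ins_congr_degree _ p fun q hq hd => congrArg (fun f => f h) (hAct_of_len F q hq hd i e)).trans
      (ins_linear L _ _ p).symm
  rw [h1]
  by_cases hp : p.len = 0
  · obtain ⟨rfl, rfl⟩ := Chain.len_eq_zero p hp
    have h2 := (F.isOperation.twist.multilinear X X).val_zero' (c := 2) (A.isOperation.twist.nil X) (.nil X)
    dsimp only [id] at h2
    rw [ins_nil, Chain.sum_splits_nil]
    refine (congrArg L h2).trans ((map_zero L).trans ?_)
    exact ((congrArg _ (DGCat.d_d _ _ h)).trans (smul_zero _)).symm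
  · rw [Chain.sum_splits_ends _ hp]
    have h2 : L (ins (twist A.m) (fun q => twist F.map X Y q) p) = (B.comp₂ W _ _ _ i e).flip h _ :=
      congrArg ((B.comp₂ W _ _ _ i e).flip h) (pull_pair F p hp _)
    rw [h2, map_add, sumOver_linear]
    refine congrArg₂ (· + ·) ?_ (sumOver_congr _ fun s hs => ?_)
    -- Solving the Leibniz rule for d(F(p))·h leaves d(F(p)h) and F(p)·dh, which are the splittings
    -- with empty left and empty right piece.
    · have h3 := DGCat.leibniz (B := B) (deg p + 2 - p.len)
        (i + (deg (.nil X : A.Word X X) + 1 - Chain.len (.nil X : A.Word X X)))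
        (i + (deg p + 1 - p.len)) e (twist F.map X Y p (deg p + 1 - p.len)) h (by ring) (by simp)
        (by ring)
      rw [hAct_of_len F p hp rfl, hAct_of_len F p hp rfl, eps_nil, Int.negOnePow_zero, one_smul]
      refine Eq.trans ?_ (congrArg₂ (· + ·) h3.symm rfl)
      have h4 : (eps p).negOnePow = -(deg p + 1 - p.len).negOnePow := by
        rw [← Int.negOnePow_succ, Int.negOnePow_eq_iff]
        exact ⟨p.len - 1, by simp only [eps]; ring⟩
      dsimp only
      rw [h4, Units.neg_smul]
      exact (add_neg_cancel_right _ _).symm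
    · split_ifs with hlr
      · have h5 : B.comp₂ _ _ _ (deg s.left + 1 - s.left.len) (deg s.right + 1 - s.right.len)
            (deg p + 2 - p.len) (twist F.map _ _ s.left _) (twist F.map _ _ s.right _) = 0 := by
          rcases hlr with hl | hl <;> rw [map_of_len F _ hl] <;> simp
        rw [h5, smul_zero, map_zero]
      · rw [not_or] at hlr
        rw [map_units_smul', hAct_of_len F _ hlr.1 rfl, hAct_of_len F _ hlr.2 rfl]
        refine congrArg _ (DGCat.assoc _ _ _ _ _ _ ?_ (by ring))
        rw [← Chain.mem_splits _ s hs, deg_append, Chain.len_append]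
        push_cast
        ring

/-- This is the functor equation of F on the string p·a. The insertions that swallow a give the
subtracted sum, and the m₁ and m₂ terms of the target combine into the first one. -/
lemma ins_fLast {X Y : A.Ob} (p : A.Word X Y) (i e : ℤ) (a : A.Hom X₀ X i) :
    ins (twist A.m) (fun q => fLast F q i e a) p =
      sumOver p.splits (fun s => (eps s.left).negOnePow •
        hAct F s.left (deg s.right + i - s.right.len) e (fLast F s.right i _ a)) -
      sumOver p.splits (fun s => (eps s.left).negOnePow •
        fLast F s.left (deg s.right + i + 1 - s.right.len) e (mLast s.right i _ a)) := by
  have hd : ∀ {Z Y : A.Ob} (q : A.Word X Z), deg (q.append (.cons (A.el i a) (.nil X₀))) + 1 -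
      (q.append (.cons (A.el i a) (.nil X₀))).len = deg q + i - q.len := by
    intro _ _ q
    simp only [deg_append, deg_cons, deg_nil, el_fst, Chain.len_append, len_cons, len_nil]
    push_cast
    ring
  have h := congrFun (ins_snoc A.isOperation.twist (F.isOperation.twist.multilinear X₀ Y) p
    (A.el i a)) e
  rw [pull_pair F _ (by simp), Pi.add_apply, sumOver_apply, Chain.sum_splits_snoc] at h
  have h2 := ins_linear (LinearMap.proj (R := K)
    (φ := fun e => B.Hom (F.obj X₀) (F.obj Y) e) e) (twist A.m)
    (fun q => twist F.map X₀ Y (q.append (.cons (A.el i a) (.nil X₀)))) p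
  refine h2.symm.trans ((eq_sub_of_add_eq h.symm).trans (congrArg₂ (· - ·) ?_ ?_))
  -- Since `hAct` of the empty string is the differential, the splitting with empty left piece is
  -- the m₁ term d(F(p,a)); the other splittings are the m₂ terms.
  · conv_rhs => rw [Chain.sum_splits_left_nil p]
    rw [map_of_len F (.nil X₀) rfl]
    simp only [Pi.zero_apply, map_zero, smul_zero, add_zero]
    refine congrArg₂ (· + ·) ?_ (sumOver_congr _ fun s _ => ?_)
    · rw [hd (Y := X) p, eps_nil, Int.negOnePow_zero, one_smul]
      rfl
    · rw [hd (Y := X) s.right]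
      split_ifs with hl
      · rw [map_of_len F _ hl]
        simp
      · rw [hAct_of_len F _ hl rfl]
        rfl
  · refine sumOver_congr _ fun s _ => congrArg _ ?_
    rw [val_eq 2 (twist A.m) _ (e := deg s.right + i + 1 - s.right.len)]
    · rfl
    · simp only [deg_append, deg_cons, deg_nil, el_fst, Chain.len_append, len_cons, len_nil]
      push_cast
      ring

/-- The first coordinate is `ins_mLast`, the two minus signs in a composite cancelling. The second
is the sum of `ins_fLast` and `ins_hAct`; the minus sign in the first coordinate of `act` produces
the subtracted sum of `ins_fLast`. -/
lemma act_relation {X Y : A.Ob} (p : A.Word X Y) : ins (twist A.m) (act F X₀ X Y) p =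
    sumOver p.splits fun s => (eps s.left).negOnePow •
      (act F X₀ _ _ s.left ∘ₗ act F X₀ _ _ s.right) := by
  refine LinearMap.ext fun t => Prod.ext (funext fun e => ?_) (funext fun e => ?_)
  · let L : (Carrier F X₀ X →ₗ[K] Carrier F X₀ Y) →ₗ[K] A.Hom X₀ Y e :=
      (LinearMap.proj (R := K) (φ := fun e => A.Hom X₀ Y e) e) ∘ₗ (LinearMap.fst K _ _) ∘ₗ
        LinearMap.applyₗ t
    change L _ = L _
    obtain ⟨i, hi⟩ : ∃ i, e - (deg p + 2 - p.len) = i := ⟨_, rfl⟩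
    rw [ins_linear, sumOver_linear]
    refine (ins_congr_degree (ψ := fun q =>
      (-LinearMap.id : A.Hom X₀ Y e →ₗ[K] A.Hom X₀ Y e) (mLast q i e (t.1 i))) _ p
      fun q _ hq => act_fst F q t i e (by omega)).trans ?_
    rw [← ins_linear, ins_mLast]
    simp only [LinearMap.neg_apply, LinearMap.id_apply, neg_neg]
    refine sumOver_congr _ fun s hs => ?_
    rw [map_units_smul']
    refine congrArg _ ?_
    rw [← Chain.mem_splits _ s hs, deg_append, Chain.len_append] at hi
    push_cast at hi
    have h1 := act_fst F s.left (act F X₀ _ _ s.right t) (deg s.right + i + 1 - s.right.len) e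
      (by omega)
    rw [act_fst F s.right t i _ (by omega), map_neg, neg_neg] at h1
    exact h1.symm
  · let L : (Carrier F X₀ X →ₗ[K] Carrier F X₀ Y) →ₗ[K] B.Hom (F.obj X₀) (F.obj Y) e :=
      (LinearMap.proj (R := K) (φ := fun e => B.Hom (F.obj X₀) (F.obj Y) e) e) ∘ₗ
        (LinearMap.snd K _ _) ∘ₗ LinearMap.applyₗ t
    change L _ = L _
    obtain ⟨i, hi⟩ : ∃ i, e + 1 - (deg p + 2 - p.len) = i := ⟨_, rfl⟩
    obtain ⟨j, hj⟩ : ∃ j, e - (deg p + 2 - p.len) = j := ⟨_, rfl⟩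
    rw [ins_linear, sumOver_linear]
    refine (ins_congr_degree (ψ := fun q => fLast F q i e (t.1 i) + hAct F q j e (t.2 j)) _ p
      fun q _ hq => act_snd F q t i j e (by omega) (by omega)).trans ?_
    rw [ins_add, ins_fLast, ins_hAct,
      sub_add_eq_add_sub, sub_eq_iff_eq_add, ← sumOver_add, ← sumOver_add]
    refine sumOver_congr _ fun s hs => ?_
    rw [map_units_smul', ← smul_add, ← smul_add]
    refine congrArg _ ?_
    rw [← Chain.mem_splits _ s hs, deg_append, Chain.len_append] at hi hj
    push_cast at hi hj
    have h1 := act_snd F s.left (act F X₀ _ _ s.right t) (deg s.right + i + 1 - s.right.len)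
      (j + (deg s.right + 1 - s.right.len)) e (by omega) (by omega)
    rw [act_fst F s.right t i _ (by omega), act_snd F s.right t i j _ (by omega) (by omega),
      map_neg, map_add] at h1
    have h3 : L (act F X₀ _ _ s.left ∘ₗ act F X₀ _ _ s.right) = _ := h1
    rw [h3]
    have h2 : deg s.right + i - s.right.len = j + (deg s.right + 1 - s.right.len) := by omega
    rw [h2]
    abel

variable (X₀)

variable {X₀} in
lemma multilinear_mLast {X Y : A.Ob} (i e : ℤ) (a : A.Hom X₀ X i) :
    IsMultilinear (fun q : A.Word X Y => mLast q i e a) where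
  add u f g w := by
    have h := congrFun ((A.isOperation.twist.multilinear X₀ Y).add u f g
      (w.append (.cons (A.el i a) (.nil X₀)))) e
    simp only [mLast, LinearMap.coe_mk, AddHom.coe_mk, Chain.append_assoc, Chain.append]
    exact h
  smul u c f w := by
    have h := congrFun ((A.isOperation.twist.multilinear X₀ Y).smul u c f
      (w.append (.cons (A.el i a) (.nil X₀)))) e
    simp only [mLast, LinearMap.coe_mk, AddHom.coe_mk, Chain.append_assoc, Chain.append]
    exact h

variable {X₀} in
lemma multilinear_fLast {X Y : A.Ob} (i e : ℤ) (a : A.Hom X₀ X i) :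
    IsMultilinear (fun q : A.Word X Y => fLast F q i e a) where
  add u f g w := by
    have h := congrFun ((F.isOperation.twist.multilinear X₀ Y).add u f g
      (w.append (.cons (A.el i a) (.nil X₀)))) e
    simp only [fLast, LinearMap.coe_mk, AddHom.coe_mk, Chain.append_assoc, Chain.append]
    exact h
  smul u c f w := by
    have h := congrFun ((F.isOperation.twist.multilinear X₀ Y).smul u c f
      (w.append (.cons (A.el i a) (.nil X₀)))) e
    simp only [fLast, LinearMap.coe_mk, AddHom.coe_mk, Chain.append_assoc, Chain.append]
    exact h

lemma act_multilinear (X Y : A.Ob) : IsMultilinear (act F X₀ X Y) where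
  add {Z Z' d} u f g w := by
    -- The degree of the action depends only on d, u and w, not on the entry of degree d, so the
    -- same components are involved for f, g and f + g.
    obtain ⟨n, hn⟩ : ∃ n : ℤ, ∀ f : A.Hom Z Z' d, deg (u.append (.cons (A.el d f) w)) + 1 -
        (u.append (.cons (A.el d f) w)).len = n :=
      ⟨deg u + (d + deg w) + 1 - (u.len + (w.len + 1) : ℕ), fun f => by
        simp only [deg_append, deg_cons, el_fst, Chain.len_append, len_cons]⟩
    refine LinearMap.ext fun t => Prod.ext (funext fun e => ?_) (funext fun e => ?_)
    · have h := fun f => act_fst F _ t _ e (congrArg (e - ·) (hn f))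
      simp only [LinearMap.add_apply, Prod.fst_add, Pi.add_apply, h, ← neg_add]
      exact congrArg _ ((multilinear_mLast _ e _).add u f g w)
    · have h := fun f => act_snd F _ t _ _ e (congrArg (e + 1 - ·) (hn f))
        (congrArg (e - ·) (hn f))
      have h' := fun f => hAct_of_len (W := F.obj X₀) F (u.append (.cons (A.el d f) w)) (by simp)
        (hn f)
      simp only [LinearMap.add_apply, Prod.snd_add, Pi.add_apply, h, h']
      rw [add_add_add_comm]
      refine congrArg₂ (· + ·) ((multilinear_fLast F _ e _).add u f g w) ?_
      rw [(F.isOperation.twist.multilinear X Y).add u f g w]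
      exact LinearMap.map_add₂ _ _ _ _
  smul {Z Z' d} u c f w := by
    obtain ⟨n, hn⟩ : ∃ n : ℤ, ∀ f : A.Hom Z Z' d, deg (u.append (.cons (A.el d f) w)) + 1 -
        (u.append (.cons (A.el d f) w)).len = n :=
      ⟨deg u + (d + deg w) + 1 - (u.len + (w.len + 1) : ℕ), fun f => by
        simp only [deg_append, deg_cons, el_fst, Chain.len_append, len_cons]⟩
    refine LinearMap.ext fun t => Prod.ext (funext fun e => ?_) (funext fun e => ?_)
    · have h := fun f => act_fst F _ t _ e (congrArg (e - ·) (hn f))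
      simp only [LinearMap.smul_apply, Prod.smul_fst, Pi.smul_apply, h, smul_neg]
      exact congrArg _ ((multilinear_mLast _ e _).smul u c f w)
    · have h := fun f => act_snd F _ t _ _ e (congrArg (e + 1 - ·) (hn f))
        (congrArg (e - ·) (hn f))
      have h' := fun f => hAct_of_len (W := F.obj X₀) F (u.append (.cons (A.el d f) w)) (by simp)
        (hn f)
      simp only [LinearMap.smul_apply, Prod.smul_snd, Pi.smul_apply, h, h', smul_add]
      refine congrArg₂ (· + ·) ((multilinear_fLast F _ e _).smul u c f w) ?_
      rw [(F.isOperation.twist.multilinear X Y).smul u c f w]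
      exact LinearMap.map_smul₂ _ _ _ _

/-- The modules underlying the cone of `F`. -/
abbrev family : DGFamily K A.Ob where
  T := Carrier F X₀
  Z Y e :=
    -- The component of degree e of the cone is A(X₀,Y)^e ⊕ B(FX₀,FY)^(e-1).
    { carrier := {t | t.1 e = 0 ∧ t.2 (e - 1) = 0}
      add_mem' := fun hs ht =>
        ⟨(congrArg₂ (· + ·) hs.1 ht.1).trans (add_zero _),
          (congrArg₂ (· + ·) hs.2 ht.2).trans (add_zero _)⟩
      zero_mem' := ⟨rfl, rfl⟩
      smul_mem' := fun c _ ht =>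
        ⟨(congrArg (c • ·) ht.1).trans (smul_zero _), (congrArg (c • ·) ht.2).trans (smul_zero _)⟩ }
  D Y := act F X₀ Y Y (.nil Y)
  D_mem {Y e} e' t h ht := by
    subst h
    refine ⟨?_, ?_⟩
    · rw [act_fst F (.nil Y) t e _ (by simp), ht.1, map_zero, neg_zero]
    · rw [act_snd F (.nil Y) t e (e - 1) _ (by simp) (by simp), ht.1, ht.2, map_zero, map_zero,
        add_zero]
  D_D {Y} t := by
    -- On the empty string the only insertion is m₀ = 0 and the only splitting gives D∘D.
    have h := act_relation F (X₀ := X₀) (.nil Y)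
    have h' := (act_multilinear F X₀ Y Y).val_zero' (c := 2) (A.isOperation.twist.nil Y) (.nil Y)
    dsimp only [id] at h'
    rw [ins_nil, h', Chain.sum_splits_nil, eps_nil, Int.negOnePow_zero, one_smul] at h
    exact (congrArg (fun f => f t) h).symm

/-- The cone of `F` on the morphisms out of `X₀`, as an `A_∞` module. -/
def module : AInfModule A where
  toDGFamily := family F X₀
  act := act F X₀
  act_nil _ := rfl
  act_mem {X Y} p e e' t h ht := by
    refine ⟨?_, ?_⟩
    · rw [act_fst F p t e _ (by omega), ht.1, map_zero, neg_zero]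
    · rw [act_snd F p t e (e - 1) _ (by omega) (by omega), ht.1, ht.2, map_zero, map_zero,
        add_zero]
  multilinear := act_multilinear F X₀
  relation := act_relation F
  act_one X := by
    -- The shift sign for the pair (1, a) is -1; it cancels the minus sign in the first coordinate
    -- of the action, so that the identity acts as the identity.
    have hk : ∀ e (a : A.Hom X₀ X e), kap ((Chain.cons (A.el 0 (A.one X)) (.nil X)).append
        (.cons (A.el e a) (.nil X₀))) = 1 := fun e a => by simp [Chain.append, kap_cons]
    refine LinearMap.ext fun t => Prod.ext (funext fun e => ?_) (funext fun e => ?_)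
    · rw [act_fst F _ t e e (by simp)]
      simp only [mLast, LinearMap.coe_mk, AddHom.coe_mk, twist, hk, Int.negOnePow_one,
        Units.neg_smul, one_smul, neg_neg]
      exact A.one_comp (t.1 e)
    · rw [act_snd F _ t (e + 1) e e (by simp) (by simp), hAct_of_len F _ (by simp) (n := 0)
        (by simp)]
      have h0 : fLast F (.cons (A.el 0 (A.one X)) (.nil X)) (e + 1) e (t.1 (e + 1)) = 0 :=
        congrFun (twist_eq_zero (F.map_unit (.nil X)
          (.cons (A.el (e + 1) (t.1 (e + 1))) (.nil X₀)) (by simp))) e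
      have h1 : twist F.map X X (.cons (A.el 0 (A.one X)) (.nil X)) 0 = B.one (F.obj X) := by
        refine Eq.trans ?_ (F.map_one X)
        simp [twist, kap_cons]
      rw [h0, h1, zero_add]
      exact DGCat.one_comp₂ _
  act_unit u w h := by
    refine LinearMap.ext fun t => Prod.ext (funext fun e => ?_) (funext fun e => ?_)
    · rw [act_fst F _ t _ e rfl]
      have h0 := fun i (a : A.Hom X₀ _ i) => A.m_unit u (w.append (.cons (A.el i a) (.nil X₀)))
        (by rw [Chain.len_append, len_cons, len_nil]; omega)
      simp only [mLast, LinearMap.coe_mk, AddHom.coe_mk, twist, Chain.append_assoc, Chain.append,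
        h0, Pi.zero_apply, smul_zero, neg_zero]
      rfl
    · rw [act_snd F _ t _ _ e rfl rfl, hAct_of_len F _ (by simp) rfl]
      have h0 := fun i (a : A.Hom X₀ _ i) => F.map_unit u (w.append (.cons (A.el i a) (.nil X₀)))
        (by rw [Chain.len_append, len_cons, len_nil]; omega)
      simp only [fLast, LinearMap.coe_mk, AddHom.coe_mk, twist, Chain.append_assoc, Chain.append,
        h0, F.map_unit u w h, Pi.zero_apply, smul_zero, map_zero]
      exact add_zero _

end Cone

/-! ### The free dg category acting on the cone of the universal functor. -/

namespace Contraction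

variable (A : AInfCat.{u} K) (X₀ : A.Ob)

/-- The cone of the universal functor, as a module over the free dg category. -/
abbrev M : AInfModule A := Cone.module (freeUnit A) X₀

/-- The action of the free dg category on the cone of the universal functor. -/
def ev {X Y : A.Ob} {d : ℤ} (v : FreeHom A X Y d) :
    Cone.Carrier (freeUnit A) X₀ X →ₗ[K] Cone.Carrier (freeUnit A) X₀ Y :=
  (FreeHom.eval (M A X₀).functor X Y d v).1

variable {A}

lemma ev_gen {X Y : A.Ob} (p : A.Word X Y) (e : ℤ) :
    ev A X₀ (FreeHom.mk (.gen p e)) = (kap p).negOnePow • ((M A X₀).op X Y p e).1 := by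
  change ((kap p).negOnePow • (M A X₀).op X Y p e).1 = _
  rcases Int.units_eq_one_or (kap p).negOnePow with h | h <;> rw [h] <;> simp

/-- Evaluation is compatible with differentials, and the differential of a linear map is its graded
commutator with D. -/
lemma ev_diff {X Y : A.Ob} {i j : ℤ} (v : FreeHom A X Y i) (h : i + 1 = j) :
    ev A X₀ (FreeHom.diff X Y i j v) = Cone.act (freeUnit A) X₀ Y Y (.nil Y) ∘ₗ ev A X₀ v -
      i.negOnePow • (ev A X₀ v ∘ₗ Cone.act (freeUnit A) X₀ X X (.nil X)) :=
  (congrArg Subtype.val (FreeHom.eval_diff (M A X₀).functor v)).trans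
    (DGFamily.dHom_coe (M := (M A X₀).toDGFamily) _ h)

lemma ev_comp {X Y Z : A.Ob} {i j k : ℤ} (g : FreeHom A Y Z i) (f : FreeHom A X Y j)
    (h : i + j = k) : ev A X₀ (FreeHom.comp X Y Z i j k g f) = ev A X₀ g ∘ₗ ev A X₀ f :=
  (congrArg Subtype.val (FreeHom.eval_comp (M A X₀).functor g f)).trans
    (DGFamily.compHom_coe (M := (M A X₀).toDGFamily) _ _ h)

lemma ev_zero (X Y : A.Ob) (d : ℤ) : ev A X₀ (0 : FreeHom A X Y d) = 0 :=
  congrArg Subtype.val (map_zero (FreeHom.eval (M A X₀).functor X Y d))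

lemma ev_add {X Y : A.Ob} {d : ℤ} (v w : FreeHom A X Y d) :
    ev A X₀ (v + w) = ev A X₀ v + ev A X₀ w :=
  congrArg Subtype.val (map_add (FreeHom.eval (M A X₀).functor X Y d) v w)

lemma ev_smul {X Y : A.Ob} {d : ℤ} (a : K) (v : FreeHom A X Y d) :
    ev A X₀ (a • v) = a • ev A X₀ v :=
  congrArg Subtype.val (map_smul (FreeHom.eval (M A X₀).functor X Y d) a v)

variable {X₀}

lemma D_fst {Y : A.Ob} (t : Cone.Carrier (freeUnit A) X₀ Y) (i e : ℤ) (h : i + 1 = e) :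
    (Cone.act (freeUnit A) X₀ Y Y (.nil Y) t).1 e = -A.m₁ X₀ Y i e (t.1 i) := by
  rw [Cone.act_fst _ _ t i e (by simp; omega)]
  refine congrArg _ ?_
  simp only [Cone.mLast, LinearMap.coe_mk, AddHom.coe_mk, Chain.append, twist, kap_cons, kap_nil,
    len_nil, Nat.cast_zero, mul_zero, add_zero, Int.negOnePow_zero, one_smul]
  rfl

/-- The linear part of the universal functor. -/
def unitLin (A : AInfCat.{u} K) (X Y : A.Ob) (d : ℤ) : A.Hom X Y d →ₗ[K] FreeHom A X Y d :=
  linPart (isOperation_unitOp A) X Y d d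

lemma D_snd {Y : A.Ob} (t : Cone.Carrier (freeUnit A) X₀ Y) (i e : ℤ) (h : i + 1 = e) :
    (Cone.act (freeUnit A) X₀ Y Y (.nil Y) t).2 e =
      unitLin A X₀ Y e (t.1 e) + FreeHom.diff X₀ Y i e (t.2 i) := by
  rw [Cone.act_snd _ _ t e i e (by simp) (by simp; omega)]
  refine congrArg₂ (· + ·) ?_ rfl
  simp only [Cone.fLast, LinearMap.coe_mk, AddHom.coe_mk, Chain.append, twist, kap_cons, kap_nil,
    len_nil, Nat.cast_zero, mul_zero, add_zero, Int.negOnePow_zero, one_smul]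
  rfl

/-- On the second summand of the cone, the action is the composition. -/
lemma ev_of_fst_eq_zero {X Y : A.Ob} {d : ℤ} (v : FreeHom A X Y d) :
    ∀ t : Cone.Carrier (freeUnit A) X₀ X, t.1 = 0 → (ev A X₀ v t).1 = 0 ∧
      ∀ j e : ℤ, e - d = j → (ev A X₀ v t).2 e = FreeHom.comp X₀ X Y d j e v (t.2 j) := by
  -- This disposes of the ill-graded generators, differentials and composites, whose classes are
  -- zero.
  have hzero : ∀ {X Y : A.Ob} {d : ℤ} (v : FreeHom A X Y d), v = 0 → ev A X₀ v = 0 →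
      ∀ t : Cone.Carrier (freeUnit A) X₀ X, t.1 = 0 → (ev A X₀ v t).1 = 0 ∧
      ∀ j e : ℤ, e - d = j → (ev A X₀ v t).2 e = FreeHom.comp X₀ X Y d j e v (t.2 j) := by
    intro X Y d v hv h t _
    rw [h, hv]
    exact ⟨rfl, fun j e _ => (LinearMap.map_zero₂ _ _).symm⟩
  induction v using FreeHom.induction with
  | @gen X Y p n =>
    by_cases h : p.len ≠ 0 ∧ deg p + 1 - p.len = n
    · intro t ht
      obtain ⟨hp, rfl⟩ := h
      have hev : ev A X₀ (FreeHom.mk (.gen p (deg p + 1 - p.len))) =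
          (kap p).negOnePow • Cone.act (freeUnit A) X₀ X Y p :=
        (ev_gen X₀ p _).trans (congrArg _ ((M A X₀).op_coe p hp rfl))
      rw [hev]
      refine ⟨funext fun e => ?_, fun j e h => ?_⟩
      · have h1 := Cone.act_fst (freeUnit A) p t _ e rfl
        rw [ht, Pi.zero_apply, map_zero, neg_zero] at h1
        exact (congrArg ((kap p).negOnePow • ·) h1).trans (smul_zero _)
      · have h1 := Cone.act_snd (freeUnit A) p t _ j e rfl h
        rw [ht, Pi.zero_apply, map_zero, zero_add, Cone.hAct_of_len _ p hp rfl] at h1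
        refine (congrArg ((kap p).negOnePow • ·) h1).trans ?_
        -- The sign `kap p` occurs twice, in the functor attached to the module and in the shifted
        -- value F(p) used by the cone, and so cancels.
        change (kap p).negOnePow • ((FreeHom.comp X₀ X Y (deg p + 1 - p.len) j e).flip (t.2 j))
          ((kap p).negOnePow • FreeHom.mk (.gen p (deg p + 1 - p.len))) = _
        rw [map_units_smul', smul_smul, Int.units_mul_self, one_smul]
        rfl
    · refine hzero _ ?_ ?_
      · by_cases hp : p.len = 0
        · obtain ⟨rfl, rfl⟩ := Chain.len_eq_zero p hp
          exact congrFun ((isOperation_unitOp A).nil X) n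
        · exact (isOperation_unitOp A).degree p n fun h' => h ⟨hp, h'.symm⟩
      · rw [ev_gen]
        exact (congrArg ((kap p).negOnePow • ·) (if_neg h)).trans
          (smul_zero (A := Cone.Carrier (freeUnit A) X₀ X →ₗ[K] Cone.Carrier (freeUnit A) X₀ Y) _)
  | one X =>
    intro t ht
    refine ⟨ht, fun j e h => ?_⟩
    obtain rfl : e = j := by omega
    exact ((freeData A).one_comp (t.2 e)).symm
  | @diff X Y i i' f h =>
    by_cases hi : i + 1 = i'
    · intro t ht
      -- The second summand is a subcomplex, so the induction hypothesis also applies to D t.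
      have hD : (Cone.act (freeUnit A) X₀ X X (.nil X) t).1 = 0 := funext fun e => by
        rw [D_fst t (e - 1) e (by ring), ht, Pi.zero_apply, map_zero, neg_zero]
        rfl
      have h1 := h t ht
      have h2 := h _ hD
      rw [ev_diff X₀ f hi]
      refine ⟨funext fun e => ?_, fun j e hj => ?_⟩
      · have h3 := D_fst (ev A X₀ f t) (e - 1) e (by ring)
        rw [h1.1, Pi.zero_apply, map_zero, neg_zero] at h3
        refine (congrArg₂ (· - ·) h3 (congrArg (i.negOnePow • ·) (congrFun h2.1 e))).trans ?_
        simp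
      · have h3 := D_snd (ev A X₀ f t) (e - 1) e (by ring)
        rw [h1.1, Pi.zero_apply, map_zero, zero_add, h1.2 j (e - 1) (by omega)] at h3
        have h4 := h2.2 (j + 1) e (by omega)
        rw [D_snd t j (j + 1) rfl, ht, Pi.zero_apply, map_zero, zero_add] at h4
        have h5 := (freeData A).leibniz i' (j + 1) (e - 1) e f (t.2 j) hi rfl (by omega) (by ring)
        refine (congrArg₂ (· - ·) h3 (congrArg (i.negOnePow • ·) h4)).trans ?_
        exact sub_eq_iff_eq_add.2 h5
    · have h0 := (freeData A).d_degree f hi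
      refine hzero _ h0 ?_
      exact (congrArg (ev A X₀) h0).trans (ev_zero X₀ X Y i')
  | @comp X Y Z i j k g f hg hf =>
    by_cases hk : i + j = k
    · intro t ht
      have h1 := hf t ht
      have h2 := hg _ h1.1
      rw [ev_comp X₀ g f hk]
      refine ⟨h2.1, fun l e hl => ?_⟩
      refine (h2.2 (e - i) e rfl).trans ?_
      rw [h1.2 l (e - i) (by omega)]
      exact ((freeData A).assoc k (e - i) e g f (t.2 l) hk (by omega)).symm
    · have h0 := (freeData A).comp_degree g f hk
      refine hzero _ h0 ?_
      exact (congrArg (ev A X₀) h0).trans (ev_zero X₀ X Z k)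
  | zero X Y e => exact hzero _ rfl (ev_zero X₀ X Y e)
  | add f g hf hg =>
    intro t ht
    rw [ev_add]
    refine ⟨?_, fun j e h => ?_⟩
    · rw [LinearMap.add_apply, Prod.fst_add, (hf t ht).1, (hg t ht).1, add_zero]
    · rw [LinearMap.add_apply, Prod.snd_add, Pi.add_apply, (hf t ht).2 j e h, (hg t ht).2 j e h]
      exact (LinearMap.map_add₂ _ _ _ _).symm
  | smul a f h =>
    intro t ht
    rw [ev_smul]
    refine ⟨?_, fun j e h' => ?_⟩
    · rw [LinearMap.smul_apply, Prod.smul_fst, (h t ht).1, smul_zero]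
    · rw [LinearMap.smul_apply, Prod.smul_snd, Pi.smul_apply, (h t ht).2 j e h']
      exact (LinearMap.map_smul₂ _ _ _ _).symm

variable (A X₀) in
/-- The identity of `X₀` in the first summand of the cone. -/
def gen : Cone.Carrier (freeUnit A) X₀ X₀ := (Pi.single 0 (A.one X₀), 0)

variable (A X₀) in
/-- The action on the identity, with values in the first summand: a retraction of the universal
functor. -/
def ret (Y : A.Ob) (d : ℤ) : FreeHom A X₀ Y d →ₗ[K] A.Hom X₀ Y d where
  -- The differential of the cone is -m₁ on the first summand; the sign (-1)^d turns the resulting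
  -- anticommutation into commutation.
  toFun v := d.negOnePow • (ev A X₀ v (gen A X₀)).1 d
  map_add' v w := by
    rw [ev_add, LinearMap.add_apply, Prod.fst_add, Pi.add_apply, smul_add]
  map_smul' a v := by
    rw [ev_smul, LinearMap.smul_apply, Prod.smul_fst, Pi.smul_apply, smul_comm]
    rfl

variable (A X₀) in
/-- The action on the identity, with values in the second summand: a contracting homotopy. -/
def htpy (Y : A.Ob) (d e : ℤ) : FreeHom A X₀ Y d →ₗ[K] FreeHom A X₀ Y e where
  toFun v := d.negOnePow • (ev A X₀ v (gen A X₀)).2 e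
  map_add' v w := by
    rw [ev_add, LinearMap.add_apply, Prod.snd_add, Pi.add_apply, smul_add]
  map_smul' a v := by
    rw [ev_smul, LinearMap.smul_apply, Prod.smul_snd, Pi.smul_apply, smul_comm]
    rfl

/-- Identities are cycles in a strictly unital A∞ category. -/
lemma D_gen_fst : (Cone.act (freeUnit A) X₀ X₀ X₀ (.nil X₀) (gen A X₀)).1 = 0 := by
  funext e
  rw [D_fst _ (e - 1) e (by ring)]
  by_cases h : e - 1 = 0
  · rw [h]
    have h1 : (gen A X₀).1 0 = A.one X₀ := Pi.single_eq_same (M := fun e => A.Hom X₀ X₀ e) 0 (A.one X₀)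
    rw [h1]
    exact (congrArg _ (congrFun (A.m_one X₀) e)).trans neg_zero
  · have h1 : (gen A X₀).1 (e - 1) = 0 := Pi.single_eq_of_ne (M := fun e => A.Hom X₀ X₀ e) h (A.one X₀)
    rw [h1, map_zero, neg_zero]
    rfl

/-- The connecting map of the cone is η¹, which preserves identities. This is how v itself enters
`htpy_diff`. -/
lemma D_gen_snd : (Cone.act (freeUnit A) X₀ X₀ X₀ (.nil X₀) (gen A X₀)).2 0 =
    FreeHom.mk (.one X₀) := by
  rw [D_snd _ (-1) 0 (by ring)]
  have h1 : (gen A X₀).1 0 = A.one X₀ := Pi.single_eq_same (M := fun e => A.Hom X₀ X₀ e) 0 (A.one X₀)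
  have h2 : (gen A X₀).2 (-1) = 0 := rfl
  rw [h1, h2, map_zero, add_zero]
  exact (freeUnit A).map_one X₀

/-- The first coordinate of the commutator formula `ev_diff` applied to `gen`: the term v·D(gen)
does not contribute, since D(gen) lies in the second summand and v preserves that summand. -/
lemma ret_diff {Y : A.Ob} {i j : ℤ} (v : FreeHom A X₀ Y i) (h : i + 1 = j) :
    ret A X₀ Y j (FreeHom.diff X₀ Y i j v) = A.m₁ X₀ Y i j (ret A X₀ Y i v) := by
  subst h
  have h1 := D_fst (ev A X₀ v (gen A X₀)) i (i + 1) rfl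
  have h2 := congrFun (ev_of_fst_eq_zero v _ D_gen_fst).1 (i + 1)
  simp only [ret, LinearMap.coe_mk, AddHom.coe_mk]
  rw [ev_diff X₀ v rfl, map_units_smul', Int.negOnePow_succ, Units.neg_smul, ← smul_neg]
  refine congrArg _ ?_
  refine (congrArg Neg.neg (congrArg₂ (· - ·) h1 (congrArg (i.negOnePow • ·) h2))).trans ?_
  simp

/-- The second coordinate of the same formula: D(v·gen) contributes η¹ of the retraction and the
differential of the homotopy, while v·D(gen) is v composed with the identity, hence v. -/
lemma htpy_diff {Y : A.Ob} {i j k : ℤ} (v : FreeHom A X₀ Y j) (h : i + 1 = j) (h' : j + 1 = k) :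
    v = unitLin A X₀ Y j (ret A X₀ Y j v) + FreeHom.diff X₀ Y i j (htpy A X₀ Y j i v) +
      htpy A X₀ Y k j (FreeHom.diff X₀ Y j k v) := by
  have h1 := D_snd (ev A X₀ v (gen A X₀)) i j h
  have h2 := (ev_of_fst_eq_zero v _ D_gen_fst).2 0 j (by ring)
  rw [D_gen_snd] at h2
  have h3 := h2.trans ((freeData A).comp_one v)
  have h4 : (ev A X₀ (FreeHom.diff X₀ Y j k v) (gen A X₀)).2 j =
      unitLin A X₀ Y j ((ev A X₀ v (gen A X₀)).1 j) +
        FreeHom.diff X₀ Y i j ((ev A X₀ v (gen A X₀)).2 i) - j.negOnePow • v :=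
    (congrFun (congrArg Prod.snd (congrArg (fun f => f (gen A X₀)) (ev_diff X₀ v h'))) j).trans
      (congrArg₂ (· - ·) h1 (congrArg (j.negOnePow • ·) h3))
  simp only [ret, htpy, LinearMap.coe_mk, AddHom.coe_mk]
  rw [h4, map_units_smul', map_units_smul', ← h', Int.negOnePow_succ, Units.neg_smul]
  simp only [smul_sub, smul_add, smul_smul, Int.units_mul_self, one_smul, neg_sub]
  exact (add_sub_cancel _ _).symm

/-- The symbol of f acts on the identity with first coordinate -m₂(f, 1) in shifted signs; right
unitality gives f, and the signs cancel. -/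
lemma ret_unitLin {Y : A.Ob} {d : ℤ} (f : A.Hom X₀ Y d) :
    ret A X₀ Y d (unitLin A X₀ Y d f) = f := by
  have hev : ev A X₀ (unitLin A X₀ Y d f) =
      Cone.act (freeUnit A) X₀ X₀ Y (.cons (A.el d f) (.nil X₀)) := by
    refine (ev_gen X₀ (.cons (A.el d f) (.nil X₀)) d).trans ?_
    rw [(M A X₀).op_coe _ (by simp) (by simp)]
    simp only [kap_cons, kap_nil, len_nil, Nat.cast_zero, mul_zero, add_zero,
      Int.negOnePow_zero, one_smul]
    rfl
  have h1 : (gen A X₀).1 0 = A.one X₀ := Pi.single_eq_same (M := fun e => A.Hom X₀ X₀ e) 0 (A.one X₀)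
  simp only [ret, LinearMap.coe_mk, AddHom.coe_mk]
  rw [hev, Cone.act_fst _ _ _ 0 d (by simp), h1]
  have hk : kap ((Chain.cons (A.el d f) (.nil X₀)).append (.cons (A.el 0 (A.one X₀)) (.nil X₀))) =
    d + 1 := by simp [Chain.append, kap_cons]
  simp only [Cone.mLast, LinearMap.coe_mk, AddHom.coe_mk, twist, hk, Int.negOnePow_succ,
    Units.neg_smul, neg_neg, smul_smul, Int.units_mul_self, one_smul]
  exact A.comp_one f

end Contraction

/-! ### The unit and the counit are quasi-isomorphisms. -/

open Contraction

/-- The contracting homotopy, as a family of maps vanishing off the degree `-1`. -/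
def htpyIf (A : AInfCat.{u} K) (X Y : A.Ob) (i j : ℤ) : FreeHom A X Y i →ₗ[K] FreeHom A X Y j :=
  if j + 1 = i then htpy A X Y i j else 0

lemma htpyIf_of_eq (A : AInfCat.{u} K) (X Y : A.Ob) {i j : ℤ} (h : j + 1 = i) :
    htpyIf A X Y i j = htpy A X Y i j := if_pos h

/-- The contracting homotopy, on the complexes of morphisms. -/
def htpyHom (A : AInfCat.{u} K) (X Y : A.Ob) (i j : ℤ) :
    ((freeDG A).homComplex X Y).X i ⟶ ((freeDG A).homComplex X Y).X j :=
  ModuleCat.ofHom (htpyIf A X Y i j)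

/-- The retraction of the universal functor, on the complexes of morphisms. -/
def retHom (A : AInfCat.{u} K) (X Y : A.Ob) :
    (freeDG A).homComplex X Y ⟶ A.homComplex X Y where
  f i := ModuleCat.ofHom (ret A X Y i)
  comm' _ _ hij := ModuleCat.hom_ext (LinearMap.ext fun v => (ret_diff v hij).symm)

/-- The universal functor and its retraction are inverse homotopy equivalences on the complexes
of morphisms. -/
def freeUnitHomotopyEquiv (A : AInfCat.{u} K) (X Y : A.Ob) :
    HomotopyEquiv (A.homComplex X Y) ((freeDG A).homComplex X Y) where
  hom := (freeUnit A).homMap X Y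
  inv := retHom A X Y
  homotopyHomInvId := Homotopy.ofEq (by
    ext i f
    exact ret_unitLin f)
  -- The identity `htpy_diff` expresses v through η(r v), which is a homotopy from the identity to
  -- the composite; the reverse direction is required.
  homotopyInvHomId := Homotopy.symm
    { hom := htpyHom A X Y
      zero := fun i j h => congrArg ModuleCat.ofHom (if_neg h)
      comm := fun j => by
        rw [dNext_eq _ (i' := j + 1) rfl, prevD_eq _ (j' := j - 1) (sub_add_cancel j 1)]
        refine ModuleCat.hom_ext (LinearMap.ext fun v => ?_)
        have key : ∀ v : FreeHom A X Y j, v =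
            htpyIf A X Y (j + 1) j (FreeHom.diff X Y j (j + 1) v) +
            FreeHom.diff X Y (j - 1) j (htpyIf A X Y j (j - 1) v) +
            unitLin A X Y j (ret A X Y j v) := fun v => by
          rw [htpyIf_of_eq A X Y rfl, htpyIf_of_eq A X Y (sub_add_cancel j 1)]
          refine (htpy_diff v (sub_add_cancel j 1) rfl).trans ?_
          rw [add_assoc, add_comm, add_comm (FreeHom.diff _ _ _ _ _)]
        exact key v }

lemma isQuasiIso_freeUnit (A : AInfCat.{u} K) : (freeUnit A).IsQuasiIso :=
  ⟨Function.bijective_id, fun X Y => (freeUnitHomotopyEquiv A X Y).quasiIso_hom⟩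

lemma AInfFunctor.homMap_comp_strict {A : AInfCat.{u} K} {B C : DGCat.{u} K}
    (F : AInfFunctor A B.toAInfCat) (G : DGFunctor B C) (X Y : A.Ob) :
    (F.comp G.toAInfFunctor).homMap X Y = F.homMap X Y ≫ G.homMap (F.obj X) (F.obj Y) := by
  ext i f
  exact comp_strict_map F G _ i

lemma AInfFunctor.isQuasiIso_idFunctor (A : AInfCat.{u} K) : (idFunctor A).IsQuasiIso := by
  refine ⟨Function.bijective_id, fun X Y => ?_⟩
  have h : (idFunctor A).homMap X Y = 𝟙 (A.homComplex X Y) := by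
    ext i f
    exact Pi.single_eq_same (M := fun e => A.Hom X Y e) i f
  exact h ▸ inferInstanceAs (QuasiIso (𝟙 (A.homComplex X Y)))

/-- Two out of three: the second factor. -/
lemma DGFunctor.isQuasiIso_of_comp {A : AInfCat.{u} K} {B C : DGCat.{u} K}
    {F : AInfFunctor A B.toAInfCat} {G : DGFunctor B C} (hF : F.IsQuasiIso)
    (hFG : (F.comp G.toAInfFunctor).IsQuasiIso) : G.IsQuasiIso := by
  refine ⟨(Function.Bijective.of_comp_iff G.obj hF.1).1 hFG.1, fun X Y => ?_⟩
  -- Surjectivity of F on objects reduces the claim to morphism complexes between objects in its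
  -- image, where F and the composite are quasi-isomorphisms.
  obtain ⟨X, rfl⟩ := hF.1.2 X
  obtain ⟨Y, rfl⟩ := hF.1.2 Y
  have h := hFG.2 X Y
  rw [F.homMap_comp_strict G] at h
  have := hF.2 X Y
  exact (quasiIso_iff_comp_left (F.homMap X Y) _).1 h

end AInf

theorem proposition2p1 (K : Type u) [Field K] :
    ∃ (V : AInf.AInfCat.{u} K ⥤ AInf.DGCat.{u} K) (adj : V ⊣ AInf.DGCat.inclusion.{u} K),
      (∀ A : AInf.AInfCat.{u} K,
        AInf.NUAInfFunctor.IsQuasiIso (AInf.AInfFunctor.toNUAInfFunctor (adj.unit.app A))) ∧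
      ∀ B : AInf.DGCat.{u} K,
        AInf.NUAInfFunctor.IsQuasiIso (AInf.AInfFunctor.toNUAInfFunctor
          ((AInf.DGCat.inclusion.{u} K).map (adj.counit.app B))) := by
  have hunit : ∀ A : AInf.AInfCat.{u} K, AInf.NUAInfFunctor.IsQuasiIso
      (AInf.AInfFunctor.toNUAInfFunctor ((AInf.freeAdjunction K).unit.app A)) := fun A =>
    (AInf.freeAdjunction_unit A).symm ▸ AInf.isQuasiIso_freeUnit A
  refine ⟨AInf.freeFunctor K, AInf.freeAdjunction K, hunit, fun B => ?_⟩
  refine AInf.DGFunctor.isQuasiIso_of_comp (G := (AInf.freeAdjunction K).counit.app B)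
    (hunit B.toAInfCat) ?_
  -- The composite of the unit at B with the included counit is the identity, which is a
  -- quasi-isomorphism; two out of three then gives the counit.
  have h := (AInf.freeAdjunction K).right_triangle_components B
  have h' : AInf.NUAInfFunctor.IsQuasiIso
      (AInf.AInfFunctor.toNUAInfFunctor (𝟙 ((AInf.DGCat.inclusion K).obj B))) :=
    AInf.AInfFunctor.isQuasiIso_idFunctor B.toAInfCat
  rw [← h] at h'
  exact h'
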